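/- \textbf{Setting.} Fix $d,T\ge 1$, $\beta\in[-1,1]^d$, and closed sets $C_1,\dots,C_T\subseteq[-1,1]^d$, each of positive Lebesgue measure and contained in the ball of radius $r$ centred at the origin. In round $t$ an algorithm draws an action $x_t\in C_t$ from a distribution $\pi_t$ that depends on the history, and observes a reward $y_t\in[-1,1]$ whose law, given the past and $x_t$, depends only on $t$ and $x_t$, has mean $\langle\beta,x_t\rangle$, and is such that $\eta_t=y_t-\langle\beta,x_t\rangle$ is $R$-sub-Gaussian ($R>0$): $\mathbb E\,e^{s\eta_t}\le e^{R^2s^2/2}$ for all $s\in\mathbb R$. Let $$\lambda=\min_{t\le T}\lambda_{\min}\big(\mathbb E_{x\sim \mathrm{Unif}(C_t)}[xx^{\top}]\big),\qquad \Delta_{\mathrm{gap}}=\min_{t\le T}\ \inf_{x\in \mathrm{ext}(C_t),\,x\ne x_t^*}\langle\beta,x_t^*-x\rangle ,$$ where $\mathrm{ext}(C_t)$ is the set of extreme points of $C_t$ and $x_t^*$ is one that maximizes $\langle\beta,\cdot\rangle$. The pseudo-regret is $R(T)=\sum_{t\le T}\max_{x\in C_t}\langle\beta,x\rangle-\mathbb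 E\sum_{t\le T}y_t$. A distribution $\pi$ on $C_t$ is \emph{round-fair} if it is a finite mixture of probability distributions on $C_t$, each of which is discrete or has a Lebesgue density, and each of which has mass function (respectively density) $g$ with $g(x)\ge g(x')$ whenever $x,x'\in C_t$ and $\langle\beta,x\rangle\ge\langle\beta,x'\rangle$. \textbf{Algorithm} FairGap, with inputs $\delta\in(0,1]$, $c>0$, $r,R,\lambda$. In round $t$ let $X,Y$ be the design matrix and reward vector of the $n$ earlier rounds in which the action was drawn uniformly, and let $\delta_t=\min(\delta,t^{-(1+c)})$. If $n\le 2r^2\ln(2dt/\delta_t)/\lambda$, play uniformly at random from $C_t$. Otherwise let $$\hat\beta=(X^{\top}X)^{-1}X^{\top}Y,\quad \kappa_t=1-r\sqrt{\tfrac{2\ln(2dt/\delta_t)}{n\lambda}},\quad w=\frac{2r^2R\sqrt{\ln(2t/\delta_t)}}{\kappa_t\lambda\sqrt n},$$ let $x_1$ be an extreme point of $C_t$ that maximizes $\langle\hat\beta,\cdot\rangle$, and let $v_2$ be the supremum of $\langle\hat\beta,\cdot\rangle$ over the other extreme points. If $[\langle\hat\beta,x_1\rangle-w,\langle\hat\beta,x_1\rangle+w]$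 and $[v_2-w,v_2+w]$ are disjoint, play $x_1$; otherwise play uniformly at random from $C_t$. \textbf{Theorem.} In this setting $\lambda>0$, and with probability at least $1-\delta$ the distribution $\pi_t$ used by FairGap is round-fair in every round $t\le T$. Moreover, let $\kappa=1-r\sqrt{2\ln(2dT/\delta)/(T\lambda)}$, and suppose that $\Delta_{\mathrm{gap}}>0$ and $\kappa>0$. Then $$R(T)\le K\cdot\frac{r^6R^2\ln(2T/\delta)}{\kappa^2\lambda^2\Delta_{\mathrm{gap}}^2},$$ and with probability at least $1-\delta$ the same bound holds for $\sum_{t\le T}\big(\max_{x\in C_t}\langle\beta,x\rangle-\langle\beta,x_t\rangle\big)$. The constant $K$ depends only on $c$ and on positive lower bounds for $r$ and $R$. -/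

import Mathlib

open MeasureTheory ProbabilityTheory
open scoped ENNReal NNReal

noncomputable section

namespace FairBandit

/-- Euclidean space `ℝ^d`. -/
abbrev Vec (d : ℕ) : Type := EuclideanSpace ℝ (Fin d)

variable {d : ℕ}

/-! ### Geometry of a choice set -/

/-- Expected outer product `E[x xᵀ]` of a uniformly random point `x` of `C`
(`cond volume C` is normalized Lebesgue measure on `C`). -/
def secondMoment (C : Set (Vec d)) : Matrix (Fin d) (Fin d) ℝ :=
  Matrix.of fun i j => ∫ x, x i * x j ∂(cond (volume : Measure (Vec d)) C)

/-- Smallest eigenvalue of a (symmetric) matrix. -/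
def minEigenvalue (M : Matrix (Fin d) (Fin d) ℝ) : ℝ := sInf (spectrum ℝ M)

/-- `λ`: the minimum over the rounds of the smallest eigenvalue of the uniform second-moment
matrix. -/
def lambdaMin (T : ℕ) (C : ℕ → Set (Vec d)) : ℝ :=
  ⨅ t : Fin T, minEigenvalue (secondMoment (C t))

open Classical in
/-- An extreme point of `C` that maximizes `⟨b, ·⟩` among the extreme points of `C`
(ties are broken by an arbitrary fixed rule). -/
def topExtreme (C : Set (Vec d)) (b : Vec d) : Vec d :=
  if h : ∃ x ∈ C.extremePoints ℝ, ∀ z ∈ C.extremePoints ℝ, inner ℝ b z ≤ inner ℝ b x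
  then h.choose else 0

/-- Value of the second best extreme point: the supremum of `⟨b, ·⟩` over the extreme points
other than the top one. -/
def runnerUp (C : Set (Vec d)) (b : Vec d) : ℝ :=
  sSup ((fun x => inner ℝ b x) '' (C.extremePoints ℝ \ {topExtreme C b}))

/-- Gap between the best and the second best extreme point of `C`. -/
def gap (C : Set (Vec d)) (β : Vec d) : ℝ :=
  sInf ((fun x => inner ℝ β (topExtreme C β - x)) '' (C.extremePoints ℝ \ {topExtreme C β}))

/-- `Δ_gap`: the smallest gap over the rounds. -/
def gapMin (T : ℕ) (C : ℕ → Set (Vec d)) (β : Vec d) : ℝ :=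
  ⨅ t : Fin T, gap (C t) β

/-! ### The bandit instance -/

/-- Standing assumptions on a linear bandit instance with `T` rounds: rounds are indexed by
`t < T`, `C t` is the choice set, and `ν t x` is the law of the reward when `x` is played. -/
structure IsInstance (T : ℕ) (C : ℕ → Set (Vec d)) (β : Vec d) (ν : ℕ → Kernel (Vec d) ℝ)
    (r : ℝ) (R : ℝ≥0) : Prop where
  coeff : ∀ i, β i ∈ Set.Icc (-1 : ℝ) 1
  subset_cube : ∀ t < T, ∀ x ∈ C t, ∀ i, x i ∈ Set.Icc (-1 : ℝ) 1
  closed : ∀ t < T, IsClosed (C t)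
  volume_pos : ∀ t < T, 0 < volume (C t)
  subset_ball : ∀ t < T, C t ⊆ Metric.closedBall 0 r
  markov : ∀ t < T, IsMarkovKernel (ν t)
  reward_mem : ∀ t < T, ∀ x ∈ C t, ∀ᵐ y ∂(ν t x), y ∈ Set.Icc (-1 : ℝ) 1
  reward_mean : ∀ t < T, ∀ x ∈ C t, ∫ y, y ∂(ν t x) = inner ℝ β x
  noise_subgaussian : ∀ t < T, ∀ x ∈ C t,
    HasSubgaussianMGF (fun y => y - inner ℝ β x) (R ^ 2) (ν t x)

/-! ### The algorithm -/

/-- Inputs of the algorithm: confidence `δ`, exponent `c`, radius `r`, noise level `R`,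
eigenvalue bound `lam`. -/
structure Params where
  δ : ℝ
  c : ℝ
  r : ℝ
  R : ℝ
  lam : ℝ

/-- The confidence parameter `δ_t = min(δ, 1/t^{1+c})` used in round `t ≥ 1`. -/
def Params.conf (p : Params) (t : ℕ) : ℝ := min p.δ (1 / (t : ℝ) ^ (1 + p.c))

/-- `κ = 1 - r √(2 ln(2dt/δ) / (nλ))` for `n` observations. -/
def kappa (d : ℕ) (r lam δ : ℝ) (n t : ℕ) : ℝ :=
  1 - r * √(2 * Real.log (2 * d * t / δ) / (n * lam))

/-- Half-width of the confidence intervals in round `t` when there are `n` observations. -/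
def Params.width (p : Params) (d n t : ℕ) : ℝ :=
  p.r ^ 2 * p.R * (2 * √(Real.log (2 * t / p.conf t))) /
    (kappa d p.r p.lam (p.conf t) n t * p.lam * √n)

/-- `XᵀX` for the observations `(x, y)` in the list `D`; the rows of `X` are the `x`. -/
def gram (D : List (Vec d × ℝ)) : Matrix (Fin d) (Fin d) ℝ :=
  (D.map fun q => Matrix.vecMulVec (fun i => q.1 i) (fun i => q.1 i)).sum

/-- `XᵀY` for the observations `(x, y)` in the list `D`. -/
def crossMoment (D : List (Vec d × ℝ)) : Fin d → ℝ :=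
  (D.map fun q => fun i => q.1 i * q.2).sum

/-- Least squares estimator `(XᵀX)⁻¹ XᵀY`. -/
def leastSquares (D : List (Vec d × ℝ)) : Vec d :=
  WithLp.toLp 2 (Matrix.mulVec (gram D)⁻¹ (crossMoment D))

/-- The algorithm plays uniformly at random in round `t ≥ 1`, with choice set `C` and recorded
observations `D`: either there are too few observations, or the confidence intervals of the top
two extreme points intersect. -/
def Explores (p : Params) (C : Set (Vec d)) (t : ℕ) (D : List (Vec d × ℝ)) : Prop :=
  (D.length : ℝ) ≤ 2 * p.r ^ 2 * Real.log (2 * d * t / p.conf t) / p.lam ∨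
  ¬ Disjoint
    (Set.Icc (inner ℝ (leastSquares D) (topExtreme C (leastSquares D)) - p.width d D.length t)
      (inner ℝ (leastSquares D) (topExtreme C (leastSquares D)) + p.width d D.length t))
    (Set.Icc (runnerUp C (leastSquares D) - p.width d D.length t)
      (runnerUp C (leastSquares D) + p.width d D.length t))

open Classical in
/-- Distribution of the action in a round, given the recorded observations: uniform on the choice
set, or the point mass at the estimated best extreme point. -/
def playDist (p : Params) (C : Set (Vec d)) (t : ℕ) (D : List (Vec d × ℝ)) : Measure (Vec d) :=
  if Explores p C t D then cond volume C else Measure.dirac (topExtreme C (leastSquares D))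

open Classical in
/-- Observations recorded in the first `t` rounds of a history of pairs (action, reward): those of
the exploration rounds. The round with index `t` is the `(t + 1)`-st. -/
def design (p : Params) (C : ℕ → Set (Vec d)) : (t : ℕ) → (Fin t → Vec d × ℝ) → List (Vec d × ℝ)
  | 0, _ => []
  | t + 1, h =>
    let D := design p C t (fun i => h i.castSucc)
    if Explores p (C t) (t + 1) D then h (Fin.last t) :: D else D

/-- The distribution `π_t` of the action in the round with index `t`, given the history before. -/
def actionDist (p : Params) (C : ℕ → Set (Vec d)) (t : ℕ) (h : Fin t → Vec d × ℝ) :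
    Measure (Vec d) :=
  playDist p (C t) (t + 1) (design p C t h)

/-- Law of the history of the first `t` rounds: in each round the action is drawn from `π_t`
given the past, and then the reward from `ν t x` given the action `x`. -/
def historyLaw (p : Params) (C : ℕ → Set (Vec d)) (ν : ℕ → Kernel (Vec d) ℝ) :
    (t : ℕ) → Measure (Fin t → Vec d × ℝ)
  | 0 => Measure.dirac Fin.elim0
  | t + 1 => (historyLaw p C ν t).bind fun h =>
      (actionDist p C t h).bind fun x =>
        (ν t x).map fun y => Fin.snoc (α := fun _ => Vec d × ℝ) h (x, y)

/-! ### Fairness -/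

/-- A discrete distribution whose mass function is monotone in the expected reward on `C`. -/
def DiscreteFair (C : Set (Vec d)) (β : Vec d) (π : Measure (Vec d)) : Prop :=
  (∃ S : Set (Vec d), S.Countable ∧ π Sᶜ = 0) ∧
    ∀ x ∈ C, ∀ x' ∈ C, inner ℝ β x' ≤ inner ℝ β x → π {x'} ≤ π {x}

/-- A continuous distribution with a density that is monotone in the expected reward on `C`. -/
def ContinuousFair (C : Set (Vec d)) (β : Vec d) (π : Measure (Vec d)) : Prop :=
  ∃ f : Vec d → ℝ≥0∞, Measurable f ∧ π = volume.withDensity f ∧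
    ∀ x ∈ C, ∀ x' ∈ C, inner ℝ β x' ≤ inner ℝ β x → f x' ≤ f x

/-- Round-fairness: `π` is a mixture of distributions on `C`, each discrete or continuous and
monotone in the expected reward. -/
def RoundFair (C : Set (Vec d)) (β : Vec d) (π : Measure (Vec d)) : Prop :=
  ∃ (m : ℕ) (α : Fin m → ℝ≥0∞) (q : Fin m → Measure (Vec d)),
    ∑ i, α i = 1 ∧
    (∀ i, IsProbabilityMeasure (q i) ∧ q i Cᶜ = 0 ∧
      (DiscreteFair C β (q i) ∨ ContinuousFair C β (q i))) ∧
    π = ∑ i, α i • q i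

/-- All `T` rounds of the history `h` are round-fair. -/
def FairHistory (p : Params) (T : ℕ) (C : ℕ → Set (Vec d)) (β : Vec d)
    (h : Fin T → Vec d × ℝ) : Prop :=
  ∀ t : Fin T, RoundFair (C t) β
    (actionDist p C t fun i : Fin t => h (Fin.castLE t.isLt.le i))

/-! ### Regret -/

/-- Largest expected reward available in `C`. -/
def bestReward (C : Set (Vec d)) (β : Vec d) : ℝ := sSup ((fun x => inner ℝ β x) '' C)

/-- Pseudo-regret: the optimal expected reward minus the expected reward of the algorithm. -/
def pseudoRegret (p : Params) (T : ℕ) (C : ℕ → Set (Vec d)) (β : Vec d)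
    (ν : ℕ → Kernel (Vec d) ℝ) : ℝ :=
  ∑ t : Fin T, bestReward (C t) β - ∫ h, ∑ t : Fin T, (h t).2 ∂(historyLaw p C ν T)

/-- Regret, in expected rewards, of the actions chosen in the history `h`. -/
def realizedRegret (T : ℕ) (C : ℕ → Set (Vec d)) (β : Vec d) (h : Fin T → Vec d × ℝ) : ℝ :=
  ∑ t : Fin T, (bestReward (C t) β - inner ℝ β (h t).1)

/-- `r⁶ R² ln(2T/δ) / (κ² λ² Δ²)` with `κ = 1 - r √(2 ln(2dT/δ) / (Tλ))`. -/
def regretBound (d T : ℕ) (r R δ lam Δ : ℝ) : ℝ :=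
  r ^ 6 * R ^ 2 * Real.log (2 * T / δ) / (kappa d r lam δ T T ^ 2 * lam ^ 2 * Δ ^ 2)

end FairBandit

end

namespace FairBandit

variable {d : ℕ}

/-! ### Extreme points and linear functionals -/

/-! The algorithm errs only if its confidence intervals do. Suppose every value `⟨β̂, x⟩` on the
choice set is within `w` of `⟨β, x⟩`. If the two intervals are disjoint, the estimated best extreme
point strictly maximizes `⟨β, ·⟩` among the extreme points, hence on the whole set by a face
argument (`inner_lt_of_forall_extremePoint_lt`). The point mass there is fair and costs no regret;
the uniform law is always fair. If instead the algorithm explores beyond the sampling threshold,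
then `Δ ≤ 4w`, which bounds the number `n` of observations (`le_explorationBound_of_le_width`), so
there are few such rounds.

Since `β̂ - β = (XᵀX)⁻¹ S` with `S` the sum of noise times action, the error on the choice set is at
most `r ‖S‖ / λ_min(XᵀX)`. Numerator and denominator are controlled by potentials of the first `n`
observations whose mean does not increase and which are frozen afterwards
(`IsInstance.lintegral_rtake_le`).

For `λ_min` this is a matrix Chernoff bound. The potential is the trace of `(1 - θ XᵀX / (N + 1)) ^
(N + 1)` instead of `exp (-θ XᵀX)`; a differential inequality along a rank one update
(`trace_pow_sub_vecMulVec_le`) takes the place of the Golden-Thompson or Lieb inequality, and `N →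
∞` gives the usual tail (`IsInstance.historyLaw_gram_lt_le`). For `S` the potential is `(k +
1)^(-1/2) exp (‖S‖² / (2ρ(k + 1)))` with `ρ = R²r²` after `k` observations. It is handled by
linearizing the square with an auxiliary Gaussian, and is free of the dimension because each step
moves `S` along one direction (`IsInstance.historyLaw_noise_gt_le`).

The first `n` observations fail at the level of round `s > n` with probability at most `(3/2) δ_s
s^(-3/2)`, and they can be used only if `s ≥ 10`. Reliability at one level persists at later ones,
so the high-probability claims need only the levels `s = n + 1`, and these failures sum to at most
`δ`. For the expected regret all `n < s` are summed in every round; `δ_s ≤ 1/s` still leaves at most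
one misled round on average, and a round costs at most `2`. Finally `κ > 0` forces `d ≤ T`, and with
`λ ≤ r²` and `Δ ≤ 2` the lower order terms are absorbed into the stated bound. -/

theorem exists_extremePoint_forall_inner_le {C : Set (Vec d)} (hC : IsCompact C)
    (hne : C.Nonempty) (b : Vec d) :
    ∃ x ∈ C.extremePoints ℝ, ∀ z ∈ C, inner ℝ b z ≤ inner ℝ b x := by
  have hexp : IsExposed ℝ C ((innerSL ℝ b).toExposed C) := ContinuousLinearMap.toExposed.isExposed
  obtain ⟨y, hyC, hy⟩ := hC.exists_isMaxOn hne
    (Continuous.continuousOn (by fun_prop : Continuous fun x : Vec d => inner ℝ b x))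
  have hy' : y ∈ (innerSL ℝ b).toExposed C := ⟨hyC, fun z hz => by simpa using hy hz⟩
  obtain ⟨x, hx⟩ := (hexp.isCompact hC).extremePoints_nonempty ⟨y, hy'⟩
  refine ⟨x, hexp.isExtreme.extremePoints_subset_extremePoints hx, fun z hz => ?_⟩
  simpa using (extremePoints_subset hx).2 z hz

theorem topExtreme_mem_extremePoints {C : Set (Vec d)} (hC : IsCompact C) (hne : C.Nonempty)
    (b : Vec d) : topExtreme C b ∈ C.extremePoints ℝ := by
  have h : ∃ x ∈ C.extremePoints ℝ, ∀ z ∈ C.extremePoints ℝ, inner ℝ b z ≤ inner ℝ b x := by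
    obtain ⟨x, hx, h⟩ := exists_extremePoint_forall_inner_le hC hne b
    exact ⟨x, hx, fun z hz => h z (extremePoints_subset hz)⟩
  rw [topExtreme, dif_pos h]
  exact h.choose_spec.1

theorem inner_le_inner_topExtreme {C : Set (Vec d)} (hC : IsCompact C) (b : Vec d)
    {z : Vec d} (hz : z ∈ C) : inner ℝ b z ≤ inner ℝ b (topExtreme C b) := by
  obtain ⟨x, hx, h⟩ := exists_extremePoint_forall_inner_le hC ⟨z, hz⟩ b
  have h' : ∃ x ∈ C.extremePoints ℝ, ∀ z ∈ C.extremePoints ℝ, inner ℝ b z ≤ inner ℝ b x :=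
    ⟨x, hx, fun z hz => h z (extremePoints_subset hz)⟩
  refine (h z hz).trans ?_
  rw [topExtreme, dif_pos h']
  exact h'.choose_spec.2 x hx

theorem topExtreme_mem {C : Set (Vec d)} (hC : IsCompact C) (hne : C.Nonempty) (b : Vec d) :
    topExtreme C b ∈ C :=
  extremePoints_subset (topExtreme_mem_extremePoints hC hne b)

theorem bestReward_eq {C : Set (Vec d)} (hC : IsCompact C) (hne : C.Nonempty) (b : Vec d) :
    bestReward C b = inner ℝ b (topExtreme C b) := by
  refine IsGreatest.csSup_eq ⟨⟨_, topExtreme_mem hC hne b, rfl⟩, ?_⟩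
  rintro _ ⟨z, hz, rfl⟩
  exact inner_le_inner_topExtreme hC b hz

theorem inner_sub_self_lt {x y : Vec d} (h : x ≠ y) :
    inner ℝ (x - y) y < inner ℝ (x - y) x := by
  have : 0 < inner ℝ (x - y) (x - y) := real_inner_self_pos.2 (sub_ne_zero.2 h)
  rw [inner_sub_right] at this
  linarith

/-- Maximizing in the direction `y - x`, for some `y ≠ x` in the set, cannot return `x`. -/
theorem exists_extremePoint_ne {C : Set (Vec d)} (hC : IsCompact C) (hnt : C.Nontrivial)
    (x : Vec d) : ∃ z ∈ C.extremePoints ℝ, z ≠ x := by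
  obtain ⟨y, hy, hyx⟩ := hnt.exists_ne x
  refine ⟨_, topExtreme_mem_extremePoints hC hnt.nonempty (y - x), fun h => ?_⟩
  have h1 := inner_le_inner_topExtreme hC (y - x) hy
  rw [h] at h1
  exact absurd (inner_sub_self_lt hyx) (not_lt.2 h1)

theorem topExtreme_eq_of_forall_inner_lt {C : Set (Vec d)} (hC : IsCompact C) (hne : C.Nonempty)
    {b x : Vec d} (h : ∀ z ∈ C.extremePoints ℝ, z ≠ x → inner ℝ b z < inner ℝ b x)
    (hx : x ∈ C) : topExtreme C b = x := by
  by_contra hcon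
  have := h _ (topExtreme_mem_extremePoints hC hne b) hcon
  have := inner_le_inner_topExtreme hC b hx
  linarith

/-- A strict maximizer of a linear functional among the extreme points of a compact set is its
only maximizer on the set. -/
theorem inner_lt_of_forall_extremePoint_lt {C : Set (Vec d)} (hC : IsCompact C) {b x : Vec d}
    (h : ∀ z ∈ C.extremePoints ℝ, z ≠ x → inner ℝ b z < inner ℝ b x)
    (hx : x ∈ C) {z : Vec d} (hz : z ∈ C) (hzx : z ≠ x) : inner ℝ b z < inner ℝ b x := by
  have htop : topExtreme C b = x := topExtreme_eq_of_forall_inner_lt hC ⟨z, hz⟩ h hx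
  have hle : ∀ y ∈ C, inner ℝ b y ≤ inner ℝ b x := fun y hy =>
    htop ▸ inner_le_inner_topExtreme hC b hy
  refine lt_of_le_of_ne (hle z hz) fun heq => ?_
  have hexp : IsExposed ℝ C ((innerSL ℝ b).toExposed C) := ContinuousLinearMap.toExposed.isExposed
  have hF := hexp.isCompact hC
  have hzF : z ∈ (innerSL ℝ b).toExposed C :=
    ⟨hz, fun y hy => by simpa [heq] using hle y hy⟩
  -- The face of maximizers is compact and its extreme points are extreme in `C`. Maximizing along
  -- `z - x` on it produces one other than `x`, against the strictness assumption.
  set u := topExtreme ((innerSL ℝ b).toExposed C) (z - x)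
  have hu : u ∈ ((innerSL ℝ b).toExposed C).extremePoints ℝ :=
    topExtreme_mem_extremePoints hF ⟨z, hzF⟩ _
  have huz := inner_le_inner_topExtreme hF (z - x) hzF
  have huz' : inner ℝ (z - x) z ≤ inner ℝ (z - x) u := huz
  have hux : u ≠ x := fun hux => by
    rw [hux] at huz'
    exact absurd (inner_sub_self_lt hzx) (not_lt.2 huz')
  have h1 := h u (hexp.isExtreme.extremePoints_subset_extremePoints hu) hux
  have h2 := (extremePoints_subset hu).2 z hz
  simp only [innerSL_apply_apply] at h2
  linarith

/-! ### The empirical gap -/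

/-- Difference between the values of the best and the second best extreme point. -/
noncomputable def topGap (C : Set (Vec d)) (b : Vec d) : ℝ :=
  inner ℝ b (topExtreme C b) - runnerUp C b

theorem inner_le_runnerUp {C : Set (Vec d)} (hC : IsCompact C) {b z : Vec d}
    (hz : z ∈ C.extremePoints ℝ) (hne : z ≠ topExtreme C b) : inner ℝ b z ≤ runnerUp C b := by
  refine le_csSup ⟨inner ℝ b (topExtreme C b), ?_⟩ ⟨z, ⟨hz, hne⟩, rfl⟩
  rintro _ ⟨y, hy, rfl⟩
  exact inner_le_inner_topExtreme hC b (extremePoints_subset hy.1)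

theorem runnerUp_le {C : Set (Vec d)} (hC : IsCompact C) (hnt : C.Nontrivial) {b : Vec d} {m : ℝ}
    (h : ∀ z ∈ C.extremePoints ℝ, z ≠ topExtreme C b → inner ℝ b z ≤ m) : runnerUp C b ≤ m := by
  obtain ⟨z, hz, hne⟩ := exists_extremePoint_ne hC hnt (topExtreme C b)
  refine csSup_le ⟨_, z, ⟨hz, hne⟩, rfl⟩ ?_
  rintro _ ⟨y, hy, rfl⟩
  exact h y hy.1 hy.2

theorem topGap_nonneg {C : Set (Vec d)} (hC : IsCompact C) (hnt : C.Nontrivial) (b : Vec d) :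
    0 ≤ topGap C b :=
  sub_nonneg.2 <| runnerUp_le hC hnt fun _ hz _ =>
    inner_le_inner_topExtreme hC b (extremePoints_subset hz)

theorem le_topGap {C : Set (Vec d)} (hC : IsCompact C) (hnt : C.Nontrivial) {b x : Vec d} {g : ℝ}
    (hx : x ∈ C) (hg : 0 < g)
    (h : ∀ z ∈ C.extremePoints ℝ, z ≠ x → inner ℝ b z ≤ inner ℝ b x - g) :
    topExtreme C b = x ∧ g ≤ topGap C b := by
  have htop : topExtreme C b = x := topExtreme_eq_of_forall_inner_lt hC hnt.nonempty
    (fun z hz hzx => by linarith [h z hz hzx]) hx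
  refine ⟨htop, ?_⟩
  have := runnerUp_le hC hnt (b := b) (m := inner ℝ b x - g) (by rwa [htop])
  rw [topGap, htop]
  linarith

/-- On `C` the two functionals differ by at most `r * ‖b - b'‖`, so differences of values move by at
most twice that; a larger gap keeps its maximizer. -/
theorem topExtreme_eq_of_lt_topGap {C : Set (Vec d)} (hC : IsCompact C) (hnt : C.Nontrivial)
    {r : ℝ} (hr : C ⊆ Metric.closedBall 0 r) {b b' : Vec d}
    (h : 2 * r * ‖b - b'‖ < topGap C b) :
    topExtreme C b' = topExtreme C b ∧ topGap C b - 2 * r * ‖b - b'‖ ≤ topGap C b' := by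
  have key : ∀ z ∈ C, |(inner ℝ b z : ℝ) - inner ℝ b' z| ≤ r * ‖b - b'‖ := fun z hz => by
    rw [← inner_sub_left]
    refine (abs_real_inner_le_norm _ _).trans ?_
    rw [mul_comm]
    have := hr hz
    rw [mem_closedBall_zero_iff] at this
    gcongr
  have htop := topExtreme_mem hC hnt.nonempty b
  refine le_topGap hC hnt htop (by linarith) fun z hz hzx => ?_
  have h1 := abs_le.1 (key z (extremePoints_subset hz))
  have h2 := abs_le.1 (key _ htop)
  have h3 := inner_le_runnerUp hC hz hzx
  have h4 : topGap C b = inner ℝ b (topExtreme C b) - runnerUp C b := rfl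
  linarith [h1.1, h1.2, h2.1, h2.2]

/-- The gap is Lipschitz: either the maximizer persists, or the gap was already below the allowed
change and nonnegativity of the other gap suffices. -/
theorem continuous_topGap {C : Set (Vec d)} (hC : IsCompact C) (hnt : C.Nontrivial) :
    Continuous (topGap C) := by
  obtain ⟨r, hr0, hr⟩ := hC.isBounded.subset_closedBall_lt 0 0
  have key : ∀ b b', topGap C b - topGap C b' ≤ 2 * r * ‖b - b'‖ := fun b b' => by
    by_cases h : 2 * r * ‖b - b'‖ < topGap C b
    · linarith [(topExtreme_eq_of_lt_topGap hC hnt hr h).2]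
    · linarith [topGap_nonneg hC hnt b']
  refine (LipschitzWith.of_dist_le_mul (K := (2 * r).toNNReal) fun b b' => ?_).continuous
  rw [Real.dist_eq, dist_eq_norm, abs_le]
  have h1 := key b b'
  have h2 := key b' b
  rw [norm_sub_rev] at h2
  rw [Real.coe_toNNReal _ (by positivity)]
  constructor <;> linarith

open Classical in
-- Ties are broken by choice, so nothing is known about measurability where the gap vanishes. Where
-- it is positive the maximizer is locally constant, and exploitation happens only there.
theorem measurable_topExtreme_of_topGap_pos {C : Set (Vec d)} (hC : IsCompact C)
    (hnt : C.Nontrivial) :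
    Measurable fun b => if 0 < topGap C b then topExtreme C b else 0 := by
  have hopen : IsOpen {b | 0 < topGap C b} := isOpen_lt continuous_const (continuous_topGap hC hnt)
  have hcont : ContinuousOn (topExtreme C) {b | 0 < topGap C b} := fun b hb => by
    obtain ⟨r, hr0, hr⟩ := hC.isBounded.subset_closedBall_lt 0 0
    refine ContinuousAt.continuousWithinAt ?_
    refine (continuousAt_const (y := topExtreme C b)).congr ?_
    have hb' : 0 < topGap C b := hb
    filter_upwards [Metric.ball_mem_nhds b (ε := topGap C b / (2 * r)) (by positivity)] with b' hb''
    refine (topExtreme_eq_of_lt_topGap hC hnt hr ?_).1.symm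
    rw [Metric.mem_ball, dist_comm, dist_eq_norm, lt_div_iff₀ (by positivity)] at hb''
    linarith
  exact hcont.measurable_piecewise continuousOn_const hopen.measurableSet

/-! ### The gap of the true coefficients -/

theorem gap_le_inner {C : Set (Vec d)} (hC : IsCompact C) {β z : Vec d}
    (hz : z ∈ C.extremePoints ℝ) (hne : z ≠ topExtreme C β) :
    gap C β ≤ inner ℝ β (topExtreme C β) - inner ℝ β z := by
  rw [← inner_sub_right]
  refine csInf_le ⟨0, ?_⟩ ⟨z, ⟨hz, hne⟩, rfl⟩
  rintro _ ⟨y, hy, rfl⟩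
  simpa [inner_sub_right] using inner_le_inner_topExtreme hC β (extremePoints_subset hy.1)

theorem gapMin_le {T : ℕ} {C : ℕ → Set (Vec d)} {β : Vec d} {t : ℕ} (ht : t < T) :
    gapMin T C β ≤ gap (C t) β :=
  ciInf_le (Set.finite_range _).bddBelow (⟨t, ht⟩ : Fin T)

end FairBandit

namespace FairBandit

/-! ### Quadratic forms of symmetric matrices -/

open Matrix in
-- In an eigenbasis the squared coordinates of `v` serve as weights for all powers at once, which
-- turns inequalities between these forms into scalar ones.
theorem dotProduct_pow_mulVec {n : Type*} [Fintype n] [DecidableEq n] {A : Matrix n n ℝ}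
    (hA : A.IsHermitian) (k : ℕ) (v : n → ℝ) :
    v ⬝ᵥ (A ^ k *ᵥ v) =
      ∑ i, hA.eigenvalues i ^ k * ((hA.eigenvectorUnitary : Matrix n n ℝ)ᵀ *ᵥ v) i ^ 2 := by
  have h : A ^ k = (hA.eigenvectorUnitary : Matrix n n ℝ) *
      diagonal (fun i => hA.eigenvalues i ^ k) * (hA.eigenvectorUnitary : Matrix n n ℝ)ᵀ := by
    conv_lhs => rw [hA.spectral_theorem, ← map_pow, Unitary.conjStarAlgAut_apply, diagonal_pow]
    rfl
  rw [h, ← mulVec_mulVec, ← mulVec_mulVec, dotProduct_mulVec, ← mulVec_transpose]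
  simp only [dotProduct, mulVec_diagonal]
  exact Finset.sum_congr rfl fun i _ => by ring

open Matrix in
/-- The eigenvalues of a symmetric matrix are values of its quadratic form. -/
theorem eigenvalues_eq_dotProduct {n : Type*} [Fintype n] [DecidableEq n] {A : Matrix n n ℝ}
    (hA : A.IsHermitian) (i : n) :
    ∃ v : n → ℝ, v ⬝ᵥ v = 1 ∧ hA.eigenvalues i = v ⬝ᵥ (A *ᵥ v) := by
  refine ⟨hA.eigenvectorBasis i, ?_, ?_⟩
  · have h := hA.eigenvectorBasis.orthonormal.1 i
    have h2 := EuclideanSpace.real_norm_sq_eq (hA.eigenvectorBasis i)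
    rw [h] at h2
    simp only [dotProduct]
    rw [← Finset.sum_congr rfl fun i _ => pow_two _]
    rw [← h2, one_pow]
  · simpa using hA.eigenvalues_eq i

/-! ### Second moments of uniform distributions -/

variable {d : ℕ}

theorem dotProduct_ofLp_eq_inner (v x : Vec d) : v.ofLp ⬝ᵥ x.ofLp = inner ℝ v x := by
  rw [EuclideanSpace.inner_eq_star_dotProduct, dotProduct_comm]
  rfl

theorem dotProduct_ofLp_self (v : Vec d) : v.ofLp ⬝ᵥ v.ofLp = ‖v‖ ^ 2 := by
  rw [dotProduct_ofLp_eq_inner, real_inner_self_eq_norm_sq]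

theorem integrable_cond_of_continuous {C : Set (Vec d)} (hC : IsCompact C)
    {f : Vec d → ℝ} (hf : Continuous f) :
    Integrable f (cond (volume : Measure (Vec d)) C) := by
  obtain ⟨m, hm⟩ := hC.exists_bound_of_continuousOn hf.continuousOn
  refine Integrable.of_bound hf.aestronglyMeasurable m ?_
  filter_upwards [ae_cond_mem hC.measurableSet] with x hx using hm x hx

theorem dotProduct_secondMoment {C : Set (Vec d)} (hC : IsCompact C) (v : Vec d) :
    v.ofLp ⬝ᵥ (secondMoment C).mulVec v.ofLp =
      ∫ x, inner ℝ v x ^ 2 ∂(cond (volume : Measure (Vec d)) C) := by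
  have hint : ∀ i j : Fin d, Integrable (fun x : Vec d => v i * (x i * x j * v j))
      (cond (volume : Measure (Vec d)) C) := fun i j =>
    integrable_cond_of_continuous hC (by fun_prop)
  have h : ∀ x : Vec d, inner ℝ v x ^ 2 = ∑ i, ∑ j, v i * (x i * x j * v j) := fun x => by
    rw [← dotProduct_ofLp_eq_inner, pow_two, dotProduct, Finset.sum_mul_sum]
    exact Finset.sum_congr rfl fun i _ => Finset.sum_congr rfl fun j _ => by ring
  simp_rw [h]
  rw [integral_finsetSum _ fun i _ => integrable_finsetSum _ fun j _ => hint i j]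
  simp_rw [integral_finsetSum _ fun j _ => hint _ j, integral_const_mul, integral_mul_const]
  simp only [dotProduct, Matrix.mulVec, secondMoment, Matrix.of_apply, Finset.mul_sum]

theorem isHermitian_secondMoment (C : Set (Vec d)) : (secondMoment C).IsHermitian := by
  ext i j
  simp [secondMoment, mul_comm]

theorem volume_inner_eq_zero {v : Vec d} (hv : v ≠ 0) :
    (volume : Measure (Vec d)) {x | inner ℝ v x = 0} = 0 := by
  have := Measure.addHaar_submodule (volume : Measure (Vec d))
    (LinearMap.ker (innerSL ℝ v).toLinearMap) (fun h => by
      rw [LinearMap.ker_eq_top] at h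
      have := congrArg (fun f => f v) h
      simp at this
      exact hv this)
  convert this using 2
  ext x
  simp

theorem isCompact_of_closed_of_subset {C : Set (Vec d)} {r : ℝ} (hC : IsClosed C)
    (h : C ⊆ Metric.closedBall 0 r) : IsCompact C :=
  (isCompact_closedBall 0 r).of_isClosed_subset hC h

theorem isProbabilityMeasure_cond {C : Set (Vec d)} (hC : IsCompact C) (hvol : 0 < volume C) :
    IsProbabilityMeasure (cond (volume : Measure (Vec d)) C) :=
  cond_isProbabilityMeasure_of_finite hvol.ne' hC.measure_lt_top.ne

theorem continuous_inner_sq (v : Vec d) : Continuous fun x : Vec d => inner ℝ v x ^ 2 :=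
  (continuous_const.inner continuous_id).pow 2

/-- The integrand vanishes only on the hyperplane orthogonal to `v`, a null set for the uniform law.
-/
theorem integral_inner_sq_pos {C : Set (Vec d)} (hC : IsCompact C)
    (hvol : 0 < volume C) {v : Vec d} (hv : v ≠ 0) :
    0 < ∫ x, inner ℝ v x ^ 2 ∂(cond (volume : Measure (Vec d)) C) := by
  rw [integral_pos_iff_support_of_nonneg (fun x => sq_nonneg _)
    (integrable_cond_of_continuous hC (continuous_inner_sq v)), pos_iff_ne_zero]
  intro h0
  have := isProbabilityMeasure_cond hC hvol
  have h1 : cond (volume : Measure (Vec d)) C {x | inner ℝ v x = 0} = 0 :=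
    cond_absolutelyContinuous (volume_inner_eq_zero hv)
  have h2 : cond (volume : Measure (Vec d)) C Set.univ ≤ 0 := by
    refine (measure_mono (t := (Function.support fun x => inner ℝ v x ^ 2) ∪
      {x | inner ℝ v x = 0}) fun x _ => ?_).trans ((measure_union_le _ _).trans ?_)
    · by_cases hx : inner ℝ v x = 0
      · exact Or.inr hx
      · exact Or.inl (pow_ne_zero 2 hx)
    · rw [h0, h1, add_zero]
  simp at h2

theorem minEigenvalue_le_integral {C : Set (Vec d)} (hC : IsCompact C) (v : Vec d) :
    minEigenvalue (secondMoment C) * ‖v‖ ^ 2 ≤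
      ∫ x, inner ℝ v x ^ 2 ∂(cond (volume : Measure (Vec d)) C) := by
  have hH := isHermitian_secondMoment C
  rw [← dotProduct_secondMoment hC]
  have h0 := dotProduct_pow_mulVec hH 0 v.ofLp
  have h1 := dotProduct_pow_mulVec hH 1 v.ofLp
  simp only [pow_zero, Matrix.one_mulVec, one_mul, pow_one] at h0 h1
  rw [h1, ← dotProduct_ofLp_self, h0, Finset.mul_sum]
  refine Finset.sum_le_sum fun i _ => mul_le_mul_of_nonneg_right ?_ (sq_nonneg _)
  exact csInf_le Matrix.finite_real_spectrum.bddBelow (hH.eigenvalues_mem_spectrum_real i)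

theorem minEigenvalue_pos (hd : 0 < d) {C : Set (Vec d)} (hC : IsCompact C)
    (hvol : 0 < volume C) : 0 < minEigenvalue (secondMoment C) := by
  have hH := isHermitian_secondMoment C
  have hne : (spectrum ℝ (secondMoment C)).Nonempty :=
    ⟨_, hH.eigenvalues_mem_spectrum_real ⟨0, hd⟩⟩
  have hmem := hne.csInf_mem Matrix.finite_real_spectrum
  rw [hH.spectrum_real_eq_range_eigenvalues] at hmem
  obtain ⟨i, hi⟩ := hmem
  obtain ⟨v, hv, hvi⟩ := eigenvalues_eq_dotProduct hH i
  rw [minEigenvalue, hH.spectrum_real_eq_range_eigenvalues, ← hi, hvi]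
  have := dotProduct_secondMoment hC (WithLp.toLp 2 v)
  rw [this]
  refine integral_inner_sq_pos hC hvol fun h0 => ?_
  have : v = 0 := congrArg WithLp.ofLp h0
  simp [this] at hv

/-! ### Compactness, `λ > 0` and the trace bound for a bandit instance -/

section Instance

variable {T : ℕ} {C : ℕ → Set (Vec d)} {β : Vec d} {ν : ℕ → Kernel (Vec d) ℝ} {r : ℝ} {R : ℝ≥0}

theorem IsInstance.isCompact (hI : IsInstance T C β ν r R) {t : ℕ} (ht : t < T) :
    IsCompact (C t) :=
  isCompact_of_closed_of_subset (hI.closed t ht) (hI.subset_ball t ht)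

theorem IsInstance.nonempty (hI : IsInstance T C β ν r R) {t : ℕ} (ht : t < T) :
    (C t).Nonempty :=
  nonempty_of_measure_ne_zero (hI.volume_pos t ht).ne'

theorem IsInstance.nontrivial (hI : IsInstance T C β ν r R) (hd : 0 < d) {t : ℕ} (ht : t < T) :
    (C t).Nontrivial := by
  have : Nonempty (Fin d) := ⟨⟨0, hd⟩⟩
  have : Nontrivial (Vec d) := inferInstance
  by_contra h
  rw [Set.not_nontrivial_iff] at h
  exact (hI.volume_pos t ht).ne' (h.measure_zero _)

theorem IsInstance.isProbabilityMeasure_cond (hI : IsInstance T C β ν r R) {t : ℕ} (ht : t < T) :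
    IsProbabilityMeasure (cond (volume : Measure (Vec d)) (C t)) :=
  FairBandit.isProbabilityMeasure_cond (hI.isCompact ht) (hI.volume_pos t ht)

theorem IsInstance.norm_le (hI : IsInstance T C β ν r R) {t : ℕ} (ht : t < T) {x : Vec d}
    (hx : x ∈ C t) : ‖x‖ ≤ r :=
  mem_closedBall_zero_iff.1 (hI.subset_ball t ht hx)

theorem IsInstance.radius_pos (hI : IsInstance T C β ν r R) (hd : 0 < d) (hT : 0 < T) :
    0 < r := by
  obtain ⟨y, hy, h⟩ := (hI.nontrivial hd hT).exists_ne 0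
  exact (norm_pos_iff.2 h).trans_le (hI.norm_le hT hy)

theorem IsInstance.abs_inner_le_one (hI : IsInstance T C β ν r R) {t : ℕ} (ht : t < T) {x : Vec d}
    (hx : x ∈ C t) : |(inner ℝ β x : ℝ)| ≤ 1 := by
  have := hI.markov t ht
  rw [← hI.reward_mean t ht x hx, ← Real.norm_eq_abs]
  refine (norm_integral_le_of_norm_le_const (C := 1) ?_).trans (by simp)
  filter_upwards [hI.reward_mem t ht x hx] with y hy
  rw [Real.norm_eq_abs, abs_le]
  exact hy

theorem IsInstance.lambdaMin_pos (hI : IsInstance T C β ν r R) (hd : 0 < d) (hT : 0 < T) :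
    0 < lambdaMin T C := by
  have : Nonempty (Fin T) := ⟨⟨0, hT⟩⟩
  obtain ⟨t, ht⟩ := exists_eq_ciInf_of_finite
    (f := fun t : Fin T => minEigenvalue (secondMoment (C t)))
  rw [lambdaMin, ← ht]
  exact minEigenvalue_pos hd (hI.isCompact t.2) (hI.volume_pos t t.2)

theorem IsInstance.lambdaMin_mul_le (hI : IsInstance T C β ν r R) {t : ℕ} (ht : t < T)
    (v : Vec d) : lambdaMin T C * ‖v‖ ^ 2 ≤
      ∫ x, inner ℝ v x ^ 2 ∂(cond (volume : Measure (Vec d)) (C t)) := by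
  refine le_trans ?_ (minEigenvalue_le_integral (hI.isCompact ht) v)
  gcongr
  exact ciInf_le (Set.finite_range _).bddBelow (⟨t, ht⟩ : Fin T)

/-- Summing the eigenvalue bound over the standard basis gives the mean of `‖x‖²` on the right. This
yields both `λ ≤ r²` and, later, `d ≤ T`. -/
theorem IsInstance.card_mul_lambdaMin_le (hI : IsInstance T C β ν r R) (hT : 0 < T) :
    d * lambdaMin T C ≤ r ^ 2 := by
  have hp := hI.isProbabilityMeasure_cond hT
  have h1 : ∑ i : Fin d, lambdaMin T C * ‖EuclideanSpace.single i (1 : ℝ)‖ ^ 2 ≤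
      ∑ i : Fin d, ∫ x : Vec d, inner ℝ (EuclideanSpace.single i (1 : ℝ)) x ^ 2
        ∂(cond (volume : Measure (Vec d)) (C 0)) :=
    Finset.sum_le_sum fun i _ => hI.lambdaMin_mul_le hT _
  rw [← integral_finsetSum _ fun i _ =>
    integrable_cond_of_continuous (hI.isCompact hT) (continuous_inner_sq _)] at h1
  have h2 : ∫ x : Vec d, ∑ i : Fin d, inner ℝ (EuclideanSpace.single i (1 : ℝ)) x ^ 2
      ∂(cond (volume : Measure (Vec d)) (C 0)) ≤ r ^ 2 := by
    have hle : ∀ᵐ x ∂(cond (volume : Measure (Vec d)) (C 0)),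
        ∑ i : Fin d, inner ℝ (EuclideanSpace.single i (1 : ℝ)) x ^ 2 ≤ r ^ 2 := by
      filter_upwards [ae_cond_mem (hI.isCompact hT).measurableSet] with x hx
      have := hI.norm_le hT hx
      have h3 := EuclideanSpace.real_norm_sq_eq x
      simp only [EuclideanSpace.inner_single_left, map_one, one_mul]
      rw [← h3]
      gcongr
    refine (integral_mono_ae (integrable_cond_of_continuous (hI.isCompact hT)
      (continuous_finsetSum _ fun i _ => continuous_inner_sq _))
      (integrable_const (r ^ 2)) hle).trans ?_
    simp
  simpa using h1.trans h2

end Instance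

end FairBandit

namespace FairBandit

variable {d : ℕ}

/-! ### The exploration rule -/

theorem not_disjoint_Icc_iff {a b w : ℝ} (hab : b ≤ a) :
    ¬ Disjoint (Set.Icc (a - w) (a + w)) (Set.Icc (b - w) (b + w)) ↔ 0 ≤ w ∧ a - b ≤ 2 * w := by
  rw [Set.not_disjoint_iff]
  constructor
  · rintro ⟨x, hx, hx'⟩
    have := hx.1; have := hx.2; have := hx'.1; have := hx'.2
    constructor <;> linarith
  · rintro ⟨hw, h⟩
    exact ⟨a - w, ⟨le_rfl, by linarith⟩, by linarith, by linarith⟩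

/-- Intervals of negative half-width are empty and therefore disjoint, whence the sign clause; it
holds automatically above the sampling threshold (`width_nonneg`). -/
theorem explores_iff {C : Set (Vec d)} (hC : IsCompact C) (hnt : C.Nontrivial) (p : Params)
    (s : ℕ) (D : List (Vec d × ℝ)) :
    Explores p C s D ↔
      (D.length : ℝ) ≤ 2 * p.r ^ 2 * Real.log (2 * d * s / p.conf s) / p.lam ∨
        (0 ≤ p.width d D.length s ∧ topGap C (leastSquares D) ≤ 2 * p.width d D.length s) := by
  rw [Explores, not_disjoint_Icc_iff (sub_nonneg.1 (topGap_nonneg hC hnt (leastSquares D)))]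
  rfl

theorem kappa_pos {p : Params} (hr : 0 ≤ p.r) (hlam : 0 < p.lam) {n s : ℕ}
    (hn : 2 * p.r ^ 2 * Real.log (2 * d * s / p.conf s) / p.lam < n) (hn0 : 0 < n) :
    0 < kappa d p.r p.lam (p.conf s) n s := by
  rw [kappa, sub_pos]
  have hn' : (0 : ℝ) < n := by exact_mod_cast hn0
  rw [div_lt_iff₀ hlam] at hn
  calc p.r * √(2 * Real.log (2 * d * s / p.conf s) / (n * p.lam))
      = √(p.r ^ 2) * √(2 * Real.log (2 * d * s / p.conf s) / (n * p.lam)) := by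
        rw [Real.sqrt_sq hr]
    _ = √(p.r ^ 2 * (2 * Real.log (2 * d * s / p.conf s) / (n * p.lam))) := by
        rw [Real.sqrt_mul (sq_nonneg _)]
    _ < √1 := by
        refine Real.sqrt_lt_sqrt_iff_of_pos one_pos |>.2 ?_
        rw [← mul_div_assoc, div_lt_one (by positivity)]
        linarith
    _ = 1 := Real.sqrt_one

theorem width_nonneg {p : Params} (hr : 0 ≤ p.r) (hR : 0 ≤ p.R) (hlam : 0 < p.lam) {n s : ℕ}
    (hn : 2 * p.r ^ 2 * Real.log (2 * d * s / p.conf s) / p.lam < n) :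
    0 ≤ p.width d n s := by
  rcases Nat.eq_zero_or_pos n with h0 | h0
  -- Without observations `√n = 0`, and division by zero makes the width `0`.
  · simp [Params.width, h0]
  · have := kappa_pos hr hlam hn h0
    rw [Params.width]
    positivity

theorem lt_topGap_of_not_explores {C : Set (Vec d)} (hC : IsCompact C) (hnt : C.Nontrivial)
    {p : Params} (hr : 0 ≤ p.r) (hR : 0 ≤ p.R) (hlam : 0 < p.lam) {s : ℕ}
    {D : List (Vec d × ℝ)} (h : ¬ Explores p C s D) :
    2 * p.r ^ 2 * Real.log (2 * d * s / p.conf s) / p.lam < D.length ∧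
      0 ≤ p.width d D.length s ∧ 2 * p.width d D.length s < topGap C (leastSquares D) := by
  rw [explores_iff hC hnt, not_or, not_le, not_and, not_le] at h
  have := width_nonneg hr hR hlam h.1
  exact ⟨h.1, this, h.2 this⟩

/-! ### Measurability of the algorithm in the history -/

/-- Number of observations, `XᵀX` and `XᵀY`. -/
def stat (D : List (Vec d × ℝ)) : ℕ × (Fin d → Fin d → ℝ) × (Fin d → ℝ) :=
  (D.length, gram D, crossMoment D)

/-- Effect of one observation on `stat`. -/
def statStep (q : (Vec d × ℝ) × ℕ × (Fin d → Fin d → ℝ) × (Fin d → ℝ)) :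
    ℕ × (Fin d → Fin d → ℝ) × (Fin d → ℝ) :=
  (q.2.1 + 1, fun i j => q.1.1 i * q.1.1 j + q.2.2.1 i j, fun i => q.1.1 i * q.1.2 + q.2.2.2 i)

theorem stat_cons (q : Vec d × ℝ) (D : List (Vec d × ℝ)) :
    stat (q :: D) = statStep (q, stat D) := by
  refine Prod.ext rfl (Prod.ext ?_ ?_)
  · funext i j
    simp [stat, statStep, gram, Matrix.vecMulVec_apply]
  · funext i
    simp [stat, statStep, crossMoment]

theorem measurable_statStep : Measurable (statStep (d := d)) := by
  unfold statStep
  refine Measurable.prodMk (by fun_prop) (Measurable.prodMk ?_ ?_)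
  · refine measurable_pi_iff.2 fun i => measurable_pi_iff.2 fun j => ?_
    fun_prop
  · refine measurable_pi_iff.2 fun i => ?_
    fun_prop

/-- The least squares estimator as a function of `XᵀX` and `XᵀY`. -/
noncomputable def estimator (q : ℕ × (Fin d → Fin d → ℝ) × (Fin d → ℝ)) : Vec d :=
  WithLp.toLp 2 (Matrix.mulVec (Matrix.of q.2.1)⁻¹ q.2.2)

theorem estimator_stat (D : List (Vec d × ℝ)) : estimator (stat D) = leastSquares D := rfl

theorem measurable_estimator : Measurable (estimator (d := d)) := by
  refine (PiLp.continuous_toLp 2 _).measurable.comp ?_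
  have hcont : ∀ f : Matrix (Fin d) (Fin d) ℝ → ℝ, Continuous f →
      Measurable fun q : ℕ × (Fin d → Fin d → ℝ) × (Fin d → ℝ) => f (Matrix.of q.2.1) :=
    fun f hf => by
      have hc : Continuous fun A : Fin d → Fin d → ℝ => f (Matrix.of A) := hf
      exact hc.measurable.comp (measurable_fst.comp measurable_snd)
  refine measurable_pi_iff.2 fun i => ?_
  simp only [Matrix.mulVec, dotProduct, Matrix.inv_def, Matrix.smul_apply, Ring.inverse_eq_inv',
    smul_eq_mul]
  refine Finset.measurable_sum _ fun j _ => Measurable.mul (Measurable.mul ?_ ?_) ?_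
  · exact (hcont _ (Continuous.matrix_det continuous_id)).inv
  · exact hcont (fun A => A.adjugate i j)
      ((Continuous.matrix_adjugate continuous_id).matrix_elem i j)
  · exact (measurable_pi_apply j).comp (measurable_snd.comp measurable_snd)

theorem exists_measurableSet_explores {C : Set (Vec d)} (hC : IsCompact C) (hnt : C.Nontrivial)
    (p : Params) (s : ℕ) :
    ∃ E : Set (ℕ × (Fin d → Fin d → ℝ) × (Fin d → ℝ)), MeasurableSet E ∧
      ∀ D : List (Vec d × ℝ), Explores p C s D ↔ stat D ∈ E := by
  refine ⟨{q | (q.1 : ℝ) ≤ 2 * p.r ^ 2 * Real.log (2 * d * s / p.conf s) / p.lam ∨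
    (0 ≤ p.width d q.1 s ∧ topGap C (estimator q) ≤ 2 * p.width d q.1 s)}, ?_,
    fun D => explores_iff hC hnt p s D⟩
  have hw : Measurable fun q : ℕ × (Fin d → Fin d → ℝ) × (Fin d → ℝ) => p.width d q.1 s :=
    (measurable_from_top (f := fun n : ℕ => p.width d n s)).comp measurable_fst
  have hn : Measurable fun q : ℕ × (Fin d → Fin d → ℝ) × (Fin d → ℝ) => (q.1 : ℝ) :=
    (measurable_from_top (f := fun n : ℕ => (n : ℝ))).comp measurable_fst
  refine (measurableSet_le hn measurable_const).union
    ((measurableSet_le measurable_const hw).inter (measurableSet_le ?_ (hw.const_mul 2)))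
  exact (continuous_topGap hC hnt).measurable.comp measurable_estimator

open Classical in
-- Stated for any recursively updated summary `φ` that decides exploration, because it serves both
-- for `stat` and for `statPair`.
theorem measurable_comp_design {Z : Type*} [MeasurableSpace Z] {p : Params} {T : ℕ}
    {C : ℕ → Set (Vec d)} {φ : List (Vec d × ℝ) → Z} {step : (Vec d × ℝ) × Z → Z}
    (hstep : Measurable step) (hφ : ∀ q D, φ (q :: D) = step (q, φ D))
    (hE : ∀ t < T, ∃ E : Set Z, MeasurableSet E ∧
      ∀ D : List (Vec d × ℝ), Explores p (C t) (t + 1) D ↔ φ D ∈ E) :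
    ∀ t ≤ T, Measurable fun h : Fin t → Vec d × ℝ => φ (design p C t h) := by
  intro t
  induction t with
  | zero => exact fun _ => measurable_const (a := φ [])
  | succ t ih =>
    intro ht
    obtain ⟨E, hEm, hE⟩ := hE t ht
    have hD : Measurable fun h : Fin (t + 1) → Vec d × ℝ =>
        φ (design p C t fun i => h i.castSucc) :=
      (ih (by omega)).comp (measurable_pi_iff.2 fun i => measurable_pi_apply _)
    have heq : (fun h : Fin (t + 1) → Vec d × ℝ => φ (design p C (t + 1) h)) = fun h =>
        if φ (design p C t fun i => h i.castSucc) ∈ E then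
          step (h (Fin.last t), φ (design p C t fun i => h i.castSucc))
        else φ (design p C t fun i => h i.castSucc) := by
      funext h
      simp only [design, ← hE]
      split_ifs
      · rw [hφ]
      · rfl
    rw [heq]
    exact Measurable.ite (hD hEm) (hstep.comp ((measurable_pi_apply _).prodMk hD)) hD

/-! ### The law of the history as an iterated kernel -/

section Law

variable {p : Params} {T : ℕ} {C : ℕ → Set (Vec d)} {β : Vec d} {ν : ℕ → Kernel (Vec d) ℝ} {r : ℝ}
  {R : ℝ≥0}

theorem IsInstance.measurable_stat_design (hI : IsInstance T C β ν r R) (hd : 0 < d) (p : Params)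
    {t : ℕ} (ht : t ≤ T) : Measurable fun h : Fin t → Vec d × ℝ => stat (design p C t h) :=
  measurable_comp_design measurable_statStep stat_cons
    (fun _ ht => exists_measurableSet_explores (hI.isCompact ht) (hI.nontrivial hd ht) p _) t ht

open Classical in
theorem IsInstance.measurable_actionDist (hI : IsInstance T C β ν r R) (hd : 0 < d)
    (hr : 0 ≤ p.r) (hR : 0 ≤ p.R) (hlam : 0 < p.lam) {t : ℕ} (ht : t < T) :
    Measurable (actionDist p C t) := by
  have hC := hI.isCompact ht
  have hnt := hI.nontrivial hd ht
  obtain ⟨E, hEm, hE⟩ := exists_measurableSet_explores hC hnt p (t + 1)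
  have hD := hI.measurable_stat_design hd p ht.le
  -- The value `0` of the inner branch is never reached: a round without exploration has a positive
  -- empirical gap.
  have heq : actionDist p C t = fun h => if stat (design p C t h) ∈ E then cond volume (C t)
      else Measure.dirac (if 0 < topGap (C t) (estimator (stat (design p C t h))) then
        topExtreme (C t) (estimator (stat (design p C t h))) else 0) := by
    funext h
    rw [actionDist, playDist]
    by_cases h1 : Explores p (C t) (t + 1) (design p C t h)
    · rw [if_pos h1, if_pos ((hE _).1 h1)]
    · obtain ⟨-, h3, h4⟩ := lt_topGap_of_not_explores hC hnt hr hR hlam h1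
      rw [if_neg h1, if_neg (mt (hE _).2 h1), if_pos (by rw [estimator_stat]; linarith),
        estimator_stat]
  rw [heq]
  exact Measurable.ite (hD hEm) measurable_const (Measure.measurable_dirac.comp
    ((measurable_topExtreme_of_topGap_pos hC hnt).comp (measurable_estimator.comp hD)))

theorem IsInstance.isProbabilityMeasure_actionDist (hI : IsInstance T C β ν r R) (p : Params)
    {t : ℕ} (ht : t < T) (h : Fin t → Vec d × ℝ) : IsProbabilityMeasure (actionDist p C t h) := by
  rw [actionDist, playDist]
  split_ifs
  · exact hI.isProbabilityMeasure_cond ht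
  · infer_instance

theorem IsInstance.ae_actionDist_mem (hI : IsInstance T C β ν r R) (p : Params)
    {t : ℕ} (ht : t < T) (h : Fin t → Vec d × ℝ) : ∀ᵐ x ∂(actionDist p C t h), x ∈ C t := by
  have hC := hI.isCompact ht
  rw [actionDist, playDist]
  split_ifs
  · exact ae_cond_mem hC.measurableSet
  · exact (ae_dirac_iff hC.measurableSet).2 (topExtreme_mem hC (hI.nonempty ht) _)

theorem measurable_snoc (t : ℕ) : Measurable fun q : (Fin t → Vec d × ℝ) × (Vec d × ℝ) =>
    Fin.snoc (α := fun _ => Vec d × ℝ) q.1 q.2 := by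
  refine measurable_pi_iff.2 fun i => ?_
  refine Fin.lastCases ?_ (fun i => ?_) i
  · simpa using measurable_snd
  · simp only [Fin.snoc_castSucc]
    exact (measurable_pi_apply i).comp measurable_fst

/-- The nested `bind`s defining the law carry no measurability by themselves. Writing one round as a
composition-product of Markov kernels makes Tonelli and Fubini available. -/
theorem IsInstance.exists_kernel (hI : IsInstance T C β ν r R) (hd : 0 < d)
    (hr : 0 ≤ p.r) (hR : 0 ≤ p.R) (hlam : 0 < p.lam) {t : ℕ} (ht : t < T)
    [SFinite (historyLaw p C ν t)] :
    ∃ κ : Kernel (Fin t → Vec d × ℝ) (Vec d), IsMarkovKernel κ ∧ (∀ h, κ h = actionDist p C t h) ∧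
      historyLaw p C ν (t + 1) = ((historyLaw p C ν t) ⊗ₘ (κ ⊗ₖ (ν t).prodMkLeft _)).map
        fun q => Fin.snoc (α := fun _ => Vec d × ℝ) q.1 q.2 := by
  have := hI.markov t ht
  let κ : Kernel (Fin t → Vec d × ℝ) (Vec d) :=
    ⟨actionDist p C t, hI.measurable_actionDist hd hr hR hlam ht⟩
  have hκ : IsMarkovKernel κ := ⟨hI.isProbabilityMeasure_actionDist p ht⟩
  refine ⟨κ, hκ, fun _ => rfl, ?_⟩
  have hsnoc := measurable_snoc (d := d) t
  have hin : ∀ h, (actionDist p C t h).bind (fun x => (ν t x).map fun y =>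
      Fin.snoc (α := fun _ => Vec d × ℝ) h (x, y)) =
      ((κ ⊗ₖ (ν t).prodMkLeft _) h).map fun q => Fin.snoc (α := fun _ => Vec d × ℝ) h q := by
    intro h
    have hs1 : Measurable fun q : Vec d × ℝ => Fin.snoc (α := fun _ => Vec d × ℝ) h q :=
      hsnoc.comp measurable_prodMk_left
    have hs2 : ∀ x, Measurable fun y : ℝ => Fin.snoc (α := fun _ => Vec d × ℝ) h (x, y) :=
      fun x => hs1.comp measurable_prodMk_left
    ext s hs
    rw [Measure.bind_apply hs, Measure.map_apply hs1 hs, Kernel.compProd_apply (hs1 hs)]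
    · refine lintegral_congr fun x => ?_
      rw [Measure.map_apply (hs2 x) hs]
      rfl
    · refine (Measure.measurable_of_measurable_coe _ fun s hs => ?_).aemeasurable
      simp_rw [fun x => Measure.map_apply (μ := ν t x) (hs2 x) hs]
      exact Kernel.measurable_kernel_prodMk_left (κ := ν t) (hs1 hs)
  rw [historyLaw]
  simp_rw [hin]
  ext s hs
  have hs3 : ∀ h : Fin t → Vec d × ℝ, Measurable fun q : Vec d × ℝ =>
      Fin.snoc (α := fun _ => Vec d × ℝ) h q := fun h => hsnoc.comp measurable_prodMk_left
  rw [Measure.map_apply hsnoc hs, Measure.bind_apply hs]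
  · simp_rw [fun h => Measure.map_apply (μ := (κ ⊗ₖ (ν t).prodMkLeft _) h) (hs3 h) hs]
    rw [Measure.compProd_apply (hsnoc hs)]
    rfl
  · refine (Measure.measurable_of_measurable_coe _ fun s hs => ?_).aemeasurable
    simp_rw [fun h => Measure.map_apply (μ := (κ ⊗ₖ (ν t).prodMkLeft _) h) (hs3 h) hs]
    exact Kernel.measurable_kernel_prodMk_left (κ := κ ⊗ₖ (ν t).prodMkLeft _) (hsnoc hs)

theorem IsInstance.isProbabilityMeasure_historyLaw (hI : IsInstance T C β ν r R) (hd : 0 < d)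
    (hr : 0 ≤ p.r) (hR : 0 ≤ p.R) (hlam : 0 < p.lam) {t : ℕ} (ht : t ≤ T) :
    IsProbabilityMeasure (historyLaw p C ν t) := by
  induction t with
  | zero => rw [historyLaw]; infer_instance
  | succ t ih =>
    have := ih (by omega)
    have := hI.markov t ht
    obtain ⟨κ, hκ, -, heq⟩ := hI.exists_kernel hd hr hR hlam ht
    rw [heq]
    exact Measure.isProbabilityMeasure_map (measurable_snoc t).aemeasurable

theorem IsInstance.lintegral_historyLaw_succ (hI : IsInstance T C β ν r R) (hd : 0 < d)
    (hr : 0 ≤ p.r) (hR : 0 ≤ p.R) (hlam : 0 < p.lam) {t : ℕ} (ht : t < T)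
    {F : (Fin (t + 1) → Vec d × ℝ) → ℝ≥0∞} (hF : Measurable F) :
    ∫⁻ h, F h ∂(historyLaw p C ν (t + 1)) =
      ∫⁻ h, ∫⁻ x, ∫⁻ y, F (Fin.snoc (α := fun _ => Vec d × ℝ) h (x, y)) ∂(ν t x)
        ∂(actionDist p C t h) ∂(historyLaw p C ν t) := by
  have := hI.isProbabilityMeasure_historyLaw hd hr hR hlam ht.le (ν := ν)
  have := hI.markov t ht
  obtain ⟨κ, hκ, hκ', heq⟩ := hI.exists_kernel hd hr hR hlam ht
  have hF' : Measurable fun q : (Fin t → Vec d × ℝ) × (Vec d × ℝ) =>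
      F (Fin.snoc (α := fun _ => Vec d × ℝ) q.1 q.2) := hF.comp (measurable_snoc (d := d) t)
  rw [heq, lintegral_map hF (measurable_snoc t), Measure.lintegral_compProd hF']
  refine lintegral_congr fun h => ?_
  have hh : Measurable fun q : Vec d × ℝ => F (Fin.snoc (α := fun _ => Vec d × ℝ) h q) :=
    hF'.comp measurable_prodMk_left
  rw [Kernel.lintegral_compProd _ _ _ hh, hκ']
  rfl

theorem IsInstance.integral_historyLaw_succ (hI : IsInstance T C β ν r R) (hd : 0 < d)
    (hr : 0 ≤ p.r) (hR : 0 ≤ p.R) (hlam : 0 < p.lam) {t : ℕ} (ht : t < T)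
    {F : (Fin (t + 1) → Vec d × ℝ) → ℝ} (hF : Integrable F (historyLaw p C ν (t + 1))) :
    ∫ h, F h ∂(historyLaw p C ν (t + 1)) =
      ∫ h, ∫ x, ∫ y, F (Fin.snoc (α := fun _ => Vec d × ℝ) h (x, y)) ∂(ν t x)
        ∂(actionDist p C t h) ∂(historyLaw p C ν t) := by
  have := hI.isProbabilityMeasure_historyLaw hd hr hR hlam ht.le (ν := ν)
  have := hI.markov t ht
  obtain ⟨κ, hκ, hκ', heq⟩ := hI.exists_kernel hd hr hR hlam ht
  have hsn := (measurable_snoc (d := d) t).aemeasurable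
    (μ := (historyLaw p C ν t) ⊗ₘ (κ ⊗ₖ (ν t).prodMkLeft _))
  rw [heq] at hF ⊢
  have hF' : Integrable (fun q : (Fin t → Vec d × ℝ) × (Vec d × ℝ) =>
      F (Fin.snoc (α := fun _ => Vec d × ℝ) q.1 q.2)) _ :=
    (integrable_map_measure hF.aestronglyMeasurable hsn).1 hF
  rw [integral_map hsn hF.aestronglyMeasurable]
  rw [Measure.integral_compProd hF']
  refine integral_congr_ae ?_
  filter_upwards [((Measure.integrable_compProd_iff hF'.aestronglyMeasurable).1 hF').1] with h hh
  rw [ProbabilityTheory.integral_compProd hh, hκ']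
  rfl

/-- Almost surely the actions are feasible and the rewards lie in `[-1, 1]`. -/
theorem IsInstance.ae_historyLaw_mem (hI : IsInstance T C β ν r R) (hd : 0 < d)
    (hr : 0 ≤ p.r) (hR : 0 ≤ p.R) (hlam : 0 < p.lam) {t : ℕ} (ht : t ≤ T) :
    ∀ᵐ h ∂(historyLaw p C ν t), ∀ i : Fin t, (h i).1 ∈ C i ∧ (h i).2 ∈ Set.Icc (-1 : ℝ) 1 := by
  induction t with
  | zero => exact Filter.Eventually.of_forall fun h i => i.elim0
  | succ t ih =>
    have := hI.isProbabilityMeasure_historyLaw hd hr hR hlam ht (ν := ν)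
    have hmeas : ∀ u ≤ T, MeasurableSet {h : Fin u → Vec d × ℝ |
        ∀ i : Fin u, (h i).1 ∈ C i ∧ (h i).2 ∈ Set.Icc (-1 : ℝ) 1} := fun u hu => by
      simp only [Set.ofPred_forall]
      refine MeasurableSet.iInter fun i => ?_
      exact ((measurable_fst.comp (measurable_pi_apply i))
          (hI.isCompact (i.2.trans_le hu)).measurableSet).inter
        ((measurable_snd.comp (measurable_pi_apply i)) measurableSet_Icc)
    rw [ae_iff, ← Set.compl_ofPred, ← lintegral_indicator_one (hmeas _ ht).compl,
      hI.lintegral_historyLaw_succ hd hr hR hlam ht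
        (measurable_one.indicator (hmeas _ ht).compl)]
    rw [lintegral_eq_zero_of_ae_eq_zero]
    filter_upwards [ih (by omega)] with h hh
    refine lintegral_eq_zero_of_ae_eq_zero ?_
    filter_upwards [hI.ae_actionDist_mem p ht h] with x hx
    refine lintegral_eq_zero_of_ae_eq_zero ?_
    filter_upwards [hI.reward_mem t ht x hx] with y hy
    refine Set.indicator_of_notMem (Set.notMem_compl_iff.2 ?_) _
    intro i
    refine Fin.lastCases ?_ (fun i => ?_) i
    · simpa using ⟨hx, hy⟩
    · simpa using hh i

end Law

end FairBandit

namespace FairBandit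

variable {d : ℕ}

/-! ### The first observations -/

/-- New observations enter at the head of the list, so the first `n` recorded ones are the last `n`
entries, `rtake n`. -/
theorem rtake_cons_of_lt {α : Type*} {q : α} {D : List α} {n : ℕ} (h : D.length < n) :
    (q :: D).rtake n = q :: D ∧ D.rtake n = D := by
  constructor <;> simp [List.rtake, List.length_cons, Nat.sub_eq_zero_of_le, Nat.succ_le_of_lt h,
    h.le]

theorem rtake_cons_of_le {α : Type*} {q : α} {D : List α} {n : ℕ} (h : n ≤ D.length) :
    (q :: D).rtake n = D.rtake n := by
  rw [List.rtake, List.rtake, List.length_cons, Nat.sub_add_comm h, List.drop_succ_cons]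

/-- `stat` of all observations and of the first `n` ones. -/
def statPair (n : ℕ) (D : List (Vec d × ℝ)) :
    (ℕ × (Fin d → Fin d → ℝ) × (Fin d → ℝ)) × (ℕ × (Fin d → Fin d → ℝ) × (Fin d → ℝ)) :=
  (stat D, stat (D.rtake n))

section Law

variable {p : Params} {T : ℕ} {C : ℕ → Set (Vec d)} {β : Vec d} {ν : ℕ → Kernel (Vec d) ℝ} {r : ℝ}
  {R : ℝ≥0}

theorem IsInstance.measurable_stat_rtake_design (hI : IsInstance T C β ν r R) (hd : 0 < d)
    (p : Params) (n : ℕ) {t : ℕ} (ht : t ≤ T) :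
    Measurable fun h : Fin t → Vec d × ℝ => stat ((design p C t h).rtake n) := by
  -- The summary of all data is carried along because the total count decides whether the prefix is
  -- still growing.
  let step (q : (Vec d × ℝ) ×
      ((ℕ × (Fin d → Fin d → ℝ) × (Fin d → ℝ)) × (ℕ × (Fin d → Fin d → ℝ) × (Fin d → ℝ)))) :
      (ℕ × (Fin d → Fin d → ℝ) × (Fin d → ℝ)) × (ℕ × (Fin d → Fin d → ℝ) × (Fin d → ℝ)) :=
    (statStep (q.1, q.2.1), if q.2.1.1 < n then statStep (q.1, q.2.2) else q.2.2)
  have hstep : Measurable step := by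
    refine (measurable_statStep.comp (by fun_prop)).prodMk (Measurable.ite ?_
      (measurable_statStep.comp (by fun_prop)) (by fun_prop))
    exact measurableSet_lt (by fun_prop) measurable_const
  have hφ : ∀ q D, statPair (d := d) n (q :: D) = step (q, statPair n D) := fun q D => by
    refine Prod.ext (stat_cons q D) ?_
    by_cases h : D.length < n
    · have h1 := rtake_cons_of_lt (q := q) h
      simp only [statPair, step, h1.1, h1.2, stat_cons]
      exact (if_pos h).symm
    · simp only [statPair, step, rtake_cons_of_le (not_lt.1 h)]
      exact (if_neg h).symm
  refine measurable_snd.comp (measurable_comp_design (T := T) hstep hφ (fun t ht => ?_) t ht)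
  obtain ⟨E, hE, h⟩ := exists_measurableSet_explores (hI.isCompact ht) (hI.nontrivial hd ht) p
    (t + 1)
  exact ⟨Prod.fst ⁻¹' E, measurable_fst hE, h⟩

theorem mem_design {t : ℕ} {h : Fin t → Vec d × ℝ} {q : Vec d × ℝ} (hq : q ∈ design p C t h) :
    ∃ i, q = h i := by
  induction t with
  | zero => simp [design] at hq
  | succ t ih =>
    rw [design] at hq
    split_ifs at hq
    · rcases List.mem_cons.1 hq with rfl | hq
      · exact ⟨_, rfl⟩
      · obtain ⟨i, hi⟩ := ih hq
        exact ⟨_, hi⟩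
    · obtain ⟨i, hi⟩ := ih hq
      exact ⟨_, hi⟩

theorem IsInstance.norm_le_of_mem_design (hI : IsInstance T C β ν r R) {t : ℕ} (ht : t ≤ T)
    {h : Fin t → Vec d × ℝ} (hh : ∀ i : Fin t, (h i).1 ∈ C i) {q : Vec d × ℝ}
    (hq : q ∈ design p C t h) : ‖q.1‖ ≤ r := by
  obtain ⟨i, rfl⟩ := mem_design hq
  exact hI.norm_le (i.2.trans_le ht) (hh i)

theorem design_succ_of_explores {t : ℕ} {h : Fin (t + 1) → Vec d × ℝ}
    (he : Explores p (C t) (t + 1) (design p C t fun i => h i.castSucc)) :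
    design p C (t + 1) h = h (Fin.last t) :: design p C t fun i => h i.castSucc := by
  rw [design]
  exact if_pos he

theorem design_succ_of_not_explores {t : ℕ} {h : Fin (t + 1) → Vec d × ℝ}
    (he : ¬ Explores p (C t) (t + 1) (design p C t fun i => h i.castSucc)) :
    design p C (t + 1) h = design p C t fun i => h i.castSucc := by
  rw [design]
  exact if_neg he

theorem snoc_comp_castSucc {α : Type*} {t : ℕ} (h : Fin t → α) (q : α) :
    (fun i : Fin t => Fin.snoc (α := fun _ => α) h q i.castSucc) = h := by
  funext i
  simp

theorem design_snoc_of_explores {t : ℕ} {h : Fin t → Vec d × ℝ} (q : Vec d × ℝ)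
    (he : Explores p (C t) (t + 1) (design p C t h)) :
    design p C (t + 1) (Fin.snoc (α := fun _ => Vec d × ℝ) h q) = q :: design p C t h := by
  rw [design_succ_of_explores (by rwa [snoc_comp_castSucc]), snoc_comp_castSucc, Fin.snoc_last]

theorem design_snoc_of_not_explores {t : ℕ} {h : Fin t → Vec d × ℝ} (q : Vec d × ℝ)
    (he : ¬ Explores p (C t) (t + 1) (design p C t h)) :
    design p C (t + 1) (Fin.snoc (α := fun _ => Vec d × ℝ) h q) = design p C t h := by
  rw [design_succ_of_not_explores (by rwa [snoc_comp_castSucc]), snoc_comp_castSucc]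

/-- A nonnegative function of the recorded data that does not increase in mean when a uniformly
drawn observation is added has, on the first `n` observations, mean at most its initial value. -/
theorem IsInstance.lintegral_rtake_le (hI : IsInstance T C β ν r R) (hd : 0 < d)
    (hr : 0 ≤ p.r) (hR : 0 ≤ p.R) (hlam : 0 < p.lam) (n : ℕ)
    {F : ℕ × (Fin d → Fin d → ℝ) × (Fin d → ℝ) → ℝ≥0∞} (hF : Measurable F)
    (hstep : ∀ t < T, ∀ D : List (Vec d × ℝ), D.length < n → (∀ q ∈ D, ‖q.1‖ ≤ r) →
      ∫⁻ x, ∫⁻ y, F (stat ((x, y) :: D)) ∂(ν t x) ∂(cond (volume : Measure (Vec d)) (C t)) ≤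
        F (stat D)) {t : ℕ} (ht : t ≤ T) :
    ∫⁻ h, F (stat ((design p C t h).rtake n)) ∂(historyLaw p C ν t) ≤ F (stat []) := by
  induction t with
  | zero => simp [historyLaw, design, List.rtake]
  | succ t ih =>
    refine le_trans ?_ (ih (by omega))
    have hF' : Measurable fun h : Fin (t + 1) → Vec d × ℝ =>
        F (stat ((design p C (t + 1) h).rtake n)) :=
      hF.comp (hI.measurable_stat_rtake_design hd p n ht)
    rw [hI.lintegral_historyLaw_succ hd hr hR hlam ht hF']
    refine lintegral_mono_ae ?_
    filter_upwards [hI.ae_historyLaw_mem hd hr hR hlam (by omega : t ≤ T) (ν := ν)] with h hh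
    have := hI.isProbabilityMeasure_actionDist p ht h
    have := hI.markov t ht
    -- Only an exploration with fewer than `n` recorded observations changes the prefix; otherwise
    -- the integrand does not depend on the new round.
    by_cases he : Explores p (C t) (t + 1) (design p C t h)
    · simp only [design_snoc_of_explores _ he]
      by_cases hn : (design p C t h).length < n
      · have hact : actionDist p C t h = cond volume (C t) := by
          rw [actionDist, playDist, if_pos he]
        simp only [(rtake_cons_of_lt hn).1, (rtake_cons_of_lt (q := (0 : Vec d × ℝ)) hn).2, hact]
        exact hstep t ht _ hn fun q hq =>
          hI.norm_le_of_mem_design (by omega) (fun i => (hh i).1) hq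
      · simp [rtake_cons_of_le (not_lt.1 hn)]
    · simp [design_snoc_of_not_explores _ he]

end Law

end FairBandit

namespace FairBandit

/-! ### Trace of powers under a rank one update -/

section Trace

open Matrix

variable {n : Type*} [Fintype n]

/-- Chebyshev's sum inequality: `w ^ k` and `w ^ l` are ordered alike, so the symmetrized double sum
of products of differences is nonnegative. -/
theorem sum_mul_sum_pow_le {ι : Type*} [Fintype ι] {w q : ι → ℝ} (hw : ∀ i, 0 ≤ w i)
    (hq : ∀ i, 0 ≤ q i) (k l : ℕ) :
    (∑ i, w i ^ k * q i) * (∑ i, w i ^ l * q i) ≤ (∑ i, q i) * ∑ i, w i ^ (k + l) * q i := by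
  have h : 0 ≤ ∑ i, ∑ j, q i * q j * ((w i ^ k - w j ^ k) * (w i ^ l - w j ^ l)) := by
    refine Finset.sum_nonneg fun i _ => Finset.sum_nonneg fun j _ =>
      mul_nonneg (mul_nonneg (hq i) (hq j)) ?_
    rcases le_total (w i) (w j) with hij | hij
    · exact mul_nonneg_of_nonpos_of_nonpos
        (sub_nonpos.2 (pow_le_pow_left₀ (hw i) hij k))
        (sub_nonpos.2 (pow_le_pow_left₀ (hw i) hij l))
    · exact mul_nonneg (sub_nonneg.2 (pow_le_pow_left₀ (hw j) hij k))
        (sub_nonneg.2 (pow_le_pow_left₀ (hw j) hij l))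
  have e1 : ∑ i, ∑ j, q i * q j * ((w i ^ k - w j ^ k) * (w i ^ l - w j ^ l)) =
      ∑ i, ∑ j, ((w i ^ (k + l) * q i) * q j + q i * (w j ^ (k + l) * q j)
        - (w i ^ k * q i) * (w j ^ l * q j) - (w i ^ l * q i) * (w j ^ k * q j)) :=
    Finset.sum_congr rfl fun i _ => Finset.sum_congr rfl fun j _ => by ring
  rw [e1] at h
  simp only [Finset.sum_add_distrib, Finset.sum_sub_distrib, ← Finset.sum_mul_sum] at h
  linarith

theorem dotProduct_vecMulVec_mulVec (x v : n → ℝ) :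
    v ⬝ᵥ (vecMulVec x x *ᵥ v) = (x ⬝ᵥ v) ^ 2 := by
  rw [vecMulVec_mulVec]
  simp [dotProduct_smul, dotProduct_comm v x, pow_two]

/-- The quadratic form at `x` as a linear functional of the matrix. -/
def quadForm (x : n → ℝ) : Matrix n n ℝ →ₗ[ℝ] ℝ where
  toFun A := x ⬝ᵥ (A *ᵥ x)
  map_add' A B := by rw [add_mulVec, dotProduct_add]
  map_smul' a A := by rw [smul_mulVec, dotProduct_smul]; rfl

theorem quadForm_mul_vecMulVec_mul (x : n → ℝ) (A B : Matrix n n ℝ) :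
    quadForm x (A * vecMulVec x x * B) = (x ⬝ᵥ (A *ᵥ x)) * (x ⬝ᵥ (B *ᵥ x)) := by
  change x ⬝ᵥ ((A * vecMulVec x x * B) *ᵥ x) = _
  rw [← mulVec_mulVec, ← mulVec_mulVec, vecMulVec_mulVec, mulVec_smul, dotProduct_smul]
  rfl

theorem trace_vecMulVec_mul (x : n → ℝ) (A : Matrix n n ℝ) :
    (vecMulVec x x * A).trace = x ⬝ᵥ (A *ᵥ x) := by
  rw [vecMulVec_mul, trace_vecMulVec, dotProduct_mulVec, dotProduct_comm]

variable [DecidableEq n]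

theorem dotProduct_pow_mul_dotProduct_pow_le {W : Matrix n n ℝ} (hW : W.PosSemidef) (k l : ℕ)
    (x : n → ℝ) :
    (x ⬝ᵥ (W ^ k *ᵥ x)) * (x ⬝ᵥ (W ^ l *ᵥ x)) ≤ (x ⬝ᵥ x) * (x ⬝ᵥ (W ^ (k + l) *ᵥ x)) := by
  have h0 := dotProduct_pow_mulVec hW.1 0 x
  simp only [pow_zero, one_mulVec, one_mul] at h0
  rw [dotProduct_pow_mulVec hW.1, dotProduct_pow_mulVec hW.1, dotProduct_pow_mulVec hW.1, h0]
  exact sum_mul_sum_pow_le hW.eigenvalues_nonneg (fun i => sq_nonneg _) k l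

theorem mul_dotProduct_pow_le {W : Matrix n n ℝ} (hW : W.IsHermitian) {c : ℝ} (hc : 0 ≤ c)
    (h : ∀ v, c * (v ⬝ᵥ v) ≤ v ⬝ᵥ (W *ᵥ v)) (k : ℕ) (x : n → ℝ) :
    c * (x ⬝ᵥ (W ^ k *ᵥ x)) ≤ x ⬝ᵥ (W ^ (k + 1) *ᵥ x) := by
  rw [dotProduct_pow_mulVec hW, dotProduct_pow_mulVec hW, Finset.mul_sum]
  refine Finset.sum_le_sum fun i _ => ?_
  obtain ⟨v, hv, hvi⟩ := eigenvalues_eq_dotProduct hW i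
  have hci : c ≤ hW.eigenvalues i := by simpa [hv, ← hvi] using h v
  have := pow_nonneg (hc.trans hci) k
  rw [pow_succ, ← mul_assoc, mul_comm c]
  exact mul_le_mul_of_nonneg_right (mul_le_mul_of_nonneg_left hci this) (sq_nonneg _)

theorem posSemidef_of_le {W : Matrix n n ℝ} (hW : W.IsHermitian) {c : ℝ} (hc : 0 ≤ c)
    (h : ∀ v, c * (v ⬝ᵥ v) ≤ v ⬝ᵥ (W *ᵥ v)) : W.PosSemidef := by
  refine hW.posSemidef_iff_eigenvalues_nonneg.2 fun i => ?_
  obtain ⟨v, hv, hvi⟩ := eigenvalues_eq_dotProduct hW i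
  have hci : c ≤ hW.eigenvalues i := by simpa [hv, ← hvi] using h v
  exact hc.trans hci

open scoped Matrix.Norms.Operator in
theorem hasDerivAt_linearMap_pow (L : Matrix n n ℝ →ₗ[ℝ] ℝ) (W B : Matrix n n ℝ) (N : ℕ) (s : ℝ) :
    HasDerivAt (fun s : ℝ => L ((W - s • B) ^ N))
      (-∑ i ∈ Finset.range N, L ((W - s • B) ^ (N - 1 - i) * B * (W - s • B) ^ i)) s := by
  have h := (((hasDerivAt_id s).smul_const B).const_sub W).fun_pow' N
  have h2 := (LinearMap.toContinuousLinearMap L).hasFDerivAt.comp_hasDerivAt s h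
  refine HasDerivAt.congr_deriv h2 ?_
  change L _ = _
  simp [Finset.sum_neg_distrib]

/-- Interpolate by `W_s = W - s B` with `B = (θ / (N + 1)) x xᵀ` and put `φ(s) = xᵀ W_s^N x`. The
trace of `W_s^(N+1)` has derivative `-θ φ(s)`. In `φ'` each product of two forms is at most `ρ xᵀ
W_s^(N-1) x` by Chebyshev, and `W_s ≥ c` bounds this by `ρ φ(s) / c`. So `φ' ≥ -m φ` with `m =
θρ/c`, hence `φ(s) ≥ exp (-m s) φ(0)`; integrating gives the factor `θ/m = c/ρ`. -/
theorem trace_pow_sub_vecMulVec_le {W : Matrix n n ℝ} (hW : W.IsHermitian) {x : n → ℝ}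
    {θ ρ c : ℝ} (hθ : 0 < θ) (hρ : 0 < ρ) (hc : 0 < c) (hx : x ⬝ᵥ x ≤ ρ) (N : ℕ)
    (h : ∀ v, c * (v ⬝ᵥ v) ≤ v ⬝ᵥ ((W - (θ / (N + 1)) • vecMulVec x x) *ᵥ v)) :
    ((W - (θ / (N + 1)) • vecMulVec x x) ^ (N + 1)).trace ≤
      (W ^ (N + 1)).trace - c / ρ * (1 - Real.exp (-(θ * ρ / c))) * (x ⬝ᵥ (W ^ N *ᵥ x)) := by
  set a := θ / (N + 1 : ℝ) with ha
  have haN : a * (N + 1) = θ := by rw [ha]; field_simp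
  have ha0 : 0 < a := by positivity
  set B := a • vecMulVec x x with hB
  set m := θ * ρ / c with hm
  have hm0 : 0 < m := by positivity
  have hBh : B.IsHermitian := by
    ext i j
    simp [hB, vecMulVec_apply, mul_comm]
  have hWs : ∀ s : ℝ, (W - s • B).IsHermitian := fun s => by
    refine hW.sub ?_
    ext i j
    simpa using congrArg (s * ·) (hBh.apply i j)
  have hquad : ∀ s ∈ Set.Icc (0 : ℝ) 1, ∀ v, c * (v ⬝ᵥ v) ≤ v ⬝ᵥ ((W - s • B) *ᵥ v) := by
    intro s hs v
    have h1 := h v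
    rw [hB, smul_smul, sub_mulVec, dotProduct_sub, smul_mulVec, dotProduct_smul,
      dotProduct_vecMulVec_mulVec, smul_eq_mul] at *
    have : s * a * (x ⬝ᵥ v) ^ 2 ≤ 1 * a * (x ⬝ᵥ v) ^ 2 := by
      gcongr
      exact hs.2
    linarith
  set φ : ℝ → ℝ := fun s => x ⬝ᵥ ((W - s • B) ^ N *ᵥ x) with hφ
  have hφd : ∀ s, HasDerivAt φ (-∑ i ∈ Finset.range N,
      a * ((x ⬝ᵥ ((W - s • B) ^ (N - 1 - i) *ᵥ x)) * (x ⬝ᵥ ((W - s • B) ^ i *ᵥ x)))) s := by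
    intro s
    refine (hasDerivAt_linearMap_pow (quadForm x) W B N s).congr_deriv ?_
    congr 1
    refine Finset.sum_congr rfl fun i _ => ?_
    rw [hB, Matrix.mul_smul, smul_mul, map_smul, quadForm_mul_vecMulVec_mul, smul_eq_mul]
  have htd : ∀ s, HasDerivAt (fun s : ℝ => ((W - s • B) ^ (N + 1)).trace) (-(θ * φ s)) s := by
    intro s
    refine (hasDerivAt_linearMap_pow (traceLinearMap n ℝ ℝ) W B (N + 1) s).congr_deriv ?_
    congr 1
    rw [Finset.sum_congr rfl (g := fun _ => a * φ s) fun i hi => ?_]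
    · simp only [Finset.sum_const, Finset.card_range, nsmul_eq_mul, Nat.cast_add, Nat.cast_one]
      rw [← haN]
      ring
    · have hi' : i ≤ N := Nat.lt_succ_iff.1 (Finset.mem_range.1 hi)
      rw [traceLinearMap_apply, trace_mul_comm, ← mul_assoc, ← pow_add, Nat.add_sub_cancel,
        Nat.add_sub_cancel' hi', trace_mul_comm, hB, smul_mul, trace_smul, trace_vecMulVec_mul,
        smul_eq_mul]
  have hφ0 : ∀ s ∈ Set.Icc (0 : ℝ) 1, 0 ≤ φ s := fun s hs => by
    have h1 := ((posSemidef_of_le (hWs s) hc.le (hquad s hs)).pow N).re_dotProduct_nonneg x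
    simpa using h1
  have hmono : MonotoneOn (fun s => Real.exp (m * s) * φ s) (Set.Icc 0 1) := by
    have hd : ∀ s, HasDerivAt (fun s => Real.exp (m * s) * φ s) _ s := fun s =>
      ((((hasDerivAt_id s).const_mul m).exp).mul (hφd s))
    refine monotoneOn_of_hasDerivWithinAt_nonneg (convex_Icc 0 1)
      (fun s _ => (hd s).continuousAt.continuousWithinAt)
      (fun s _ => (hd s).hasDerivWithinAt) fun s hs => ?_
    rw [interior_Icc] at hs
    have hs' := Set.Ioo_subset_Icc_self hs
    have hpsd := posSemidef_of_le (hWs s) hc.le (hquad s hs')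
    have hsum : ∑ i ∈ Finset.range N, a * ((x ⬝ᵥ ((W - s • B) ^ (N - 1 - i) *ᵥ x)) *
        (x ⬝ᵥ ((W - s • B) ^ i *ᵥ x))) ≤ m * φ s := by
      rcases Nat.eq_zero_or_pos N with hN | hN
      · have h1 := hφ0 s hs'
        rw [Finset.sum_eq_zero fun i hi => by simp [hN] at hi]
        positivity
      have hlow := mul_dotProduct_pow_le (hWs s) hc.le (hquad s hs') (N - 1) x
      rw [Nat.sub_add_cancel hN] at hlow
      have hQ : 0 ≤ x ⬝ᵥ ((W - s • B) ^ (N - 1) *ᵥ x) := by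
        simpa using (hpsd.pow (N - 1)).re_dotProduct_nonneg x
      calc _ ≤ ∑ i ∈ Finset.range N, a * (ρ * (x ⬝ᵥ ((W - s • B) ^ (N - 1) *ᵥ x))) := by
            refine Finset.sum_le_sum fun i hi => mul_le_mul_of_nonneg_left ?_ ha0.le
            have h1 := dotProduct_pow_mul_dotProduct_pow_le hpsd (N - 1 - i) i x
            rw [Nat.sub_add_cancel (by have := Finset.mem_range.1 hi; omega)] at h1
            exact h1.trans (mul_le_mul_of_nonneg_right hx hQ)
        _ = a * N * ρ * (x ⬝ᵥ ((W - s • B) ^ (N - 1) *ᵥ x)) := by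
            simp only [Finset.sum_const, Finset.card_range, nsmul_eq_mul]
            ring
        _ ≤ θ * ρ * (x ⬝ᵥ ((W - s • B) ^ (N - 1) *ᵥ x)) := by
            refine mul_le_mul_of_nonneg_right (mul_le_mul_of_nonneg_right ?_ hρ.le) hQ
            rw [← haN]
            nlinarith
        _ = m * (c * (x ⬝ᵥ ((W - s • B) ^ (N - 1) *ᵥ x))) := by
            rw [hm]
            field_simp
        _ ≤ m * φ s := mul_le_mul_of_nonneg_left hlow hm0.le
    have he := Real.exp_pos (m * s)
    simp only [id, mul_one]
    nlinarith [mul_nonneg he.le (sub_nonneg.2 hsum)]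
  have hlb : ∀ s ∈ Set.Icc (0 : ℝ) 1, Real.exp (-(m * s)) * φ 0 ≤ φ s := fun s hs => by
    have h1 := hmono (Set.left_mem_Icc.2 zero_le_one) hs hs.1
    simp only [mul_zero, Real.exp_zero, one_mul] at h1
    rw [Real.exp_neg, inv_mul_le_iff₀ (Real.exp_pos _)]
    exact h1
  have hanti : AntitoneOn (fun s => ((W - s • B) ^ (N + 1)).trace +
      c / ρ * (1 - Real.exp (-(m * s))) * φ 0) (Set.Icc 0 1) := by
    have hd : ∀ s, HasDerivAt (fun s => ((W - s • B) ^ (N + 1)).trace +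
        c / ρ * (1 - Real.exp (-(m * s))) * φ 0) _ s := fun s =>
      (htd s).add ((((((hasDerivAt_id s).const_mul m).neg.exp).const_sub 1).const_mul
        (c / ρ)).mul_const (φ 0))
    refine antitoneOn_of_hasDerivWithinAt_nonpos (convex_Icc 0 1)
      (fun s _ => (hd s).continuousAt.continuousWithinAt)
      (fun s _ => (hd s).hasDerivWithinAt) fun s hs => ?_
    rw [interior_Icc] at hs
    have h1 := hlb s (Set.Ioo_subset_Icc_self hs)
    have h2 : c / ρ * m = θ := by rw [hm]; field_simp
    simp only [id, mul_one]
    have h3 : -(θ * φ s) + c / ρ * -(Real.exp (-(m * s)) * -m) * φ 0 =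
        -θ * (φ s - Real.exp (-(m * s)) * φ 0) := by
      rw [← h2]; ring
    refine (le_of_eq h3).trans ?_
    nlinarith
  have hfin := hanti (Set.left_mem_Icc.2 zero_le_one) (Set.right_mem_Icc.2 zero_le_one) zero_le_one
  simp only [one_smul, mul_one, zero_smul, sub_zero, mul_zero, neg_zero, Real.exp_zero, sub_self,
    zero_mul, add_zero, hφ] at hfin
  linarith

theorem dotProduct_pow_succ_le {W : Matrix n n ℝ} (hW : W.PosSemidef)
    (h : ∀ v, v ⬝ᵥ (W *ᵥ v) ≤ v ⬝ᵥ v) (k : ℕ) (x : n → ℝ) :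
    x ⬝ᵥ (W ^ (k + 1) *ᵥ x) ≤ x ⬝ᵥ (W ^ k *ᵥ x) := by
  rw [dotProduct_pow_mulVec hW.1, dotProduct_pow_mulVec hW.1]
  refine Finset.sum_le_sum fun i _ => mul_le_mul_of_nonneg_right ?_ (sq_nonneg _)
  obtain ⟨v, hv, hvi⟩ := eigenvalues_eq_dotProduct hW.1 i
  have h1 : hW.1.eigenvalues i ≤ 1 := by simpa [hv, ← hvi] using h v
  exact pow_le_pow_of_le_one (hW.eigenvalues_nonneg i) h1 (Nat.le_succ k)

theorem trace_eq_sum_dotProduct (A : Matrix n n ℝ) :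
    A.trace = ∑ i, Pi.single i 1 ⬝ᵥ (A *ᵥ Pi.single i 1) := by
  simp [Matrix.trace]

theorem trace_pow_succ_le {W : Matrix n n ℝ} (hW : W.PosSemidef)
    (h : ∀ v, v ⬝ᵥ (W *ᵥ v) ≤ v ⬝ᵥ v) (k : ℕ) : (W ^ (k + 1)).trace ≤ (W ^ k).trace := by
  rw [trace_eq_sum_dotProduct, trace_eq_sum_dotProduct]
  exact Finset.sum_le_sum fun i _ => dotProduct_pow_succ_le hW h k _

/-- The form at a unit vector is an average of eigenvalues, so some eigenvalue is at least as large,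
and its power is one of the nonnegative terms of the trace. -/
theorem pow_dotProduct_le_trace_pow {W : Matrix n n ℝ} (hW : W.PosSemidef) {v : n → ℝ}
    (hv : v ⬝ᵥ v = 1) (k : ℕ) : (v ⬝ᵥ (W *ᵥ v)) ^ k ≤ (W ^ k).trace := by
  have h0 := dotProduct_pow_mulVec hW.1 0 v
  have h1 := dotProduct_pow_mulVec hW.1 1 v
  simp only [pow_zero, one_mulVec, one_mul, pow_one, hv] at h0 h1
  set q := fun i => ((hW.1.eigenvectorUnitary : Matrix n n ℝ)ᵀ *ᵥ v) i ^ 2 with hq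
  obtain ⟨i, hi⟩ : ∃ i, v ⬝ᵥ (W *ᵥ v) ≤ hW.1.eigenvalues i := by
    by_contra! hlt
    have h2 : ∑ i, hW.1.eigenvalues i * q i < ∑ i, (v ⬝ᵥ (W *ᵥ v)) * q i := by
      obtain ⟨j, hj⟩ : ∃ j, 0 < q j := by
        by_contra! hle
        have : ∑ i, q i ≤ 0 := Finset.sum_nonpos fun i _ => hle i
        linarith
      refine Finset.sum_lt_sum (fun i _ => mul_le_mul_of_nonneg_right (hlt i).le (sq_nonneg _))
        ⟨j, Finset.mem_univ j, mul_lt_mul_of_pos_right (hlt j) hj⟩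
    rw [← Finset.mul_sum, ← h0, mul_one, ← h1] at h2
    exact lt_irrefl _ h2
  have htr : (W ^ k).trace = ∑ i, hW.1.eigenvalues i ^ k := by
    conv_lhs => rw [hW.1.spectral_theorem, ← map_pow, Unitary.conjStarAlgAut_apply, diagonal_pow,
      trace_mul_cycle, Unitary.coe_star_mul_self, one_mul, trace_diagonal]
    rfl
  rw [htr]
  have hnn : 0 ≤ v ⬝ᵥ (W *ᵥ v) := by simpa using hW.re_dotProduct_nonneg v
  exact (pow_le_pow_left₀ hnn hi k).trans (Finset.single_le_sum
    (f := fun i => hW.1.eigenvalues i ^ k)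
    (fun i _ => pow_nonneg (hW.eigenvalues_nonneg i) k) (Finset.mem_univ i))

end Trace

end FairBandit

namespace FairBandit

variable {d : ℕ}

/-! ### The smallest eigenvalue of the design matrix -/

section Gram

open Matrix

theorem gram_cons (q : Vec d × ℝ) (D : List (Vec d × ℝ)) :
    gram (q :: D) = vecMulVec q.1.ofLp q.1.ofLp + gram D := by
  simp [gram]

theorem isHermitian_gram (D : List (Vec d × ℝ)) : (gram D).IsHermitian := by
  induction D with
  | nil => simp [gram]
  | cons q D ih =>
    rw [gram_cons]
    refine IsHermitian.add ?_ ih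
    ext i j
    simp [vecMulVec_apply, mul_comm]

theorem dotProduct_gram_cons (q : Vec d × ℝ) (D : List (Vec d × ℝ)) (v : Fin d → ℝ) :
    v ⬝ᵥ (gram (q :: D) *ᵥ v) = (q.1.ofLp ⬝ᵥ v) ^ 2 + v ⬝ᵥ (gram D *ᵥ v) := by
  rw [gram_cons, add_mulVec, dotProduct_add, dotProduct_vecMulVec_mulVec]

theorem dotProduct_gram_nonneg (D : List (Vec d × ℝ)) (v : Fin d → ℝ) :
    0 ≤ v ⬝ᵥ (gram D *ᵥ v) := by
  induction D with
  | nil => simp [gram]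
  | cons q D ih =>
    rw [dotProduct_gram_cons]
    positivity

theorem sq_dotProduct_le (x : Vec d) (v : Fin d → ℝ) :
    (x.ofLp ⬝ᵥ v) ^ 2 ≤ ‖x‖ ^ 2 * (v ⬝ᵥ v) := by
  have h1 := dotProduct_ofLp_eq_inner x (WithLp.toLp 2 v)
  have h2 := dotProduct_ofLp_self (WithLp.toLp 2 v)
  simp only at h1 h2
  rw [h1, h2, ← mul_pow, ← sq_abs]
  exact pow_le_pow_left₀ (abs_nonneg _) (abs_real_inner_le_norm _ _) 2

theorem dotProduct_gram_le {r : ℝ} {D : List (Vec d × ℝ)} (hD : ∀ q ∈ D, ‖q.1‖ ≤ r)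
    (v : Fin d → ℝ) : v ⬝ᵥ (gram D *ᵥ v) ≤ D.length * r ^ 2 * (v ⬝ᵥ v) := by
  induction D with
  | nil => simp [gram]
  | cons q D ih =>
    rw [dotProduct_gram_cons, List.length_cons]
    have h1 := ih fun q' hq' => hD q' (List.mem_cons_of_mem _ hq')
    have h2 := sq_dotProduct_le q.1 v
    have h3 : ‖q.1‖ ^ 2 ≤ r ^ 2 :=
      pow_le_pow_left₀ (norm_nonneg _) (hD q List.mem_cons_self) 2
    have h4 : 0 ≤ v ⬝ᵥ v := by
      simpa using dotProduct_star_self_nonneg v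
    push_cast
    nlinarith [mul_le_mul_of_nonneg_right h3 h4]

/-- `1 - (θ / (N + 1)) XᵀX`, whose `(N + 1)`-st power approximates `exp (-θ XᵀX)`. -/
noncomputable def damped (θ : ℝ) (N : ℕ) (A : Matrix (Fin d) (Fin d) ℝ) :
    Matrix (Fin d) (Fin d) ℝ :=
  1 - (θ / (N + 1)) • A

theorem dotProduct_damped (θ : ℝ) (N : ℕ) (A : Matrix (Fin d) (Fin d) ℝ) (v : Fin d → ℝ) :
    v ⬝ᵥ (damped θ N A *ᵥ v) = v ⬝ᵥ v - θ / (N + 1) * (v ⬝ᵥ (A *ᵥ v)) := by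
  rw [damped, sub_mulVec, one_mulVec, dotProduct_sub, smul_mulVec, dotProduct_smul, smul_eq_mul]

theorem isHermitian_damped (θ : ℝ) (N : ℕ) {A : Matrix (Fin d) (Fin d) ℝ} (hA : A.IsHermitian) :
    (damped θ N A).IsHermitian := by
  refine IsHermitian.sub isHermitian_one ?_
  ext i j
  simpa using congrArg (θ / (N + 1) * ·) (hA.apply i j)

theorem le_dotProduct_damped {θ r : ℝ} (hθ : 0 ≤ θ) (N : ℕ) {n : ℕ} {D : List (Vec d × ℝ)}
    (hD : ∀ q ∈ D, ‖q.1‖ ≤ r) (hn : D.length ≤ n) (v : Fin d → ℝ) :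
    (1 - θ * n * r ^ 2 / (N + 1)) * (v ⬝ᵥ v) ≤ v ⬝ᵥ (damped θ N (gram D) *ᵥ v) := by
  rw [dotProduct_damped, sub_mul, one_mul]
  have h4 : 0 ≤ v ⬝ᵥ v := by simpa using dotProduct_star_self_nonneg v
  have h1 : v ⬝ᵥ (gram D *ᵥ v) ≤ n * r ^ 2 * (v ⬝ᵥ v) :=
    (dotProduct_gram_le hD v).trans (by gcongr)
  have h2 := mul_le_mul_of_nonneg_left h1 (by positivity : 0 ≤ θ / (N + 1))
  have h3 : θ / (N + 1) * (n * r ^ 2 * (v ⬝ᵥ v)) = θ * n * r ^ 2 / (N + 1) * (v ⬝ᵥ v) := by ring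
  linarith

theorem dotProduct_damped_le {θ : ℝ} (hθ : 0 ≤ θ) (N : ℕ) (D : List (Vec d × ℝ))
    (v : Fin d → ℝ) : v ⬝ᵥ (damped θ N (gram D) *ᵥ v) ≤ v ⬝ᵥ v := by
  rw [dotProduct_damped]
  have := dotProduct_gram_nonneg D v
  have : 0 ≤ θ / (N + 1) * (v ⬝ᵥ (gram D *ᵥ v)) := by positivity
  linarith

/-- The exponent is even so that the power is `AᵀA` with `A = W ^ m`: the form is then a sum of
squares `⟨row, x⟩²`, and the trace the sum of the squared row norms. -/
theorem lam_mul_trace_le_integral {C : Set (Vec d)} (hC : IsCompact C) {lam : ℝ}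
    (hlam : ∀ v : Vec d, lam * ‖v‖ ^ 2 ≤
      ∫ x, inner ℝ v x ^ 2 ∂(cond (volume : Measure (Vec d)) C))
    {W : Matrix (Fin d) (Fin d) ℝ} (hW : W.IsHermitian) (m : ℕ) :
    lam * (W ^ (2 * m)).trace ≤
      ∫ x : Vec d, x.ofLp ⬝ᵥ (W ^ (2 * m) *ᵥ x.ofLp) ∂(cond (volume : Measure (Vec d)) C) := by
  set A := W ^ m with hA
  have hAh : Aᵀ = A := by
    rw [hA, transpose_pow]
    congr 1
  have hpow : W ^ (2 * m) = Aᵀ * A := by rw [hAh, hA, ← pow_add, two_mul]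
  have h1 : ∀ x : Vec d, x.ofLp ⬝ᵥ (W ^ (2 * m) *ᵥ x.ofLp) =
      ∑ i, inner ℝ (WithLp.toLp 2 (A i)) x ^ 2 := fun x => by
    rw [hpow, ← mulVec_mulVec, dotProduct_mulVec, vecMul_transpose, dotProduct]
    refine Finset.sum_congr rfl fun i _ => ?_
    rw [← dotProduct_ofLp_eq_inner, pow_two]
    rfl
  have h2 : (W ^ (2 * m)).trace = ∑ i, ‖(WithLp.toLp 2 (A i) : Vec d)‖ ^ 2 := by
    rw [hpow, trace_mul_comm, Matrix.trace]
    refine Finset.sum_congr rfl fun i _ => ?_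
    rw [← dotProduct_ofLp_self]
    rfl
  simp_rw [h1]
  rw [integral_finsetSum _ fun i _ => integrable_cond_of_continuous hC (continuous_inner_sq _),
    h2, Finset.mul_sum]
  exact Finset.sum_le_sum fun i _ => hlam _

/-- Average the rank one estimate over `x`. The mean decrement is a multiple of `λ tr W^(2m)`, and
`tr W^(2m) ≥ tr W^(2m+1)` because `0 ≤ W ≤ 1`, so the trace contracts. -/
theorem integral_trace_damped_le {C : Set (Vec d)} (hC : IsCompact C) (hvol : 0 < volume C)
    {r lam θ : ℝ} (hr : 0 < r) (hCr : ∀ x ∈ C, ‖x‖ ≤ r) (hlam0 : 0 ≤ lam) (hθ : 0 < θ)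
    (hlam : ∀ v : Vec d, lam * ‖v‖ ^ 2 ≤
      ∫ x, inner ℝ v x ^ 2 ∂(cond (volume : Measure (Vec d)) C))
    {m n : ℕ} (hc : 0 < 1 - θ * n * r ^ 2 / ((2 * m : ℕ) + 1))
    {D : List (Vec d × ℝ)} (hD : ∀ q ∈ D, ‖q.1‖ ≤ r) (hn : D.length < n) :
    ∫ x : Vec d, (damped θ (2 * m) (vecMulVec x.ofLp x.ofLp + gram D) ^ (2 * m + 1)).trace
        ∂(cond (volume : Measure (Vec d)) C) ≤
      (1 - (1 - θ * n * r ^ 2 / ((2 * m : ℕ) + 1)) * ((1 - Real.exp (-(θ * r ^ 2))) / r ^ 2) * lam)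
        * (damped θ (2 * m) (gram D) ^ (2 * m + 1)).trace := by
  set c := 1 - θ * n * r ^ 2 / ((2 * m : ℕ) + 1) with hcdef
  set W := damped θ (2 * m) (gram D) with hWdef
  have hp := isProbabilityMeasure_cond hC hvol
  have hWh : W.IsHermitian := isHermitian_damped _ _ (isHermitian_gram D)
  have hWc := le_dotProduct_damped hθ.le (2 * m) hD hn.le
  have hWp : W.PosSemidef := posSemidef_of_le hWh hc.le hWc
  have hc1 : c ≤ 1 := by
    rw [hcdef, sub_le_self_iff]
    positivity
  have hcont1 : Continuous fun x : Vec d =>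
      (damped θ (2 * m) (vecMulVec x.ofLp x.ofLp + gram D) ^ (2 * m + 1)).trace := by
    unfold damped
    fun_prop
  have hcont2 : Continuous fun x : Vec d => x.ofLp ⬝ᵥ (W ^ (2 * m) *ᵥ x.ofLp) := by
    fun_prop
  have hg : 1 - Real.exp (-(θ * r ^ 2)) ≤ 1 - Real.exp (-(θ * r ^ 2 / c)) := by
    refine sub_le_sub_left (Real.exp_le_exp.2 (neg_le_neg ?_)) _
    rw [le_div_iff₀ hc]
    exact mul_le_of_le_one_right (by positivity) hc1
  have hg0 : 0 ≤ 1 - Real.exp (-(θ * r ^ 2)) := by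
    rw [sub_nonneg, Real.exp_le_one_iff]
    have : 0 ≤ θ * r ^ 2 := by positivity
    linarith
  have hpt : ∀ᵐ x ∂(cond (volume : Measure (Vec d)) C),
      (damped θ (2 * m) (vecMulVec x.ofLp x.ofLp + gram D) ^ (2 * m + 1)).trace ≤
        (W ^ (2 * m + 1)).trace -
          c * ((1 - Real.exp (-(θ * r ^ 2))) / r ^ 2) * (x.ofLp ⬝ᵥ (W ^ (2 * m) *ᵥ x.ofLp)) := by
    filter_upwards [ae_cond_mem hC.measurableSet] with x hx
    have hxr := hCr x hx
    have heq : damped θ (2 * m) (vecMulVec x.ofLp x.ofLp + gram D) =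
        W - (θ / ((2 * m : ℕ) + 1)) • vecMulVec x.ofLp x.ofLp := by
      rw [hWdef, damped, damped, smul_add]
      abel
    have hquad := le_dotProduct_damped hθ.le (2 * m) (n := n) (D := (x, 0) :: D)
      (List.forall_mem_cons.2 ⟨hxr, hD⟩) (by simpa using hn)
    rw [gram_cons, heq] at hquad
    have hx2 : x.ofLp ⬝ᵥ x.ofLp ≤ r ^ 2 := by
      rw [dotProduct_ofLp_self]
      exact pow_le_pow_left₀ (norm_nonneg _) hxr 2
    have := trace_pow_sub_vecMulVec_le hWh hθ (by positivity) hc hx2 (2 * m) hquad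
    rw [heq]
    refine this.trans (sub_le_sub_left ?_ _)
    have hnn : 0 ≤ x.ofLp ⬝ᵥ (W ^ (2 * m) *ᵥ x.ofLp) := by
      simpa using (hWp.pow (2 * m)).re_dotProduct_nonneg x.ofLp
    refine mul_le_mul_of_nonneg_right ?_ hnn
    rw [← mul_div_assoc, div_mul_eq_mul_div]
    gcongr
  refine (integral_mono_ae (integrable_cond_of_continuous hC hcont1)
    ((integrable_const _).sub ((integrable_cond_of_continuous hC hcont2).const_mul _)) hpt).trans ?_
  rw [integral_sub' (integrable_const _) ((integrable_cond_of_continuous hC hcont2).const_mul _),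
    integral_const_mul]
  have h1 := lam_mul_trace_le_integral hC hlam hWh m
  have h2 := trace_pow_succ_le hWp (dotProduct_damped_le hθ.le (2 * m) D) (2 * m)
  have h3 : c * ((1 - Real.exp (-(θ * r ^ 2))) / r ^ 2) * (lam * (W ^ (2 * m + 1)).trace) ≤
      c * ((1 - Real.exp (-(θ * r ^ 2))) / r ^ 2) *
        ∫ x : Vec d, x.ofLp ⬝ᵥ (W ^ (2 * m) *ᵥ x.ofLp) ∂(cond (volume : Measure (Vec d)) C) :=
    mul_le_mul_of_nonneg_left ((mul_le_mul_of_nonneg_left h2 hlam0).trans h1) (by positivity)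
  simp only [integral_const, probReal_univ, one_smul]
  linarith

variable {p : Params} {T : ℕ} {C : ℕ → Set (Vec d)} {β : Vec d} {ν : ℕ → Kernel (Vec d) ℝ} {r : ℝ}
  {R : ℝ≥0}

theorem mem_of_mem_rtake {α : Type*} {D : List α} {n : ℕ} {q : α} (h : q ∈ D.rtake n) : q ∈ D :=
  List.mem_of_mem_drop h

/-- The trace potential of the first `n` observations. -/
noncomputable def tracePotential (θ b : ℝ) (m n : ℕ)
    (q : ℕ × (Fin d → Fin d → ℝ) × (Fin d → ℝ)) : ℝ≥0∞ :=
  ENNReal.ofReal ((damped θ (2 * m) (Matrix.of q.2.1) ^ (2 * m + 1)).trace * b ^ (n - q.1))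

theorem measurable_tracePotential (θ b : ℝ) (m n : ℕ) :
    Measurable (tracePotential (d := d) θ b m n) := by
  have hc : Continuous fun A : Fin d → Fin d → ℝ =>
      (damped θ (2 * m) (Matrix.of A) ^ (2 * m + 1)).trace := by
    have : Continuous fun A : Matrix (Fin d) (Fin d) ℝ =>
        (damped θ (2 * m) A ^ (2 * m + 1)).trace := by
      unfold damped
      fun_prop
    exact this
  exact ((hc.measurable.comp (measurable_fst.comp measurable_snd)).mul
    ((measurable_from_top (f := fun k : ℕ => b ^ (n - k))).comp measurable_fst)).ennreal_ofReal

theorem tracePotential_stat (θ b : ℝ) (m n : ℕ) (D : List (Vec d × ℝ)) :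
    tracePotential θ b m n (stat D) = ENNReal.ofReal
      ((damped θ (2 * m) (gram D) ^ (2 * m + 1)).trace * b ^ (n - D.length)) := rfl

theorem IsInstance.lambdaMin_le (hI : IsInstance T C β ν r R) (hd : 0 < d) (hT : 0 < T) :
    lambdaMin T C ≤ r ^ 2 := by
  refine le_trans ?_ (hI.card_mul_lambdaMin_le hT)
  exact le_mul_of_one_le_left (hI.lambdaMin_pos hd hT).le (by exact_mod_cast hd)

theorem IsInstance.contraction_nonneg (hI : IsInstance T C β ν r R) (hd : 0 < d) (hT : 0 < T)
    {θ : ℝ} (hθ : 0 < θ) (m n : ℕ) :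
    0 ≤ 1 - (1 - θ * n * r ^ 2 / ((2 * m : ℕ) + 1)) *
        ((1 - Real.exp (-(θ * r ^ 2))) / r ^ 2) * lambdaMin T C := by
  have hr := hI.radius_pos hd hT
  have hlam := hI.lambdaMin_pos hd hT
  have h1 : 1 - θ * n * r ^ 2 / ((2 * m : ℕ) + 1) ≤ 1 := by
    rw [sub_le_self_iff]
    positivity
  have h2 : 1 - Real.exp (-(θ * r ^ 2)) ≤ 1 := by
    rw [sub_le_self_iff]
    exact (Real.exp_pos _).le
  have h2' : 0 ≤ 1 - Real.exp (-(θ * r ^ 2)) := by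
    rw [sub_nonneg, Real.exp_le_one_iff]
    have : 0 ≤ θ * r ^ 2 := by positivity
    linarith
  have h3 := hI.lambdaMin_le hd hT
  rw [sub_nonneg]
  calc _ ≤ 1 * (1 / r ^ 2) * r ^ 2 := by gcongr
    _ = 1 := by field_simp

/-- An observation contracts the mean trace by the base of the power in the potential, and that
power loses exactly one factor. -/
theorem IsInstance.lintegral_tracePotential_le (hI : IsInstance T C β ν r R) (hd : 0 < d)
    (hT : 0 < T) {θ : ℝ} (hθ : 0 < θ) {m n : ℕ}
    (hc : 0 < 1 - θ * n * r ^ 2 / ((2 * m : ℕ) + 1)) {t : ℕ} (ht : t < T)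
    {D : List (Vec d × ℝ)} (hn : D.length < n) (hD : ∀ q ∈ D, ‖q.1‖ ≤ r) :
    ∫⁻ x, ∫⁻ y, tracePotential θ (1 - (1 - θ * n * r ^ 2 / ((2 * m : ℕ) + 1)) *
        ((1 - Real.exp (-(θ * r ^ 2))) / r ^ 2) * lambdaMin T C) m n (stat ((x, y) :: D)) ∂(ν t x)
        ∂(cond (volume : Measure (Vec d)) (C t)) ≤
      tracePotential θ (1 - (1 - θ * n * r ^ 2 / ((2 * m : ℕ) + 1)) *
        ((1 - Real.exp (-(θ * r ^ 2))) / r ^ 2) * lambdaMin T C) m n (stat D) := by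
  have hC := hI.isCompact ht
  have hp := hI.isProbabilityMeasure_cond ht
  have hν := hI.markov t ht
  have hr := hI.radius_pos hd hT
  have hlam := hI.lambdaMin_pos hd hT
  have hint := integral_trace_damped_le hC (hI.volume_pos t ht) hr (fun x hx => hI.norm_le ht hx)
    hlam.le hθ (hI.lambdaMin_mul_le ht) hc hD hn
  set b := 1 - (1 - θ * n * r ^ 2 / ((2 * m : ℕ) + 1)) *
        ((1 - Real.exp (-(θ * r ^ 2))) / r ^ 2) * lambdaMin T C with hb
  have hb0 : 0 ≤ b := hI.contraction_nonneg hd hT hθ m n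
  have hcont : Continuous fun x : Vec d =>
      (damped θ (2 * m) (vecMulVec x.ofLp x.ofLp + gram D) ^ (2 * m + 1)).trace := by
    unfold damped
    fun_prop
  simp only [tracePotential_stat, gram_cons, List.length_cons, lintegral_const, measure_univ,
    mul_one]
  rw [← ofReal_integral_eq_lintegral_ofReal
    ((integrable_cond_of_continuous hC hcont).mul_const _)]
  · refine ENNReal.ofReal_le_ofReal ?_
    rw [integral_mul_const]
    calc _ ≤ (b * (damped θ (2 * m) (gram D) ^ (2 * m + 1)).trace) * b ^ (n - (D.length + 1)) :=
          mul_le_mul_of_nonneg_right hint (pow_nonneg hb0 _)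
      _ = (damped θ (2 * m) (gram D) ^ (2 * m + 1)).trace * b ^ (n - (D.length + 1) + 1) := by
          ring
      _ = _ := by
          congr 2
          omega
  · filter_upwards [ae_cond_mem hC.measurableSet] with x hx
    refine mul_nonneg ?_ (pow_nonneg hb0 _)
    have hquad := le_dotProduct_damped hθ.le (2 * m) (n := n) (D := (x, 0) :: D)
      (List.forall_mem_cons.2 ⟨hI.norm_le ht hx, hD⟩) (by simpa using hn)
    have hps := posSemidef_of_le (isHermitian_damped θ (2 * m) (isHermitian_gram ((x, 0) :: D)))
      hc.le hquad
    rw [gram_cons] at hps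
    exact (hps.pow _).trace_nonneg

/-- Markov's inequality: the potential starts at `d b^n`, and a unit vector with a small quadratic
form keeps the trace large. -/
theorem IsInstance.historyLaw_gram_mul_le (hI : IsInstance T C β ν r R) (hd : 0 < d) (hT : 0 < T)
    (hr : 0 ≤ p.r) (hR : 0 ≤ p.R) (hlam : 0 < p.lam) {θ κ : ℝ} (hθ : 0 < θ) (hκ1 : κ ≤ 1)
    {m n : ℕ} (hc : 0 < 1 - θ * n * r ^ 2 / ((2 * m : ℕ) + 1)) :
    (1 - θ * (κ * n * lambdaMin T C) / ((2 * m : ℕ) + 1)) ^ (2 * m + 1) *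
      (historyLaw p C ν T).real {h | ((design p C T h).rtake n).length = n ∧
        ∃ v, v ⬝ᵥ v = 1 ∧ v ⬝ᵥ (gram ((design p C T h).rtake n) *ᵥ v) < κ * n * lambdaMin T C} ≤
      d * (1 - (1 - θ * n * r ^ 2 / ((2 * m : ℕ) + 1)) *
        ((1 - Real.exp (-(θ * r ^ 2))) / r ^ 2) * lambdaMin T C) ^ n := by
  have hprob := hI.isProbabilityMeasure_historyLaw hd hr hR hlam le_rfl (ν := ν)
  have hlam0 := hI.lambdaMin_pos hd hT
  have hlamr := hI.lambdaMin_le hd hT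
  set b := 1 - (1 - θ * n * r ^ 2 / ((2 * m : ℕ) + 1)) *
        ((1 - Real.exp (-(θ * r ^ 2))) / r ^ 2) * lambdaMin T C with hb
  have hmain := hI.lintegral_rtake_le hd hr hR hlam n (measurable_tracePotential θ b m n)
    (fun t ht D hn hD => hI.lintegral_tracePotential_le hd hT hθ hc ht hn hD) le_rfl (p := p)
  have hmark := mul_meas_ge_le_lintegral (μ := historyLaw p C ν T)
    ((measurable_tracePotential θ b m n).comp (hI.measurable_stat_rtake_design hd p n le_rfl))
    (ENNReal.ofReal ((1 - θ * (κ * n * lambdaMin T C) / ((2 * m : ℕ) + 1)) ^ (2 * m + 1)))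
  set A := {h | ((design p C T h).rtake n).length = n ∧
        ∃ v, v ⬝ᵥ v = 1 ∧ v ⬝ᵥ (gram ((design p C T h).rtake n) *ᵥ v) < κ * n * lambdaMin T C}
  have hnn : 0 ≤ 1 - θ * (κ * n * lambdaMin T C) / ((2 * m : ℕ) + 1) := by
    refine hc.le.trans (sub_le_sub_left (div_le_div_of_nonneg_right ?_ (by positivity)) _)
    calc θ * (κ * n * lambdaMin T C) ≤ θ * (1 * n * r ^ 2) := by gcongr
      _ = _ := by ring
  have hsub : historyLaw p C ν T A ≤ historyLaw p C ν T {h | ENNReal.ofReal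
      ((1 - θ * (κ * n * lambdaMin T C) / ((2 * m : ℕ) + 1)) ^ (2 * m + 1)) ≤
        (tracePotential θ b m n ∘ fun h => stat ((design p C T h).rtake n)) h} := by
    refine measure_mono_ae ?_
    filter_upwards [hI.ae_historyLaw_mem hd hr hR hlam le_rfl (ν := ν)] with h hh hA
    obtain ⟨hlen, v, hv, hlt⟩ := hA
    change ENNReal.ofReal _ ≤ tracePotential θ b m n (stat ((design p C T h).rtake n))
    rw [tracePotential_stat, hlen, Nat.sub_self, pow_zero, mul_one]
    refine ENNReal.ofReal_le_ofReal ?_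
    have hquad := le_dotProduct_damped hθ.le (2 * m) (n := n)
      (D := (design p C T h).rtake n) (fun q hq => hI.norm_le_of_mem_design le_rfl
        (fun i => (hh i).1) (mem_of_mem_rtake hq)) hlen.le
    have hps := posSemidef_of_le (isHermitian_damped θ (2 * m) (isHermitian_gram _)) hc.le hquad
    refine le_trans (pow_le_pow_left₀ hnn ?_ _) (pow_dotProduct_le_trace_pow hps hv _)
    rw [dotProduct_damped, hv, mul_div_right_comm]
    gcongr
  have h0 : tracePotential θ b m n (stat ([] : List (Vec d × ℝ))) =
      ENNReal.ofReal (d * b ^ n) := by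
    rw [tracePotential_stat]
    simp [gram, damped]
  rw [h0] at hmain
  have hfin := (mul_le_mul_right hsub _).trans (hmark.trans hmain)
  have hb0 : 0 ≤ b := hI.contraction_nonneg hd hT hθ m n
  have hfin' := ENNReal.toReal_mono ENNReal.ofReal_ne_top hfin
  rwa [ENNReal.toReal_mul, ENNReal.toReal_ofReal (pow_nonneg hnn _),
    ENNReal.toReal_ofReal (by positivity)] at hfin'

/-- Lower tail bound for the smallest eigenvalue of the design matrix. -/
theorem IsInstance.historyLaw_gram_lt_le (hI : IsInstance T C β ν r R) (hd : 0 < d) (hT : 0 < T)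
    (hr : 0 ≤ p.r) (hR : 0 ≤ p.R) (hlam : 0 < p.lam) {κ : ℝ} (hκ0 : 0 < κ) (hκ1 : κ < 1) (n : ℕ) :
    (historyLaw p C ν T).real {h | ((design p C T h).rtake n).length = n ∧
        ∃ v, v ⬝ᵥ v = 1 ∧ v ⬝ᵥ (gram ((design p C T h).rtake n) *ᵥ v) < κ * n * lambdaMin T C} ≤
      d * Real.exp (-(n * lambdaMin T C / r ^ 2 * (1 - κ + κ * Real.log κ))) := by
  have hr0 := hI.radius_pos hd hT
  have hlam0 := hI.lambdaMin_pos hd hT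
  -- The optimal choice: it makes `exp (-θ r²) = κ`, where the derivative in `θ` of the exponent
  -- vanishes.
  set θ := -Real.log κ / r ^ 2 with hθdef
  have hlog : Real.log κ < 0 := Real.log_neg hκ0 hκ1
  have hθ : 0 < θ := div_pos (neg_pos.2 hlog) (by positivity)
  have hθr : θ * r ^ 2 = -Real.log κ := by rw [hθdef]; field_simp
  set P := (historyLaw p C ν T).real {h | ((design p C T h).rtake n).length = n ∧
        ∃ v, v ⬝ᵥ v = 1 ∧ v ⬝ᵥ (gram ((design p C T h).rtake n) *ᵥ v) < κ * n * lambdaMin T C}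
  have hodd : Filter.Tendsto (fun m : ℕ => 2 * m + 1) Filter.atTop Filter.atTop :=
    Filter.tendsto_atTop_mono (fun m => by simp only [id]; omega) Filter.tendsto_id
  have hden : ∀ a : ℝ, Filter.Tendsto (fun m : ℕ => a / ((2 * m : ℕ) + 1 : ℝ)) Filter.atTop
      (nhds 0) := fun a => by
    have := (tendsto_const_div_atTop_nhds_zero_nat a).comp hodd
    refine this.congr fun m => ?_
    simp
  have hlim1 : Filter.Tendsto (fun m : ℕ =>
      (1 - θ * (κ * n * lambdaMin T C) / ((2 * m : ℕ) + 1)) ^ (2 * m + 1) * P) Filter.atTop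
      (nhds (Real.exp (-(θ * (κ * n * lambdaMin T C))) * P)) := by
    refine Filter.Tendsto.mul_const P ?_
    have := (Real.tendsto_one_add_div_pow_exp (-(θ * (κ * n * lambdaMin T C)))).comp hodd
    refine this.congr fun m => ?_
    simp only [Function.comp_apply]
    congr 1
    push_cast
    ring
  have hlim2 : Filter.Tendsto (fun m : ℕ => d * (1 - (1 - θ * n * r ^ 2 / ((2 * m : ℕ) + 1)) *
        ((1 - Real.exp (-(θ * r ^ 2))) / r ^ 2) * lambdaMin T C) ^ n) Filter.atTop
      (nhds (d * (1 - (1 - 0) * ((1 - Real.exp (-(θ * r ^ 2))) / r ^ 2) * lambdaMin T C) ^ n)) :=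
    (((((hden _).const_sub 1).mul_const _).mul_const _).const_sub 1).pow n |>.const_mul _
  have hev : ∀ᶠ m : ℕ in Filter.atTop, 0 < 1 - θ * n * r ^ 2 / ((2 * m : ℕ) + 1) := by
    have := (hden (θ * n * r ^ 2)).const_sub 1
    exact this.eventually (lt_mem_nhds (by norm_num))
  -- As `m → ∞` the power on the left becomes an exponential and the lower eigenvalue bound `c` of
  -- the damped matrix tends to `1`.
  have hle := le_of_tendsto_of_tendsto hlim1 hlim2 (hev.mono fun m hm =>
    hI.historyLaw_gram_mul_le hd hT hr hR hlam hθ hκ1.le hm)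
  rw [hθr, neg_neg, Real.exp_log hκ0, sub_zero, one_mul] at hle
  have h1 : 0 ≤ 1 - (1 - κ) / r ^ 2 * lambdaMin T C := by
    have := hI.lambdaMin_le hd hT
    rw [sub_nonneg, div_mul_eq_mul_div, div_le_one (by positivity)]
    nlinarith
  have h2 : (1 - (1 - κ) / r ^ 2 * lambdaMin T C) ^ n ≤
      Real.exp (-((1 - κ) / r ^ 2 * lambdaMin T C)) ^ n := by
    refine pow_le_pow_left₀ h1 ?_ n
    linarith [Real.add_one_le_exp (-((1 - κ) / r ^ 2 * lambdaMin T C))]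
  rw [← Real.exp_nat_mul] at h2
  have h3 : Real.exp (-(θ * (κ * n * lambdaMin T C))) * P ≤
      d * Real.exp (n * -((1 - κ) / r ^ 2 * lambdaMin T C)) :=
    hle.trans (by gcongr)
  calc P = Real.exp (θ * (κ * n * lambdaMin T C)) *
        (Real.exp (-(θ * (κ * n * lambdaMin T C))) * P) := by
        rw [← mul_assoc, ← Real.exp_add, add_neg_cancel, Real.exp_zero, one_mul]
    _ ≤ Real.exp (θ * (κ * n * lambdaMin T C)) *
        (d * Real.exp (n * -((1 - κ) / r ^ 2 * lambdaMin T C))) := by gcongr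
    _ = d * Real.exp (-(n * lambdaMin T C / r ^ 2 * (1 - κ + κ * Real.log κ))) := by
        rw [mul_left_comm, ← Real.exp_add, hθdef]
        congr 2
        field_simp
        ring

end Gram

end FairBandit

namespace FairBandit

/-! ### Sub-Gaussian noise -/

/-- Completing the square turns integrand times density into a constant times the Gaussian density
of mean `v / (1 - u)` and variance `1 / (1 - u)`. -/
theorem lintegral_exp_quadratic_gaussianReal {u : ℝ} (hu : u < 1) (v : ℝ) :
    ∫⁻ g, ENNReal.ofReal (Real.exp (u * g ^ 2 / 2 + v * g)) ∂(gaussianReal 0 1) =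
      ENNReal.ofReal ((√(1 - u))⁻¹ * Real.exp (v ^ 2 / (2 * (1 - u)))) := by
  have hu' : 0 < 1 - u := sub_pos.2 hu
  obtain ⟨w, hwu⟩ : ∃ w : ℝ≥0, (w : ℝ) = (1 - u)⁻¹ :=
    ⟨Real.toNNReal (1 - u)⁻¹, Real.coe_toNNReal _ (inv_pos.2 hu').le⟩
  have hw : w ≠ 0 := fun h => by
    rw [h] at hwu
    exact (inv_pos.2 hu').ne hwu
  rw [gaussianReal_of_var_ne_zero 0 one_ne_zero,
    lintegral_withDensity_eq_lintegral_mul _ (measurable_gaussianPDF 0 1) (by fun_prop)]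
  have hpt : ∀ g : ℝ, (gaussianPDF 0 1 * fun g => ENNReal.ofReal
      (Real.exp (u * g ^ 2 / 2 + v * g))) g =
      ENNReal.ofReal ((√(1 - u))⁻¹ * Real.exp (v ^ 2 / (2 * (1 - u)))) *
        gaussianPDF (v / (1 - u)) w g := by
    intro g
    simp only [Pi.mul_apply, gaussianPDF]
    rw [← ENNReal.ofReal_mul (gaussianPDFReal_nonneg _ _ _), ← ENNReal.ofReal_mul (by positivity)]
    congr 1
    simp only [gaussianPDFReal, NNReal.coe_one, hwu]
    have h1 : √(2 * Real.pi * (1 - u)⁻¹) = √(2 * Real.pi * 1) * (√(1 - u))⁻¹ := by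
      rw [mul_one, Real.sqrt_mul (by positivity), Real.sqrt_inv]
    have hs : √(1 - u) ≠ 0 := (Real.sqrt_pos.2 hu').ne'
    rw [h1, mul_inv, inv_inv]
    have h2 : Real.exp (-(g - 0) ^ 2 / (2 * 1)) * Real.exp (u * g ^ 2 / 2 + v * g) =
        Real.exp (v ^ 2 / (2 * (1 - u))) *
          Real.exp (-(g - v / (1 - u)) ^ 2 / (2 * (1 - u)⁻¹)) := by
      rw [← Real.exp_add, ← Real.exp_add]
      congr 1
      field_simp
      ring
    calc _ = (√(2 * Real.pi * 1))⁻¹ * (Real.exp (-(g - 0) ^ 2 / (2 * 1)) *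
          Real.exp (u * g ^ 2 / 2 + v * g)) := by ring
      _ = _ := by
        rw [h2]
        field_simp
  simp_rw [hpt]
  rw [lintegral_const_mul _ (measurable_gaussianPDF _ _), lintegral_gaussianPDF_eq_one _ hw,
    mul_one]

/-- `exp (a X² / 2)` is the mean of `exp (√a g X)` over a standard Gaussian `g`. After exchanging
integrals the exponent is linear in `X`, and the sub-Gaussian bound applies for each `g`. -/
theorem lintegral_exp_sq_le_of_hasSubgaussianMGF {Ω : Type*} [MeasurableSpace Ω] {μ : Measure Ω}
    [SFinite μ] {X : Ω → ℝ} {R2 : ℝ≥0} (hX : HasSubgaussianMGF X R2 μ) (hXm : Measurable X)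
    {a : ℝ} (ha : 0 ≤ a) (haR : a * R2 < 1) (b : ℝ) :
    ∫⁻ ω, ENNReal.ofReal (Real.exp (b * X ω + a * X ω ^ 2 / 2)) ∂μ ≤
      ENNReal.ofReal ((√(1 - a * R2))⁻¹ * Real.exp (R2 * b ^ 2 / (2 * (1 - a * R2)))) := by
  have h1 : ∀ ω, ENNReal.ofReal (Real.exp (b * X ω + a * X ω ^ 2 / 2)) =
      ∫⁻ g, ENNReal.ofReal (Real.exp ((b + √a * g) * X ω)) ∂(gaussianReal 0 1) := by
    intro ω
    have h := lintegral_exp_quadratic_gaussianReal zero_lt_one (√a * X ω)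
    simp only [sub_zero, Real.sqrt_one, inv_one, one_mul, mul_one, zero_mul, zero_div,
      zero_add] at h
    rw [mul_pow, Real.sq_sqrt ha] at h
    rw [Real.exp_add, ENNReal.ofReal_mul (Real.exp_pos _).le, ← h,
      ← lintegral_const_mul _ (by fun_prop)]
    refine lintegral_congr fun g => ?_
    rw [← ENNReal.ofReal_mul (Real.exp_pos _).le, ← Real.exp_add]
    congr 2
    ring
  simp_rw [h1]
  rw [lintegral_lintegral_swap (by fun_prop)]
  have h2 : ∀ g : ℝ, ∫⁻ ω, ENNReal.ofReal (Real.exp ((b + √a * g) * X ω)) ∂μ ≤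
      ENNReal.ofReal (Real.exp (R2 * b ^ 2 / 2)) *
        ENNReal.ofReal (Real.exp (a * R2 * g ^ 2 / 2 + (R2 * b * √a) * g)) := by
    intro g
    rw [← ofReal_integral_eq_lintegral_ofReal (hX.integrable_exp_mul _)
      (Filter.Eventually.of_forall fun _ => (Real.exp_pos _).le),
      ← ENNReal.ofReal_mul (Real.exp_pos _).le, ← Real.exp_add]
    refine ENNReal.ofReal_le_ofReal ((hX.mgf_le _).trans (le_of_eq ?_))
    congr 1
    have : √a ^ 2 = a := Real.sq_sqrt ha
    linear_combination (R2 * g ^ 2 / 2 : ℝ) * this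
  refine (lintegral_mono h2).trans (le_of_eq ?_)
  rw [lintegral_const_mul _ (by fun_prop), lintegral_exp_quadratic_gaussianReal haR,
    ← ENNReal.ofReal_mul (Real.exp_pos _).le]
  congr 1
  rw [mul_left_comm, ← Real.exp_add, mul_pow, Real.sq_sqrt ha]
  congr 2
  have : 1 - a * (R2 : ℝ) ≠ 0 := (sub_pos.2 haR).ne'
  rw [div_add_div _ _ two_ne_zero (by simpa using this), div_eq_div_iff (by simpa using this)
    (by simpa using this)]
  ring

variable {d : ℕ}

/-- Expanding the squared norm leaves a linear plus a quadratic term in the scalar `X`, so the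
dimension does not enter. -/
theorem lintegral_exp_norm_add_smul_sq_le {Ω : Type*} [MeasurableSpace Ω] {μ : Measure Ω}
    [SFinite μ] {X : Ω → ℝ} {R : ℝ≥0} (hX : HasSubgaussianMGF X (R ^ 2) μ) (hXm : Measurable X)
    {r B : ℝ} {x : Vec d} (hx : ‖x‖ ≤ r) (hB : R ^ 2 * r ^ 2 < B) (S : Vec d) :
    ∫⁻ ω, ENNReal.ofReal (Real.exp (‖S + X ω • x‖ ^ 2 / (2 * B))) ∂μ ≤
      ENNReal.ofReal ((√(1 - R ^ 2 * r ^ 2 / B))⁻¹ *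
        Real.exp (‖S‖ ^ 2 / (2 * (B - R ^ 2 * r ^ 2)))) := by
  have hρ0 : 0 ≤ (R : ℝ) ^ 2 * r ^ 2 := by positivity
  have hB0 : 0 < B := hρ0.trans_lt hB
  have hx2 : ‖x‖ ^ 2 ≤ r ^ 2 := pow_le_pow_left₀ (norm_nonneg _) hx 2
  have haR : ‖x‖ ^ 2 / B * (R ^ 2 : ℝ≥0) ≤ R ^ 2 * r ^ 2 / B := by
    push_cast
    rw [div_mul_eq_mul_div, mul_comm]
    gcongr
  have hlt : (R : ℝ) ^ 2 * r ^ 2 / B < 1 := (div_lt_one hB0).2 hB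
  have h := lintegral_exp_sq_le_of_hasSubgaussianMGF hX hXm (by positivity : 0 ≤ ‖x‖ ^ 2 / B)
    (haR.trans_lt hlt) (inner ℝ S x / B)
  have hsplit : ∀ ω, ENNReal.ofReal (Real.exp (‖S + X ω • x‖ ^ 2 / (2 * B))) =
      ENNReal.ofReal (Real.exp (‖S‖ ^ 2 / (2 * B))) * ENNReal.ofReal
        (Real.exp (inner ℝ S x / B * X ω + ‖x‖ ^ 2 / B * X ω ^ 2 / 2)) := fun ω => by
    rw [← ENNReal.ofReal_mul (Real.exp_pos _).le, ← Real.exp_add, norm_add_sq_real,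
      real_inner_smul_right, norm_smul, mul_pow, Real.norm_eq_abs, sq_abs]
    congr 2
    field_simp
    ring
  simp_rw [hsplit]
  rw [lintegral_const_mul _ (by fun_prop)]
  refine (mul_le_mul_right h _).trans ?_
  rw [← ENNReal.ofReal_mul (Real.exp_pos _).le]
  refine ENNReal.ofReal_le_ofReal ?_
  rw [mul_left_comm, ← Real.exp_add]
  have hpos : 0 < 1 - (R : ℝ) ^ 2 * r ^ 2 / B := sub_pos.2 hlt
  have hin : (inner ℝ S x : ℝ) ^ 2 ≤ ‖S‖ ^ 2 * r ^ 2 := by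
    rw [← sq_abs]
    refine (pow_le_pow_left₀ (abs_nonneg _) (abs_real_inner_le_norm S x) 2).trans ?_
    rw [mul_pow]
    gcongr
  gcongr
  calc _ ≤ ‖S‖ ^ 2 / (2 * B) + R ^ 2 * (‖S‖ ^ 2 * r ^ 2 / B ^ 2) /
        (2 * (1 - R ^ 2 * r ^ 2 / B)) := by
        push_cast
        rw [div_pow]
        push_cast at haR
        gcongr
    _ = ‖S‖ ^ 2 / (2 * (B - R ^ 2 * r ^ 2)) := by
        have : B - (R : ℝ) ^ 2 * r ^ 2 ≠ 0 := (sub_pos.2 hB).ne'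
        field_simp
        ring

/-- `XᵀY - XᵀXβ`, the sum of the noise terms times the actions. -/
noncomputable def noise (β : Vec d) (q : ℕ × (Fin d → Fin d → ℝ) × (Fin d → ℝ)) : Vec d :=
  WithLp.toLp 2 (q.2.2 - Matrix.mulVec (Matrix.of q.2.1) β.ofLp)

theorem noise_stat_cons (β : Vec d) (x : Vec d) (y : ℝ) (D : List (Vec d × ℝ)) :
    noise β (stat ((x, y) :: D)) = noise β (stat D) + (y - inner ℝ β x) • x := by
  ext i
  have h1 : ((stat ((x, y) :: D)).2.2 : Fin d → ℝ) i = x i * y + crossMoment D i := by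
    simp [stat, crossMoment]
  have h2 : Matrix.mulVec (gram ((x, y) :: D)) β.ofLp i =
      inner ℝ β x * x i + Matrix.mulVec (gram D) β.ofLp i := by
    rw [gram_cons, Matrix.add_mulVec, Matrix.vecMulVec_mulVec, dotProduct_comm,
      dotProduct_ofLp_eq_inner]
    simp [mul_comm]
  change (stat ((x, y) :: D)).2.2 i - Matrix.mulVec (gram ((x, y) :: D)) β.ofLp i =
    (crossMoment D i - Matrix.mulVec (gram D) β.ofLp i) + (y - inner ℝ β x) * x i
  rw [h1, h2]
  ring

theorem measurable_noise (β : Vec d) : Measurable (noise β) := by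
  refine (PiLp.continuous_toLp 2 _).measurable.comp ?_
  refine measurable_pi_iff.2 fun i => ?_
  simp only [Matrix.mulVec, dotProduct, Pi.sub_apply, Matrix.of_apply]
  fun_prop

/-- The exponential potential of the noise. -/
noncomputable def noisePotential (β : Vec d) (ρ : ℝ)
    (q : ℕ × (Fin d → Fin d → ℝ) × (Fin d → ℝ)) : ℝ≥0∞ :=
  ENNReal.ofReal ((√(q.1 + 1))⁻¹ * Real.exp (‖noise β q‖ ^ 2 / (2 * (ρ * (q.1 + 1)))))

theorem measurable_noisePotential (β : Vec d) (ρ : ℝ) : Measurable (noisePotential β ρ) := by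
  have hn := (measurable_noise β).norm
  have h1 : Measurable fun q : ℕ × (Fin d → Fin d → ℝ) × (Fin d → ℝ) => (q.1 : ℝ) :=
    (measurable_from_top (f := fun n : ℕ => (n : ℝ))).comp measurable_fst
  unfold noisePotential
  fun_prop

section Law

variable {p : Params} {T : ℕ} {C : ℕ → Set (Vec d)} {β : Vec d} {ν : ℕ → Kernel (Vec d) ℝ} {r : ℝ}
  {R : ℝ≥0}

/-- With `k` observations and `B = ρ (k + 2)` one has `B - ρ = ρ (k + 1)` and `1 - ρ / B = (k + 1) /
(k + 2)`, so the normalizing square roots telescope. -/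
theorem IsInstance.lintegral_noisePotential_le (hI : IsInstance T C β ν r R) (hr : 0 < r)
    (hR : 0 < R) {t : ℕ} (ht : t < T) (D : List (Vec d × ℝ)) :
    ∫⁻ x, ∫⁻ y, noisePotential β (R ^ 2 * r ^ 2) (stat ((x, y) :: D)) ∂(ν t x)
        ∂(cond (volume : Measure (Vec d)) (C t)) ≤
      noisePotential β (R ^ 2 * r ^ 2) (stat D) := by
  have hp := hI.isProbabilityMeasure_cond ht
  have hν := hI.markov t ht
  have hR' : (0 : ℝ) < R := hR
  set ρ : ℝ := R ^ 2 * r ^ 2 with hρ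
  have hρ0 : 0 < ρ := by positivity
  set k : ℝ := (D.length : ℝ) with hk
  have hk0 : 0 ≤ k := Nat.cast_nonneg _
  have hpt : ∀ᵐ x ∂(cond (volume : Measure (Vec d)) (C t)),
      ∫⁻ y, noisePotential β ρ (stat ((x, y) :: D)) ∂(ν t x) ≤ noisePotential β ρ (stat D) := by
    filter_upwards [ae_cond_mem (hI.isCompact ht).measurableSet] with x hx
    have hB : (R : ℝ) ^ 2 * r ^ 2 < ρ * (k + 1 + 1) := by nlinarith
    have h := lintegral_exp_norm_add_smul_sq_le (hI.noise_subgaussian t ht x hx) (by fun_prop)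
      (hI.norm_le ht hx) hB (noise β (stat D))
    have heq : ∀ y, noisePotential β ρ (stat ((x, y) :: D)) = ENNReal.ofReal ((√(k + 1 + 1))⁻¹) *
        ENNReal.ofReal (Real.exp (‖noise β (stat D) + (y - inner ℝ β x) • x‖ ^ 2 /
          (2 * (ρ * (k + 1 + 1))))) := fun y => by
      rw [← ENNReal.ofReal_mul (by positivity), noisePotential, noise_stat_cons]
      simp [stat, hk]
    simp_rw [heq]
    rw [lintegral_const_mul _ (by fun_prop)]
    refine (mul_le_mul_right h _).trans (le_of_eq ?_)
    rw [← ENNReal.ofReal_mul (by positivity), noisePotential]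
    congr 1
    have e1 : 1 - (R : ℝ) ^ 2 * r ^ 2 / (ρ * (k + 1 + 1)) = (k + 1) / (k + 1 + 1) := by
      rw [← hρ]
      field_simp
      ring
    have e2 : ρ * (k + 1 + 1) - (R : ℝ) ^ 2 * r ^ 2 = ρ * (k + 1) := by
      rw [← hρ]
      ring
    rw [e1, e2, Real.sqrt_div (by positivity), ← mul_assoc]
    congr 1
    have : 0 < √(k + 1 + 1) := Real.sqrt_pos.2 (by positivity)
    have h3 : ((stat D).1 : ℝ) = k := rfl
    rw [h3]
    field_simp
  refine (lintegral_mono_ae hpt).trans ?_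
  simp

/-- Tail bound for the noise of the first `n` observations. -/
theorem IsInstance.historyLaw_noise_gt_le (hI : IsInstance T C β ν r R) (hd : 0 < d) (hT : 0 < T)
    (hR0 : 0 < R) (hr : 0 ≤ p.r) (hR : 0 ≤ p.R) (hlam : 0 < p.lam) (n : ℕ) (a : ℝ) :
    (historyLaw p C ν T).real {h | ((design p C T h).rtake n).length = n ∧
        a < ‖noise β (stat ((design p C T h).rtake n))‖ ^ 2} ≤
      √(n + 1) * Real.exp (-(a / (2 * (R ^ 2 * r ^ 2 * (n + 1))))) := by
  have hr0 := hI.radius_pos hd hT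
  have hprob := hI.isProbabilityMeasure_historyLaw hd hr hR hlam le_rfl (ν := ν)
  have hR0' : (0 : ℝ) < R := hR0
  set ρ : ℝ := R ^ 2 * r ^ 2 with hρ
  have hρ0 : 0 < ρ := by positivity
  have hmain := hI.lintegral_rtake_le hd hr hR hlam n (measurable_noisePotential β ρ)
    (fun t ht D _ _ => hI.lintegral_noisePotential_le hr0 hR0 ht D) le_rfl (p := p)
  have h0 : noisePotential β ρ (stat ([] : List (Vec d × ℝ))) = 1 := by
    have : noise β (stat ([] : List (Vec d × ℝ))) = 0 := by
      have hz : Matrix.of (stat ([] : List (Vec d × ℝ))).2.1 = 0 := rfl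
      rw [noise, hz, Matrix.zero_mulVec, sub_zero]
      rfl
    have hl : (stat ([] : List (Vec d × ℝ))).1 = 0 := rfl
    simp [noisePotential, this, hl]
  set b := (√(n + 1 : ℝ))⁻¹ * Real.exp (a / (2 * (ρ * (n + 1)))) with hb
  have hb0 : 0 < b := by positivity
  have hmark := mul_meas_ge_le_lintegral (μ := historyLaw p C ν T)
    ((measurable_noisePotential β ρ).comp (hI.measurable_stat_rtake_design hd p n le_rfl))
    (ENNReal.ofReal b)
  have hsub : historyLaw p C ν T {h | ((design p C T h).rtake n).length = n ∧
        a < ‖noise β (stat ((design p C T h).rtake n))‖ ^ 2} ≤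
      historyLaw p C ν T {h | ENNReal.ofReal b ≤
        (noisePotential β ρ ∘ fun h => stat ((design p C T h).rtake n)) h} := by
    refine measure_mono fun h hh => ?_
    change ENNReal.ofReal b ≤ noisePotential β ρ (stat ((design p C T h).rtake n))
    refine ENNReal.ofReal_le_ofReal ?_
    have hlen : ((stat ((design p C T h).rtake n)).1 : ℝ) = n := by exact_mod_cast hh.1
    rw [hlen, hb]
    gcongr
    exact hh.2.le
  rw [h0] at hmain
  have hfin := ENNReal.toReal_mono ENNReal.one_ne_top
    ((mul_le_mul_right hsub _).trans (hmark.trans hmain))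
  rw [ENNReal.toReal_mul, ENNReal.toReal_ofReal hb0.le, ENNReal.toReal_one] at hfin
  rw [Measure.real, ← mul_le_mul_iff_right₀ hb0]
  refine hfin.trans (le_of_eq ?_)
  have hs : 0 < √(n + 1 : ℝ) := Real.sqrt_pos.2 (by positivity)
  rw [hb, Real.exp_neg]
  have := Real.exp_pos (a / (2 * (ρ * (n + 1))))
  field_simp

end Law

end FairBandit

namespace FairBandit

variable {d : ℕ}

/-! ### Scalar estimates -/

theorem log_add_le_zero {κ : ℝ} (h0 : 0 < κ) (h1 : κ ≤ 1) :
    Real.log κ + (1 - κ) + (1 - κ) ^ 2 / 2 ≤ 0 := by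
  have hmono : MonotoneOn (fun κ : ℝ => Real.log κ + (1 - κ) + (1 - κ) ^ 2 / 2) (Set.Ioc 0 1) := by
    have hd : ∀ x ∈ Set.Ioc (0 : ℝ) 1, HasDerivAt
        (fun κ : ℝ => Real.log κ + (1 - κ) + (1 - κ) ^ 2 / 2) _ x := fun x hx =>
      ((Real.hasDerivAt_log hx.1.ne').add ((hasDerivAt_id x).const_sub 1)).add
        ((((hasDerivAt_id x).const_sub 1).pow 2).div_const 2)
    refine monotoneOn_of_hasDerivWithinAt_nonneg (convex_Ioc 0 1)
      (fun x hx => (hd x hx).continuousAt.continuousWithinAt)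
      (fun x hx => (hd x (interior_subset hx)).hasDerivWithinAt) fun x hx => ?_
    have hx' := (interior_subset hx).1
    have : x⁻¹ + -1 + 2 * (1 - x) * -1 / 2 = (1 - x) ^ 2 / x := by
      field_simp
      ring
    simp only [id, Nat.cast_ofNat, Nat.add_one_sub_one, pow_one]
    rw [this]
    positivity
  have := hmono ⟨h0, h1⟩ ⟨one_pos, le_rfl⟩ h1
  simpa using this

/-- Both sides vanish at `κ = 1`, and the derivative of their difference is the expression in
`log_add_le_zero`. -/
theorem sq_add_cube_le_entropy {κ : ℝ} (h0 : 0 < κ) (h1 : κ ≤ 1) :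
    (1 - κ) ^ 2 / 2 + (1 - κ) ^ 3 / 6 ≤ 1 - κ + κ * Real.log κ := by
  have hanti : AntitoneOn (fun κ : ℝ => 1 - κ + κ * Real.log κ -
      ((1 - κ) ^ 2 / 2 + (1 - κ) ^ 3 / 6)) (Set.Ioc 0 1) := by
    have hd : ∀ x ∈ Set.Ioc (0 : ℝ) 1, HasDerivAt (fun κ : ℝ => 1 - κ + κ * Real.log κ -
      ((1 - κ) ^ 2 / 2 + (1 - κ) ^ 3 / 6)) _ x := fun x hx =>
      ((((hasDerivAt_id x).const_sub 1).add
        ((hasDerivAt_id x).mul (Real.hasDerivAt_log hx.1.ne'))).sub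
        (((((hasDerivAt_id x).const_sub 1).pow 2).div_const 2).add
          ((((hasDerivAt_id x).const_sub 1).pow 3).div_const 6)))
    refine antitoneOn_of_hasDerivWithinAt_nonpos (convex_Ioc 0 1)
      (fun x hx => (hd x hx).continuousAt.continuousWithinAt)
      (fun x hx => (hd x (interior_subset hx)).hasDerivWithinAt) fun x hx => ?_
    have hx' := interior_subset hx
    have h2 := log_add_le_zero hx'.1 hx'.2
    have h3 : x * x⁻¹ = 1 := mul_inv_cancel₀ hx'.1.ne'
    simp only [id, Nat.cast_ofNat, Nat.add_one_sub_one, pow_one]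
    linarith
  have := hanti ⟨h0, h1⟩ ⟨one_pos, le_rfl⟩ h1
  simp only [sub_self, Real.log_one, mul_zero] at this
  norm_num at this
  linarith

/-- Giving up the factor `7/8` in the eigenvalue bound raises the coefficient from `1/2` to `5/8`.
The cubic term is needed: near `κ = 0` the quadratic one yields only about `1/2`. -/
theorem entropy_lower_bound {κ : ℝ} (h0 : 0 < κ) (h1 : κ ≤ 1) :
    5 / 8 * (1 - κ) ^ 2 ≤ 1 - 7 / 8 * κ + 7 / 8 * κ * Real.log (7 / 8 * κ) := by
  have h := sq_add_cube_le_entropy (κ := 7 / 8 * κ) (by positivity) (by linarith)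
  refine le_trans ?_ h
  -- Over the common denominator `3072` the difference of the two sides is `25` plus this
  -- expression; its quadratic factor has negative discriminant.
  have h2 : 0 ≤ (1 - κ) * (357 - 597 * (1 - κ) + 343 * (1 - κ) ^ 2) := by
    refine mul_nonneg (by linarith) ?_
    nlinarith [sq_nonneg (343 * (1 - κ) - 597 / 2)]
  nlinarith

theorem conf_pos {p : Params} (hδ : 0 < p.δ) {s : ℕ} (hs : 0 < s) : 0 < p.conf s := by
  have : (0 : ℝ) < s := by exact_mod_cast hs
  rw [Params.conf]
  positivity

theorem conf_le {p : Params} (s : ℕ) : p.conf s ≤ p.δ := min_le_left _ _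

theorem conf_le_inv {p : Params} (hc : 0 ≤ p.c) {s : ℕ} (hs : 0 < s) :
    p.conf s ≤ 1 / s := by
  have hs' : (1 : ℝ) ≤ s := by exact_mod_cast hs
  refine (min_le_right _ _).trans (one_div_le_one_div_of_le (by linarith) ?_)
  calc (s : ℝ) = (s : ℝ) ^ (1 : ℝ) := (Real.rpow_one _).symm
    _ ≤ _ := Real.rpow_le_rpow_of_exponent_le hs' (by linarith)

theorem conf_anti {p : Params} (hc : 0 ≤ p.c) {s s' : ℕ} (hs : 0 < s) (h : s ≤ s') :
    p.conf s' ≤ p.conf s := by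
  have hs' : (0 : ℝ) < s := by exact_mod_cast hs
  refine min_le_min_left _ (one_div_le_one_div_of_le (by positivity) ?_)
  exact Real.rpow_le_rpow hs'.le (by exact_mod_cast h) (by linarith)

theorem log_mul_div_conf {p : Params} (hδ : 0 < p.δ) {s : ℕ} (hs : 0 < s) :
    Real.log (2 * s / p.conf s) = Real.log 2 + Real.log s - Real.log (p.conf s) := by
  have hs' : (0 : ℝ) < s := by exact_mod_cast hs
  rw [Real.log_div (by positivity) (conf_pos hδ hs).ne', Real.log_mul two_ne_zero hs'.ne']

theorem log_dim_mul_div_conf (hd : 0 < d) {p : Params} (hδ : 0 < p.δ) {s : ℕ} (hs : 0 < s) :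
    Real.log (2 * d * s / p.conf s) = Real.log (2 * s / p.conf s) + Real.log d := by
  have hs' : (0 : ℝ) < s := by exact_mod_cast hs
  have hd' : (0 : ℝ) < d := by exact_mod_cast hd
  have := conf_pos hδ hs
  rw [← Real.log_mul (by positivity) hd'.ne']
  congr 1
  ring

theorem log_le_log_dim (hd : 0 < d) {p : Params} (hδ : 0 < p.δ) {s : ℕ} (hs : 0 < s) :
    Real.log (2 * s / p.conf s) ≤ Real.log (2 * d * s / p.conf s) := by
  rw [log_dim_mul_div_conf hd hδ hs]
  have : 0 ≤ Real.log d := Real.log_natCast_nonneg d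
  linarith

theorem log_conf_le {p : Params} (hδ : 0 < p.δ) (hc : 0 ≤ p.c) {s : ℕ} (hs : 0 < s) :
    Real.log (p.conf s) ≤ -Real.log s := by
  have := Real.log_le_log (conf_pos hδ hs) (conf_le_inv hc hs)
  rwa [one_div, Real.log_inv] at this

theorem log_two_mul_le {p : Params} (hδ : 0 < p.δ) (hc : 0 ≤ p.c) {s : ℕ} (hs : 0 < s) :
    Real.log 2 + 2 * Real.log s ≤ Real.log (2 * s / p.conf s) := by
  rw [log_mul_div_conf hδ hs]
  linarith [log_conf_le hδ hc hs]

theorem log_mul_div_conf_pos {p : Params} (hδ : 0 < p.δ) (hc : 0 ≤ p.c) {s : ℕ} (hs : 0 < s) :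
    0 < Real.log (2 * s / p.conf s) := by
  have := log_two_mul_le hδ hc hs
  have h1 : 0 ≤ Real.log s := Real.log_natCast_nonneg s
  have h2 := Real.log_pos one_lt_two
  linarith

theorem exp_neg_log_eq {s : ℕ} (hs : 0 < s) :
    Real.exp (-(3 / 2 * Real.log s)) = (s * √s)⁻¹ := by
  have hs' : (0 : ℝ) < s := by exact_mod_cast hs
  have h1 : Real.exp (Real.log s / 2) = √s := by rw [Real.exp_half, Real.exp_log hs']
  rw [Real.exp_neg, show 3 / 2 * Real.log s = Real.log s + Real.log s / 2 by ring, Real.exp_add,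
    Real.exp_log hs', h1]

/-- By `δ_s ≤ 1/s` the surplus powers `1/4` and `1/2` of `δ_s` become powers of `s`. In the second
term `√(n + 1) ≤ √s`, and the factor `e` is absorbed by `2^(3/2)`, since `1 < (3/2) log 2`. -/
theorem failure_sum_le (hd : 0 < d) {p : Params} (hδ : 0 < p.δ) (hc : 0 ≤ p.c) {s n : ℕ}
    (hn : n + 1 ≤ s) :
    d * Real.exp (-(5 / 4 * Real.log (2 * d * s / p.conf s))) +
      √(n + 1) * Real.exp (1 - 3 / 2 * Real.log (2 * s / p.conf s)) ≤
      3 / 2 * p.conf s * (s * √s)⁻¹ := by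
  have hs : 0 < s := by omega
  have hs' : (0 : ℝ) < s := by exact_mod_cast hs
  have hd' : (0 : ℝ) < d := by exact_mod_cast hd
  have hu := conf_pos hδ hs
  have hul := log_conf_le hδ hc hs
  have hld : 0 ≤ Real.log d := Real.log_natCast_nonneg d
  have hl2 := Real.log_two_gt_d9
  have hmul : p.conf s * (s * √s)⁻¹ = Real.exp (Real.log (p.conf s) + -(3 / 2 * Real.log s)) := by
    rw [Real.exp_add, Real.exp_log hu, exp_neg_log_eq hs]
  have h1 : d * Real.exp (-(5 / 4 * Real.log (2 * d * s / p.conf s))) ≤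
      1 / 2 * (p.conf s * (s * √s)⁻¹) := by
    have e1 : (1 : ℝ) / 2 = Real.exp (-Real.log 2) := by
      rw [Real.exp_neg, Real.exp_log two_pos, one_div]
    conv_lhs => enter [1]; rw [← Real.exp_log hd']
    rw [hmul, e1, ← Real.exp_add, ← Real.exp_add, Real.exp_le_exp,
      log_dim_mul_div_conf hd hδ hs, log_mul_div_conf hδ hs]
    linarith
  have h2 : √(n + 1) * Real.exp (1 - 3 / 2 * Real.log (2 * s / p.conf s)) ≤
      p.conf s * (s * √s)⁻¹ := by
    have e2 : √(n + 1 : ℝ) ≤ Real.exp (Real.log s / 2) := by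
      rw [Real.exp_half, Real.exp_log hs']
      exact Real.sqrt_le_sqrt (by exact_mod_cast hn)
    refine (mul_le_mul_of_nonneg_right e2 (Real.exp_pos _).le).trans ?_
    rw [hmul, ← Real.exp_add, Real.exp_le_exp, log_mul_div_conf hδ hs]
    linarith
  linarith

theorem inv_mul_sqrt_le {s : ℕ} (hs : 2 ≤ s) :
    ((s : ℝ) * √s)⁻¹ ≤ 2 * ((√(s - 1 : ℕ))⁻¹ - (√s)⁻¹) := by
  have h1 : (0 : ℝ) < (s - 1 : ℕ) := by exact_mod_cast (by omega : 0 < s - 1)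
  have h2 : ((s - 1 : ℕ) : ℝ) = s - 1 := by
    rw [Nat.cast_sub (by omega)]
    simp
  have hs' : (0 : ℝ) < s := by linarith
  set a := √((s - 1 : ℕ) : ℝ) with ha
  set b := √(s : ℝ) with hb
  have ha0 : 0 < a := Real.sqrt_pos.2 h1
  have hb0 : 0 < b := Real.sqrt_pos.2 hs'
  have hab : a ≤ b := Real.sqrt_le_sqrt (by linarith)
  have ha2 : a ^ 2 = s - 1 := by rw [ha, Real.sq_sqrt h1.le, h2]
  have hb2 : b ^ 2 = s := by rw [hb, Real.sq_sqrt hs'.le]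
  rw [inv_sub_inv ha0.ne' hb0.ne', ← hb2, ← mul_div_assoc, inv_eq_one_div,
    div_le_div_iff₀ (by positivity) (by positivity)]
  have h3 : (b - a) * (b + a) = 1 := by linear_combination hb2 - ha2
  have h4 : a * (b + a) ≤ 2 * b ^ 2 := by nlinarith
  calc 1 * (a * b) = b * (a * (b + a)) * (b - a) := by
        linear_combination (-(a * b)) * h3
    _ ≤ b * (2 * b ^ 2) * (b - a) := by
        have : 0 ≤ b - a := sub_nonneg.2 hab
        gcongr
    _ = _ := by ring

theorem sum_inv_mul_sqrt_le (m : ℕ) (hm : 0 < m) (N : ℕ) :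
    ∑ s ∈ Finset.Ico (m + 1) N, ((s : ℝ) * √s)⁻¹ ≤ 2 * (√m)⁻¹ := by
  rcases Nat.lt_or_ge N (m + 1) with h | h
  · rw [Finset.Ico_eq_empty (by omega), Finset.sum_empty]
    positivity
  · have key : ∀ k, ∑ s ∈ Finset.Ico (m + 1) (m + 1 + k), ((s : ℝ) * √s)⁻¹ ≤
        2 * ((√m)⁻¹ - (√(m + k : ℕ))⁻¹) := by
      intro k
      induction k with
      | zero => simp
      | succ k ih =>
        rw [← add_assoc, Finset.sum_Ico_succ_top (by omega)]
        have h1 := inv_mul_sqrt_le (s := m + 1 + k) (by omega)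
        rw [show m + 1 + k - 1 = m + k by omega] at h1
        rw [show m + (k + 1) = m + 1 + k by omega]
        linarith
    obtain ⟨k, rfl⟩ := Nat.exists_eq_add_of_le h
    refine (key k).trans ?_
    have : 0 ≤ (√(m + k : ℕ))⁻¹ := by positivity
    linarith

end FairBandit

namespace FairBandit

variable {d : ℕ}

/-! ### The confidence event -/

/-- Number of observations needed before the estimator is used in round `s`. -/
noncomputable def threshold (p : Params) (d s : ℕ) : ℝ :=
  2 * p.r ^ 2 * Real.log (2 * d * s / p.conf s) / p.lam

open Matrix in
/-- The data `D` have a well conditioned design matrix and small noise at the confidence level of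
round `s`. -/
def Reliable (p : Params) (β : Vec d) (s : ℕ) (D : List (Vec d × ℝ)) : Prop :=
  (∀ v : Fin d → ℝ, v ⬝ᵥ v = 1 →
    7 / 8 * kappa d p.r p.lam (p.conf s) D.length s * D.length * p.lam ≤ v ⬝ᵥ (gram D *ᵥ v)) ∧
  ‖noise β (stat D)‖ ^ 2 ≤
    49 / 16 * (p.r ^ 2 * p.R ^ 2 * D.length * Real.log (2 * s / p.conf s))

/-- A later level has larger logarithms, hence a smaller `κ` and a larger noise allowance. This lets
the union bound use a single level for each `n`. -/
theorem Reliable.mono {p : Params} (hd : 0 < d) (hδ : 0 < p.δ) (hc : 0 ≤ p.c) (hr : 0 ≤ p.r)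
    (hlam : 0 < p.lam) {β : Vec d} {s s' : ℕ} (hs : 0 < s) (hss' : s ≤ s')
    {D : List (Vec d × ℝ)} (h : Reliable p β s D) : Reliable p β s' D := by
  have hcs := conf_anti hc hs hss'
  have hu := conf_pos hδ (hs.trans_le hss')
  have hs0 : (0 : ℝ) < s := by exact_mod_cast hs
  have hd0 : (0 : ℝ) < d := by exact_mod_cast hd
  have hss : (s : ℝ) ≤ s' := by exact_mod_cast hss'
  have hu' := conf_pos hδ hs
  refine ⟨fun v hv => le_trans ?_ (h.1 v hv), h.2.trans ?_⟩
  · unfold kappa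
    gcongr
  · gcongr

section Law

variable {T : ℕ} {C : ℕ → Set (Vec d)} {β : Vec d} {ν : ℕ → Kernel (Vec d) ℝ} {r : ℝ}
  {R : ℝ≥0}

theorem IsInstance.two_mul_log_lt (hI : IsInstance T C β ν r R) (hd : 0 < d) (hT : 0 < T)
    {p : Params} (hpr : p.r = r) (hpl : p.lam = lambdaMin T C) (hδ : 0 < p.δ) (hc : 0 ≤ p.c)
    {s : ℕ} {x : ℝ} (hs : 0 < s) (hn : threshold p d s < x) :
    2 * Real.log (2 * s / p.conf s) < x := by
  refine lt_of_le_of_lt ?_ hn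
  have hlam := hI.lambdaMin_pos hd hT
  have h1 := hI.lambdaMin_le hd hT
  have h2 := log_le_log_dim hd hδ hs
  have h3 := log_mul_div_conf_pos hδ hc hs
  rw [threshold, hpr, hpl, le_div_iff₀ hlam]
  nlinarith

/-- With `E`, `L` the logarithms with and without `d`: `(1 - κ)² = 2r²E/(nλ)` makes the eigenvalue
exponent `(5/4) E`, and `2L < n` gives `(49/32) L n/(n + 1) ≥ (3/2) L - 1` for the noise. -/
theorem IsInstance.historyLaw_not_reliable_le (hI : IsInstance T C β ν r R) (hd : 0 < d)
    (hT : 0 < T) (hR : 0 < R) {p : Params} (hpr : p.r = r) (hpR : p.R = R)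
    (hpl : p.lam = lambdaMin T C) (hδ : 0 < p.δ) (hc : 0 ≤ p.c) {n s : ℕ} (hns : n + 1 ≤ s)
    (hn : threshold p d s < n) :
    (historyLaw p C ν T).real {h | ((design p C T h).rtake n).length = n ∧
      ¬ Reliable p β s ((design p C T h).rtake n)} ≤ 3 / 2 * p.conf s * (s * √s)⁻¹ := by
  have hs : 0 < s := by omega
  have hr := hI.radius_pos hd hT
  have hlam := hI.lambdaMin_pos hd hT
  have hpr0 : 0 ≤ p.r := by rw [hpr]; exact hr.le
  have hpR0 : 0 ≤ p.R := by rw [hpR]; exact R.2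
  have hpl0 : 0 < p.lam := by rw [hpl]; exact hlam
  have hprob := hI.isProbabilityMeasure_historyLaw hd hpr0 hpR0 hpl0 le_rfl (ν := ν)
  have hR' : (0 : ℝ) < R := hR
  set L := Real.log (2 * s / p.conf s) with hL
  set E := Real.log (2 * d * s / p.conf s) with hE
  have hL0 : 0 < L := log_mul_div_conf_pos hδ hc hs
  have hLE : L ≤ E := log_le_log_dim hd hδ hs
  have h2L := hI.two_mul_log_lt hd hT hpr hpl hδ hc hs hn
  have hn0 : (0 : ℝ) < n := by linarith
  have hn0' : 0 < n := by exact_mod_cast hn0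
  set κ := kappa d p.r p.lam (p.conf s) n s with hκ
  have hκ0 : 0 < κ := kappa_pos hpr0 hpl0 hn hn0'
  have hκ1 : 1 - κ = r * √(2 * E / (n * lambdaMin T C)) := by
    rw [hκ, kappa, hpr, hpl]
    ring
  have hκ1' : κ ≤ 1 := by
    have : 0 ≤ 1 - κ := by rw [hκ1]; positivity
    linarith
  have hκsq : (1 - κ) ^ 2 = r ^ 2 * (2 * E / (n * lambdaMin T C)) := by
    rw [hκ1, mul_pow, Real.sq_sqrt]
    have : 0 ≤ E := by linarith
    positivity
  have hgram := hI.historyLaw_gram_lt_le hd hT hpr0 hpR0 hpl0 (κ := 7 / 8 * κ) (by positivity)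
    (by linarith) n (p := p)
  have hnoise := hI.historyLaw_noise_gt_le hd hT hR hpr0 hpR0 hpl0 n
    (49 / 16 * (p.r ^ 2 * p.R ^ 2 * n * L)) (p := p)
  refine le_trans ?_ (failure_sum_le hd hδ hc hns)
  refine le_trans (measureReal_mono ?_ (measure_ne_top _ _)) ((measureReal_union_le _ _).trans
    (add_le_add (hgram.trans ?_) (hnoise.trans ?_)))
  · rintro h ⟨hlen, hrel⟩
    rw [Reliable, not_and_or, hlen] at hrel
    rcases hrel with hrel | hrel
    · push Not at hrel
      obtain ⟨v, hv, hlt⟩ := hrel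
      refine Or.inl ⟨hlen, v, hv, ?_⟩
      rw [hpl] at hlt
      rwa [hκ, hpl]
    · exact Or.inr ⟨hlen, not_le.1 hrel⟩
  · refine mul_le_mul_of_nonneg_left (Real.exp_le_exp.2 (neg_le_neg ?_)) (Nat.cast_nonneg d)
    have h1 := entropy_lower_bound hκ0 hκ1'
    rw [hκsq] at h1
    calc 5 / 4 * E = n * lambdaMin T C / r ^ 2 *
          (5 / 8 * (r ^ 2 * (2 * E / (n * lambdaMin T C)))) := by
          field_simp
          ring
      _ ≤ _ := by gcongr
  · gcongr
    rw [hpr, hpR]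
    have e1 : 49 / 16 * (r ^ 2 * (R : ℝ) ^ 2 * n * L) / (2 * ((R : ℝ) ^ 2 * r ^ 2 * (n + 1))) =
        49 / 32 * (L - L / (n + 1)) := by
      field_simp
      ring
    rw [e1]
    have e2 : L / (n + 1) ≤ 1 / 2 := by
      rw [div_le_iff₀ (by positivity)]
      linarith
    linarith

/-- Usable data satisfy `s - 1 ≥ n > 2 log 2 + 4 log s`, which fails for `s ≤ 9`. Starting at `10`
makes the failure sum at most `(3/2) · 2/√9 = 1`. -/
theorem IsInstance.ten_le_of_threshold_lt (hI : IsInstance T C β ν r R) (hd : 0 < d) (hT : 0 < T)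
    {p : Params} (hpr : p.r = r) (hpl : p.lam = lambdaMin T C) (hδ : 0 < p.δ) (hc : 0 ≤ p.c)
    {n s : ℕ} (hns : n + 1 ≤ s) (hn : threshold p d s < n) : 10 ≤ s := by
  have hs : 0 < s := by omega
  have h1 := hI.two_mul_log_lt hd hT hpr hpl hδ hc hs hn
  have h2 := log_two_mul_le hδ hc hs
  have h3 : (n : ℝ) + 1 ≤ s := by exact_mod_cast hns
  have hl2 := Real.log_two_gt_d9
  by_contra! hlt
  have h4 : ∀ k : ℕ, 2 ^ k ≤ s → k * Real.log 2 ≤ Real.log s := fun k hk => by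
    rw [← Real.log_pow]
    exact Real.log_le_log (by positivity) (by exact_mod_cast hk)
  have h5 : (2 ≤ s → Real.log 2 ≤ Real.log s) ∧ (4 ≤ s → 2 * Real.log 2 ≤ Real.log s) ∧
      (8 ≤ s → 3 * Real.log 2 ≤ Real.log s) :=
    ⟨fun h => by simpa using h4 1 (by omega), fun h => by simpa using h4 2 (by omega),
      fun h => by simpa using h4 3 (by omega)⟩
  have h6 : 0 ≤ Real.log s := Real.log_natCast_nonneg s
  rcases Nat.lt_or_ge s 2 with h | h
  · have : (s : ℝ) ≤ 1 := by exact_mod_cast (by omega : s ≤ 1)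
    linarith
  rcases Nat.lt_or_ge s 6 with h' | h'
  · have : (s : ℝ) ≤ 5 := by exact_mod_cast (by omega : s ≤ 5)
    linarith [h5.1 h]
  rcases Nat.lt_or_ge s 8 with h'' | h''
  · have : (s : ℝ) ≤ 7 := by exact_mod_cast (by omega : s ≤ 7)
    linarith [h5.2.1 (by omega)]
  · have : (s : ℝ) ≤ 9 := by exact_mod_cast (by omega : s ≤ 9)
    linarith [h5.2.2 h'']

/-- The first `n` observations are available and not reliable at the level of round `s`. -/
def unreliableSet (p : Params) (T : ℕ) (C : ℕ → Set (Vec d)) (β : Vec d) (n s : ℕ) :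
    Set (Fin T → Vec d × ℝ) :=
  {h | threshold p d s < n ∧ ((design p C T h).rtake n).length = n ∧
    ¬ Reliable p β s ((design p C T h).rtake n)}

theorem IsInstance.historyLaw_unreliableSet_le (hI : IsInstance T C β ν r R) (hd : 0 < d)
    (hT : 0 < T) (hR : 0 < R) {p : Params} (hpr : p.r = r) (hpR : p.R = R)
    (hpl : p.lam = lambdaMin T C) (hδ : 0 < p.δ) (hc : 0 ≤ p.c) {n s : ℕ} (hns : n + 1 ≤ s) :
    (historyLaw p C ν T).real (unreliableSet p T C β n s) ≤
      if 10 ≤ s then 3 / 2 * p.conf s * (s * √s)⁻¹ else 0 := by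
  by_cases hn : threshold p d s < n
  · rw [if_pos (hI.ten_le_of_threshold_lt hd hT hpr hpl hδ hc hns hn)]
    simpa only [unreliableSet, hn, true_and] using
      hI.historyLaw_not_reliable_le hd hT hR hpr hpR hpl hδ hc hns hn
  · have : unreliableSet p T C β n s = ∅ := by
      simp only [unreliableSet, hn, false_and]
      rfl
    rw [this, measureReal_empty]
    split_ifs
    · have := conf_pos (p := p) hδ (by omega : 0 < s)
      positivity
    · rfl

/-- With probability at least `1 - δ` all data are reliable from the first round on in which they
can be used. -/
theorem IsInstance.historyLaw_iUnion_unreliableSet_le (hI : IsInstance T C β ν r R) (hd : 0 < d)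
    (hT : 0 < T) (hR : 0 < R) {p : Params} (hpr : p.r = r) (hpR : p.R = R)
    (hpl : p.lam = lambdaMin T C) (hδ : 0 < p.δ) (hc : 0 ≤ p.c) :
    (historyLaw p C ν T).real (⋃ n ∈ Finset.range T, unreliableSet p T C β n (n + 1)) ≤ p.δ := by
  refine (measureReal_biUnion_finset_le _ _).trans ?_
  calc ∑ n ∈ Finset.range T, (historyLaw p C ν T).real (unreliableSet p T C β n (n + 1))
      ≤ ∑ n ∈ Finset.range T, if 10 ≤ n + 1 then
          3 / 2 * p.δ * (((n + 1 : ℕ) : ℝ) * √(n + 1 : ℕ))⁻¹ else 0 := by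
        refine Finset.sum_le_sum fun n _ => (hI.historyLaw_unreliableSet_le hd hT hR hpr hpR hpl hδ
          hc le_rfl).trans ?_
        split_ifs
        · have := conf_le (p := p) (n + 1)
          gcongr
        · exact le_rfl
    _ = ∑ s ∈ Finset.Ico 1 (T + 1), if 10 ≤ s then 3 / 2 * p.δ * ((s : ℝ) * √s)⁻¹ else 0 := by
        rw [Finset.sum_Ico_eq_sum_range]
        refine Finset.sum_congr rfl fun n _ => ?_
        rw [add_comm 1 n]
    _ = ∑ s ∈ Finset.Ico (9 + 1) (T + 1), 3 / 2 * p.δ * ((s : ℝ) * √s)⁻¹ := by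
        rw [← Finset.sum_filter]
        refine Finset.sum_congr ?_ fun _ _ => rfl
        ext s
        simp only [Finset.mem_filter, Finset.mem_Ico]
        omega
    _ ≤ 3 / 2 * p.δ * (2 * (√(9 : ℕ))⁻¹) := by
        rw [← Finset.mul_sum]
        have := sum_inv_mul_sqrt_le 9 (by norm_num) (T + 1)
        gcongr
    _ = p.δ := by
        have : √((9 : ℕ) : ℝ) = 3 := by
          rw [show ((9 : ℕ) : ℝ) = 3 ^ 2 by norm_num, Real.sqrt_sq (by norm_num)]
        rw [this]
        ring

/-- This bounds the expected number of misled rounds. Round `s` has `s` possible sample sizes, a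
factor paid for by `δ_s ≤ 1/s`. -/
theorem IsInstance.sum_historyLaw_unreliableSet_le (hI : IsInstance T C β ν r R) (hd : 0 < d)
    (hT : 0 < T) (hR : 0 < R) {p : Params} (hpr : p.r = r) (hpR : p.R = R)
    (hpl : p.lam = lambdaMin T C) (hδ : 0 < p.δ) (hc : 0 ≤ p.c) :
    ∑ t ∈ Finset.range T, ∑ n ∈ Finset.range (t + 1),
      (historyLaw p C ν T).real (unreliableSet p T C β n (t + 1)) ≤ 1 := by
  calc ∑ t ∈ Finset.range T, ∑ n ∈ Finset.range (t + 1),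
      (historyLaw p C ν T).real (unreliableSet p T C β n (t + 1))
      ≤ ∑ t ∈ Finset.range T, if 10 ≤ t + 1 then
          3 / 2 * (((t + 1 : ℕ) : ℝ) * √(t + 1 : ℕ))⁻¹ else 0 := by
        refine Finset.sum_le_sum fun t _ => (Finset.sum_le_card_nsmul _ _ _ fun n hn =>
          hI.historyLaw_unreliableSet_le hd hT hR hpr hpR hpl hδ hc
            (Finset.mem_range.1 hn)).trans ?_
        rw [Finset.card_range, nsmul_eq_mul]
        split_ifs
        · have h1 := conf_le_inv (p := p) hc (Nat.succ_pos t)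
          have h0 : (0 : ℝ) < (t + 1 : ℕ) := by positivity
          calc ((t + 1 : ℕ) : ℝ) * (3 / 2 * p.conf (t + 1) * (((t + 1 : ℕ) : ℝ) * √(t + 1 : ℕ))⁻¹)
              ≤ ((t + 1 : ℕ) : ℝ) *
                (3 / 2 * (1 / (t + 1 : ℕ)) * (((t + 1 : ℕ) : ℝ) * √(t + 1 : ℕ))⁻¹) := by
                gcongr
            _ = _ := by
                field_simp
        · simp
    _ = ∑ s ∈ Finset.Ico 1 (T + 1), if 10 ≤ s then 3 / 2 * ((s : ℝ) * √s)⁻¹ else 0 := by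
        rw [Finset.sum_Ico_eq_sum_range]
        refine Finset.sum_congr rfl fun n _ => ?_
        rw [add_comm 1 n]
    _ = ∑ s ∈ Finset.Ico (9 + 1) (T + 1), 3 / 2 * ((s : ℝ) * √s)⁻¹ := by
        rw [← Finset.sum_filter]
        refine Finset.sum_congr ?_ fun _ _ => rfl
        ext s
        simp only [Finset.mem_filter, Finset.mem_Ico]
        omega
    _ ≤ 3 / 2 * (2 * (√(9 : ℕ))⁻¹) := by
        rw [← Finset.mul_sum]
        have := sum_inv_mul_sqrt_le 9 (by norm_num) (T + 1)
        gcongr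
    _ = 1 := by
        have : √((9 : ℕ) : ℝ) = 3 := by
          rw [show ((9 : ℕ) : ℝ) = 3 ^ 2 by norm_num, Real.sqrt_sq (by norm_num)]
        rw [this]
        ring

end Law

end FairBandit

namespace FairBandit

variable {d : ℕ}

/-! ### Consequences of reliable data -/

open Matrix in
-- Pair the equation with `u`: `μ ‖u‖² ≤ ⟨u, S⟩ ≤ ‖u‖ ‖S‖`.
theorem norm_le_of_gram_mulVec_eq {A : Matrix (Fin d) (Fin d) ℝ} {μ : ℝ} (hμ : 0 < μ)
    (hA : ∀ v : Fin d → ℝ, v ⬝ᵥ v = 1 → μ ≤ v ⬝ᵥ (A *ᵥ v)) {u S : Vec d}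
    (h : A *ᵥ u.ofLp = S.ofLp) : ‖u‖ ≤ ‖S‖ / μ := by
  rcases eq_or_ne u 0 with rfl | hu
  · simp only [norm_zero]
    positivity
  have hu0 : 0 < ‖u‖ := norm_pos_iff.2 hu
  have h1 : μ * ‖u‖ ^ 2 ≤ u.ofLp ⬝ᵥ (A *ᵥ u.ofLp) := by
    have h2 := hA (‖u‖⁻¹ • u.ofLp) (by
      rw [smul_dotProduct, dotProduct_smul, dotProduct_ofLp_self, smul_eq_mul, smul_eq_mul]
      field_simp)
    rw [mulVec_smul, smul_dotProduct, dotProduct_smul, smul_eq_mul, smul_eq_mul, ← mul_assoc,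
      ← mul_inv, ← pow_two, inv_mul_eq_div, le_div_iff₀ (by positivity)] at h2
    exact h2
  rw [h, dotProduct_ofLp_eq_inner] at h1
  have h3 := h1.trans (real_inner_le_norm u S)
  rw [le_div_iff₀ hμ]
  nlinarith

open Matrix in
theorem isUnit_det_of_le {A : Matrix (Fin d) (Fin d) ℝ} {μ : ℝ} (hμ : 0 < μ)
    (hA : ∀ v : Fin d → ℝ, v ⬝ᵥ v = 1 → μ ≤ v ⬝ᵥ (A *ᵥ v)) : IsUnit A.det := by
  by_contra h
  rw [isUnit_iff_ne_zero, not_not] at h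
  obtain ⟨v, hv, hAv⟩ := exists_mulVec_eq_zero_iff.2 h
  have := norm_le_of_gram_mulVec_eq hμ hA (u := WithLp.toLp 2 v) (S := 0) hAv
  rw [norm_zero, zero_div, norm_le_zero_iff] at this
  exact hv (congrArg WithLp.ofLp this)

open Matrix in
theorem gram_mulVec_leastSquares_sub {β : Vec d} {D : List (Vec d × ℝ)}
    (h : IsUnit (gram D).det) :
    gram D *ᵥ (leastSquares D - β).ofLp = (noise β (stat D)).ofLp := by
  change gram D *ᵥ ((gram D)⁻¹ *ᵥ crossMoment D - β.ofLp) = crossMoment D - gram D *ᵥ β.ofLp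
  rw [mulVec_sub, mulVec_mulVec, mul_nonsing_inv _ h, one_mulVec]

/-- The constants are tuned to the width: noise factor `√(49/16) = 7/4` over eigenvalue factor `7/8`
is its leading `2`. -/
theorem Reliable.abs_inner_sub_le {p : Params} (hr : 0 ≤ p.r) (hR : 0 ≤ p.R) (hlam : 0 < p.lam)
    {β : Vec d} {s : ℕ} {D : List (Vec d × ℝ)} (h : Reliable p β s D)
    (hlog : 0 ≤ Real.log (2 * s / p.conf s))
    (hn : threshold p d s < D.length) (hn0 : 0 < D.length) {x : Vec d} (hx : ‖x‖ ≤ p.r) :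
    |(inner ℝ (leastSquares D) x : ℝ) - inner ℝ β x| ≤ p.width d D.length s := by
  have hκ := kappa_pos hr hlam hn hn0
  set κ := kappa d p.r p.lam (p.conf s) D.length s with hκdef
  set n : ℝ := (D.length : ℝ) with hndef
  have hn' : 0 < n := by rw [hndef]; exact_mod_cast hn0
  set L := Real.log (2 * s / p.conf s) with hL
  have hμ : 0 < 7 / 8 * κ * n * p.lam := by positivity
  have h1 := norm_le_of_gram_mulVec_eq hμ h.1
    (gram_mulVec_leastSquares_sub (β := β) (isUnit_det_of_le hμ h.1))
  have h2 : ‖noise β (stat D)‖ ≤ 7 / 4 * (p.r * p.R * √n * √L) := by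
    refine abs_le_of_sq_le_sq' ?_ (by positivity) |>.2
    refine h.2.trans (le_of_eq ?_)
    rw [mul_pow, mul_pow, mul_pow, mul_pow, Real.sq_sqrt hn'.le, Real.sq_sqrt hlog]
    ring
  rw [← inner_sub_left]
  calc |(inner ℝ (leastSquares D - β) x : ℝ)| ≤ ‖leastSquares D - β‖ * ‖x‖ :=
        abs_real_inner_le_norm _ _
    _ ≤ (7 / 4 * (p.r * p.R * √n * √L)) / (7 / 8 * κ * n * p.lam) * p.r := by
        refine mul_le_mul (h1.trans ?_) hx (norm_nonneg _) (by positivity)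
        gcongr
    _ = p.width d D.length s := by
        rw [Params.width, ← hκdef, ← hndef, ← hL]
        have hs : 0 < √n := Real.sqrt_pos.2 hn'
        have hs2 : √n * √n = n := Real.mul_self_sqrt hn'.le
        generalize √n = q at hs hs2 ⊢
        rw [← hs2]
        field_simp
        ring

/-- An empirical lead above `2w` survives an error of `w` at each of two extreme points; the face
argument extends strictness to all of `C`. -/
theorem inner_lt_topExtreme_of_not_explores {C : Set (Vec d)} (hC : IsCompact C)
    (hnt : C.Nontrivial) {p : Params} (hr : 0 ≤ p.r) (hR : 0 ≤ p.R) (hlam : 0 < p.lam)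
    {β : Vec d} {s : ℕ} {D : List (Vec d × ℝ)} (hex : ¬ Explores p C s D)
    (herr : ∀ x ∈ C, |(inner ℝ (leastSquares D) x : ℝ) - inner ℝ β x| ≤ p.width d D.length s)
    {z : Vec d} (hz : z ∈ C) (hne : z ≠ topExtreme C (leastSquares D)) :
    inner ℝ β z < inner ℝ β (topExtreme C (leastSquares D)) := by
  obtain ⟨-, -, hgap⟩ := lt_topGap_of_not_explores hC hnt hr hR hlam hex
  have htop := topExtreme_mem hC hnt.nonempty (leastSquares D)
  refine inner_lt_of_forall_extremePoint_lt hC (fun y hy hyne => ?_) htop hz hne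
  have h1 := inner_le_runnerUp hC hy hyne
  have h2 := abs_le.1 (herr y (extremePoints_subset hy))
  have h3 := abs_le.1 (herr _ htop)
  have h4 : topGap C (leastSquares D) = inner ℝ (leastSquares D) (topExtreme C (leastSquares D)) -
    runnerUp C (leastSquares D) := rfl
  linarith [h2.1, h2.2, h3.1, h3.2]

/-- A true gap above `4w` would leave an empirical gap above `2w`, and the intervals would be
disjoint. -/
theorem gap_le_width_of_explores {C : Set (Vec d)} (hC : IsCompact C)
    (hnt : C.Nontrivial) {p : Params} {β : Vec d} {s : ℕ} {D : List (Vec d × ℝ)}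
    (hex : Explores p C s D) (hn : threshold p d s < D.length)
    (herr : ∀ x ∈ C, |(inner ℝ (leastSquares D) x : ℝ) - inner ℝ β x| ≤ p.width d D.length s) :
    gap C β ≤ 4 * p.width d D.length s := by
  rw [explores_iff hC hnt] at hex
  obtain ⟨hw, hgap⟩ := hex.resolve_left (not_le.2 hn)
  by_contra! hlt
  have htop := topExtreme_mem hC hnt.nonempty β
  have := (le_topGap hC hnt (b := leastSquares D) htop
    (g := gap C β - 2 * p.width d D.length s) (by linarith) fun z hz hne => ?_).2
  · linarith
  · have h1 := gap_le_inner hC hz hne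
    have h2 := abs_le.1 (herr z (extremePoints_subset hz))
    have h3 := abs_le.1 (herr _ htop)
    linarith [h2.1, h2.2, h3.1, h3.2]

/-! ### Round-fairness -/

theorem roundFair_of_single {C : Set (Vec d)} {β : Vec d} {π : Measure (Vec d)}
    [IsProbabilityMeasure π] (hC : π Cᶜ = 0) (h : DiscreteFair C β π ∨ ContinuousFair C β π) :
    RoundFair C β π :=
  ⟨1, fun _ => 1, fun _ => π, by simp, fun _ => ⟨inferInstance, hC, h⟩, by simp⟩

theorem roundFair_cond {C : Set (Vec d)} (hC : IsCompact C) (hvol : 0 < volume C) (β : Vec d) :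
    RoundFair C β (cond volume C) := by
  have := isProbabilityMeasure_cond hC hvol
  refine roundFair_of_single (ae_iff.1 (ae_cond_mem hC.measurableSet)) (Or.inr ?_)
  refine ⟨C.indicator fun _ => (volume C)⁻¹, measurable_const.indicator hC.measurableSet, ?_, ?_⟩
  · rw [withDensity_indicator hC.measurableSet, withDensity_const]
    rfl
  · intro x hx x' hx' _
    rw [Set.indicator_of_mem hx, Set.indicator_of_mem hx']

/-- Uniqueness of the maximizer matters: a tied point would have to carry the same mass. -/
theorem roundFair_dirac {C : Set (Vec d)} (hC : MeasurableSet C) {β x : Vec d} (hx : x ∈ C)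
    (h : ∀ z ∈ C, z ≠ x → inner ℝ β z < inner ℝ β x) : RoundFair C β (Measure.dirac x) := by
  refine roundFair_of_single (by simp [Measure.dirac_apply' x hC.compl, hx]) (Or.inl ⟨⟨{x},
    Set.countable_singleton x, by simp [Measure.dirac_apply' x]⟩, ?_⟩)
  intro z hz z' hz' hle
  by_cases hzx : z' = x
  · subst hzx
    have : z = z' := by
      by_contra hne
      exact absurd (h z hz hne) (not_lt.2 hle)
    rw [this]
  · have : Measure.dirac x {z'} = 0 := by
      rw [Measure.dirac_apply' x (measurableSet_singleton z')]
      exact Set.indicator_of_notMem (fun hm => hzx hm.symm) _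
    rw [this]
    exact zero_le

end FairBandit

namespace FairBandit

variable {d : ℕ}

/-! ### Data recorded before a round -/

/-- The observations recorded before the round with index `t` of a history of `T` rounds. -/
noncomputable def dataBefore (p : Params) (C : ℕ → Set (Vec d)) {T : ℕ} (h : Fin T → Vec d × ℝ)
    (t : Fin T) : List (Vec d × ℝ) :=
  design p C t fun i : Fin t => h (Fin.castLE t.isLt.le i)

/-- The data before the round with index `t` are numerous enough to be used, but unreliable. -/
def Misled (p : Params) (C : ℕ → Set (Vec d)) (β : Vec d) {T : ℕ} (h : Fin T → Vec d × ℝ)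
    (t : Fin T) : Prop :=
  threshold p d (t + 1) < (dataBefore p C h t).length ∧
    ¬ Reliable p β (t + 1) (dataBefore p C h t)

section Path

variable {p : Params} {C : ℕ → Set (Vec d)} {β : Vec d}

theorem length_design_le {t : ℕ} (h : Fin t → Vec d × ℝ) : (design p C t h).length ≤ t := by
  induction t with
  | zero => simp [design]
  | succ t ih =>
    have := ih fun i => h i.castSucc
    by_cases he : Explores p (C t) (t + 1) (design p C t fun i => h i.castSucc)
    · rw [design_succ_of_explores he, List.length_cons]
      omega
    · rw [design_succ_of_not_explores he]
      omega

theorem design_suffix {t T : ℕ} (ht : t ≤ T) (h : Fin T → Vec d × ℝ) :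
    (design p C t fun i => h (Fin.castLE ht i)) <:+ design p C T h := by
  induction T, ht using Nat.le_induction with
  | base => exact List.suffix_rfl
  | succ T ht ih =>
    refine (ih fun i => h i.castSucc).trans ?_
    by_cases he : Explores p (C T) (T + 1) (design p C T fun i => h i.castSucc)
    · rw [design_succ_of_explores he]
      exact List.suffix_cons _ _
    · rw [design_succ_of_not_explores he]

/-- Replaces the random data before a round by a prefix of the final record, so that a union over
deterministic `n` applies. -/
theorem rtake_design {T : ℕ} (h : Fin T → Vec d × ℝ) (t : Fin T) :
    (design p C T h).rtake (dataBefore p C h t).length = dataBefore p C h t :=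
  (List.suffix_iff_eq_drop.1 (design_suffix t.isLt.le h)).symm

theorem Misled.mem_unreliableSet {T : ℕ} {h : Fin T → Vec d × ℝ} {t : Fin T}
    (hm : Misled p C β h t) :
    h ∈ unreliableSet p T C β (dataBefore p C h t).length (t + 1) := by
  refine ⟨hm.1, ?_, ?_⟩
  · rw [rtake_design]
  · rw [rtake_design]
    exact hm.2

theorem threshold_mono (hd : 0 < d) (hδ : 0 < p.δ) (hc : 0 ≤ p.c) (hlam : 0 < p.lam) {s s' : ℕ}
    (hs : 0 < s) (hss' : s ≤ s') : threshold p d s ≤ threshold p d s' := by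
  have hcs := conf_anti hc hs hss'
  have hu := conf_pos hδ (hs.trans_le hss')
  have hs0 : (0 : ℝ) < s := by exact_mod_cast hs
  have hd0 : (0 : ℝ) < d := by exact_mod_cast hd
  have hss : (s : ℝ) ≤ s' := by exact_mod_cast hss'
  have hu' := conf_pos hδ hs
  unfold threshold
  gcongr

/-- The data number `n ≤ t`, so level `n + 1` is no later than level `t + 1`: its threshold is no
larger, and its reliability persists. -/
theorem not_misled_of_notMem (hd : 0 < d) (hδ : 0 < p.δ) (hc : 0 ≤ p.c) (hr : 0 ≤ p.r)
    (hlam : 0 < p.lam) {T : ℕ} {h : Fin T → Vec d × ℝ}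
    (hh : h ∉ ⋃ n ∈ Finset.range T, unreliableSet p T C β n (n + 1)) (t : Fin T) :
    ¬ Misled p C β h t := by
  intro hm
  have hlen : (dataBefore p C h t).length ≤ t := length_design_le _
  refine hh (Set.mem_iUnion₂.2 ⟨(dataBefore p C h t).length,
    Finset.mem_range.2 (hlen.trans_lt t.2), ?_, ?_, ?_⟩)
  · exact (threshold_mono hd hδ hc hlam (Nat.succ_pos _) (by omega)).trans_lt hm.1
  · rw [rtake_design]
  · rw [rtake_design]
    exact fun hrel => hm.2 (hrel.mono hd hδ hc hr hlam (Nat.succ_pos _) (by omega))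

open Classical in
/-- At most `B + 1` exploration rounds start with at most `B` observations. -/
theorem sum_explores_le {B : ℝ} (hB : 0 ≤ B) {T : ℕ} (h : Fin T → Vec d × ℝ) :
    ∑ t : Fin T, (if Explores p (C t) (t + 1) (dataBefore p C h t) ∧
      ((dataBefore p C h t).length : ℝ) ≤ B then (1 : ℝ) else 0) ≤ B + 1 := by
  -- Strengthened for the induction: the count is also at most the number of recorded observations,
  -- which is at most `B` whenever a new round is counted.
  suffices H : ∑ t : Fin T, (if Explores p (C t) (t + 1) (dataBefore p C h t) ∧
      ((dataBefore p C h t).length : ℝ) ≤ B then (1 : ℝ) else 0) ≤ (design p C T h).length ∧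
      ∑ t : Fin T, (if Explores p (C t) (t + 1) (dataBefore p C h t) ∧
      ((dataBefore p C h t).length : ℝ) ≤ B then (1 : ℝ) else 0) ≤ B + 1 from H.2
  induction T with
  | zero => simp only [Finset.univ_eq_empty, Finset.sum_empty]; exact ⟨by positivity, by linarith⟩
  | succ T ih =>
    obtain ⟨ih1, ih2⟩ := ih fun i => h i.castSucc
    rw [Fin.sum_univ_castSucc]
    have hpre : ∀ t : Fin T, dataBefore p C h t.castSucc =
        dataBefore p C (fun i => h i.castSucc) t := fun t => rfl
    have hlast : dataBefore p C h (Fin.last T) = design p C T fun i => h i.castSucc := rfl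
    simp only [hpre, hlast, Fin.val_castSucc, Fin.val_last]
    by_cases he : Explores p (C T) (T + 1) (design p C T fun i => h i.castSucc)
    · rw [design_succ_of_explores he, List.length_cons]
      push_cast
      by_cases hl : ((design p C T fun i => h i.castSucc).length : ℝ) ≤ B
      · rw [if_pos ⟨he, hl⟩]
        constructor <;> linarith
      · rw [if_neg fun hh => hl hh.2]
        constructor <;> linarith
    · rw [design_succ_of_not_explores he, if_neg fun hh => he hh.1]
      constructor <;> linarith

end Path

section Law

variable {p : Params} {T : ℕ} {C : ℕ → Set (Vec d)} {β : Vec d} {ν : ℕ → Kernel (Vec d) ℝ} {r : ℝ}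
  {R : ℝ≥0}

theorem IsInstance.params_nonneg (hI : IsInstance T C β ν r R) (hd : 0 < d) (hT : 0 < T)
    (hpr : p.r = r) (hpR : p.R = R) (hpl : p.lam = lambdaMin T C) :
    0 < p.r ∧ 0 ≤ p.R ∧ 0 < p.lam := by
  rw [hpr, hpR, hpl]
  exact ⟨hI.radius_pos hd hT, R.2, hI.lambdaMin_pos hd hT⟩

theorem IsInstance.abs_inner_sub_le_width (hI : IsInstance T C β ν r R) (hd : 0 < d) (hT : 0 < T)
    (hpr : p.r = r) (hpR : p.R = R) (hpl : p.lam = lambdaMin T C) (hδ : 0 < p.δ) (hc : 0 ≤ p.c)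
    {h : Fin T → Vec d × ℝ} {t : Fin T} (hm : ¬ Misled p C β h t)
    (hn : threshold p d (t + 1) < (dataBefore p C h t).length) {x : Vec d} (hx : x ∈ C t) :
    |(inner ℝ (leastSquares (dataBefore p C h t)) x : ℝ) - inner ℝ β x| ≤
      p.width d (dataBefore p C h t).length (t + 1) := by
  obtain ⟨hr, hR, hlam⟩ := hI.params_nonneg hd hT hpr hpR hpl
  have hlog := log_mul_div_conf_pos hδ hc (Nat.succ_pos t)
  have hn0 : (0 : ℝ) < (dataBefore p C h t).length := by
    have := hI.two_mul_log_lt hd hT hpr hpl hδ hc (Nat.succ_pos t) hn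
    linarith
  have hrel : Reliable p β (t + 1) (dataBefore p C h t) := by
    by_contra hcon
    exact hm ⟨hn, hcon⟩
  exact hrel.abs_inner_sub_le hr.le hR hlam hlog.le hn (by exact_mod_cast hn0)
    (hpr ▸ hI.norm_le t.2 hx)

theorem IsInstance.inner_lt_of_not_misled (hI : IsInstance T C β ν r R) (hd : 0 < d) (hT : 0 < T)
    (hpr : p.r = r) (hpR : p.R = R) (hpl : p.lam = lambdaMin T C) (hδ : 0 < p.δ) (hc : 0 ≤ p.c)
    {h : Fin T → Vec d × ℝ} {t : Fin T} (hm : ¬ Misled p C β h t)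
    (he : ¬ Explores p (C t) (t + 1) (dataBefore p C h t)) {z : Vec d} (hz : z ∈ C t)
    (hne : z ≠ topExtreme (C t) (leastSquares (dataBefore p C h t))) :
    inner ℝ β z < inner ℝ β (topExtreme (C t) (leastSquares (dataBefore p C h t))) := by
  obtain ⟨hr, hR, hlam⟩ := hI.params_nonneg hd hT hpr hpR hpl
  have hn := (lt_topGap_of_not_explores (hI.isCompact t.2) (hI.nontrivial hd t.2) hr.le hR hlam
    he).1
  exact inner_lt_topExtreme_of_not_explores (hI.isCompact t.2) (hI.nontrivial hd t.2) hr.le hR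
    hlam he (fun x hx => hI.abs_inner_sub_le_width hd hT hpr hpR hpl hδ hc hm hn hx) hz hne

theorem IsInstance.roundFair_of_not_misled (hI : IsInstance T C β ν r R) (hd : 0 < d) (hT : 0 < T)
    (hpr : p.r = r) (hpR : p.R = R) (hpl : p.lam = lambdaMin T C) (hδ : 0 < p.δ) (hc : 0 ≤ p.c)
    {h : Fin T → Vec d × ℝ} {t : Fin T} (hm : ¬ Misled p C β h t) :
    RoundFair (C t) β (playDist p (C t) (t + 1) (dataBefore p C h t)) := by
  have hC := hI.isCompact t.2
  rw [playDist]
  split_ifs with he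
  · exact roundFair_cond hC (hI.volume_pos t t.2) β
  · exact roundFair_dirac hC.measurableSet (topExtreme_mem hC (hI.nonempty t.2) _)
      fun z hz hne => hI.inner_lt_of_not_misled hd hT hpr hpR hpl hδ hc hm he hz hne

theorem IsInstance.historyLaw_iUnion_le (hI : IsInstance T C β ν r R) (hd : 0 < d)
    (hT : 0 < T) (hR : 0 < R) (hpr : p.r = r) (hpR : p.R = R)
    (hpl : p.lam = lambdaMin T C) (hδ : 0 < p.δ) (hc : 0 ≤ p.c) :
    historyLaw p C ν T (⋃ n ∈ Finset.range T, unreliableSet p T C β n (n + 1)) ≤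
      ENNReal.ofReal p.δ := by
  obtain ⟨hr, hR', hlam⟩ := hI.params_nonneg hd hT hpr hpR hpl
  have := hI.isProbabilityMeasure_historyLaw hd hr.le hR' hlam le_rfl (ν := ν)
  rw [← ofReal_measureReal (measure_ne_top _ _)]
  exact ENNReal.ofReal_le_ofReal
    (hI.historyLaw_iUnion_unreliableSet_le hd hT hR hpr hpR hpl hδ hc)

theorem IsInstance.historyLaw_not_fairHistory_le (hI : IsInstance T C β ν r R) (hd : 0 < d)
    (hT : 0 < T) (hR : 0 < R) (hpr : p.r = r) (hpR : p.R = R)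
    (hpl : p.lam = lambdaMin T C) (hδ : 0 < p.δ) (hc : 0 ≤ p.c) :
    historyLaw p C ν T {h | ¬ FairHistory p T C β h} ≤ ENNReal.ofReal p.δ := by
  obtain ⟨hr, hR', hlam⟩ := hI.params_nonneg hd hT hpr hpR hpl
  refine (measure_mono fun h hh => ?_).trans
    (hI.historyLaw_iUnion_le hd hT hR hpr hpR hpl hδ hc)
  by_contra hcon
  exact hh fun t => hI.roundFair_of_not_misled hd hT hpr hpR hpl hδ hc
    (not_misled_of_notMem hd hδ hc hr.le hlam hcon t)

/-! ### Exploitation rounds -/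

theorem IsInstance.ae_historyLaw_succ (hI : IsInstance T C β ν r R) (hd : 0 < d)
    (hr : 0 ≤ p.r) (hR : 0 ≤ p.R) (hlam : 0 < p.lam) {t : ℕ} (ht : t < T)
    {S : Set (Fin (t + 1) → Vec d × ℝ)} (hS : MeasurableSet S)
    (h : ∀ᵐ h ∂(historyLaw p C ν t), ∀ᵐ x ∂(actionDist p C t h), ∀ᵐ y ∂(ν t x),
      Fin.snoc (α := fun _ => Vec d × ℝ) h (x, y) ∈ S) :
    ∀ᵐ h ∂(historyLaw p C ν (t + 1)), h ∈ S := by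
  rw [ae_iff, ← Set.compl_ofPred, Set.ofPred_mem_eq, ← lintegral_indicator_one hS.compl,
    hI.lintegral_historyLaw_succ hd hr hR hlam ht (measurable_one.indicator hS.compl)]
  refine lintegral_eq_zero_of_ae_eq_zero ?_
  filter_upwards [h] with h hh
  refine lintegral_eq_zero_of_ae_eq_zero ?_
  filter_upwards [hh] with x hx
  refine lintegral_eq_zero_of_ae_eq_zero ?_
  filter_upwards [hx] with y hy
  exact Set.indicator_of_notMem (Set.notMem_compl_iff.2 hy) _

/-- Almost surely the estimated best extreme point is played whenever the algorithm does not
explore. -/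
theorem IsInstance.ae_historyLaw_exploit (hI : IsInstance T C β ν r R) (hd : 0 < d)
    (hr : 0 ≤ p.r) (hR : 0 ≤ p.R) (hlam : 0 < p.lam) {t : ℕ} (ht : t ≤ T) :
    ∀ᵐ h ∂(historyLaw p C ν t), ∀ i : Fin t,
      ¬ Explores p (C i) (i + 1) (dataBefore p C h i) →
        (h i).1 = topExtreme (C i) (leastSquares (dataBefore p C h i)) := by
  induction t with
  | zero => exact Filter.Eventually.of_forall fun h i => i.elim0
  | succ t ih =>
    have hmeas : MeasurableSet {h : Fin (t + 1) → Vec d × ℝ | ∀ i : Fin (t + 1),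
        ¬ Explores p (C i) (i + 1) (dataBefore p C h i) →
          (h i).1 = topExtreme (C i) (leastSquares (dataBefore p C h i))} := by
      simp only [Set.ofPred_forall]
      refine MeasurableSet.iInter fun i => ?_
      have hi : (i : ℕ) < T := by omega
      have hC := hI.isCompact hi
      have hnt := hI.nontrivial hd hi
      obtain ⟨E, hEm, hE⟩ := exists_measurableSet_explores hC hnt p (i + 1)
      have hD : Measurable fun h : Fin (t + 1) → Vec d × ℝ => stat (dataBefore p C h i) :=
        (hI.measurable_stat_design hd p hi.le).comp
          (measurable_pi_iff.2 fun j => measurable_pi_apply _)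
      have hg := (measurable_topExtreme_of_topGap_pos hC hnt).comp (measurable_estimator.comp hD)
      refine MeasurableSet.congr ((hD hEm).union (measurableSet_eq_fun
        (measurable_fst.comp (measurable_pi_apply i)) hg)) ?_
      ext h
      by_cases he : Explores p (C i) (i + 1) (dataBefore p C h i)
      · exact ⟨fun _ hne => absurd he hne, fun _ => Or.inl ((hE _).1 he)⟩
      · obtain ⟨-, h3, h4⟩ := lt_topGap_of_not_explores hC hnt hr hR hlam he
        have hpos : 0 < topGap (C i) (estimator (stat (dataBefore p C h i))) := by
          rw [estimator_stat]
          linarith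
        constructor
        · rintro (h1 | h1) _
          · exact absurd ((hE _).2 h1) he
          · have h2 : (h i).1 = if 0 < topGap (C i) (estimator (stat (dataBefore p C h i))) then
                topExtreme (C i) (estimator (stat (dataBefore p C h i))) else 0 := h1
            rwa [if_pos hpos, estimator_stat] at h2
        · intro h1
          refine Or.inr ?_
          change (h i).1 = if 0 < topGap (C i) (estimator (stat (dataBefore p C h i))) then
                topExtreme (C i) (estimator (stat (dataBefore p C h i))) else 0
          rw [if_pos hpos, estimator_stat]
          exact h1 he
    refine hI.ae_historyLaw_succ hd hr hR hlam ht hmeas ?_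
    filter_upwards [ih (by omega)] with h hh
    have hx : ∀ᵐ x ∂(actionDist p C t h), ¬ Explores p (C t) (t + 1) (design p C t h) →
        x = topExtreme (C t) (leastSquares (design p C t h)) := by
      rw [actionDist, playDist]
      split_ifs with he
      · exact Filter.Eventually.of_forall fun x hne => absurd he hne
      · rw [ae_dirac_eq]
        exact fun _ => rfl
    filter_upwards [hx] with x hx
    refine Filter.Eventually.of_forall fun y i => ?_
    refine Fin.lastCases ?_ (fun i => ?_) i
    · have : dataBefore p C (Fin.snoc (α := fun _ => Vec d × ℝ) h (x, y)) (Fin.last t) =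
          design p C t h := congrArg (design p C t) (snoc_comp_castSucc h (x, y))
      rw [this, Fin.snoc_last]
      exact hx
    · have : dataBefore p C (Fin.snoc (α := fun _ => Vec d × ℝ) h (x, y)) i.castSucc =
          dataBefore p C h i := by
        change dataBefore p C (fun i : Fin t => Fin.snoc (α := fun _ => Vec d × ℝ) h (x, y)
          i.castSucc) i = _
        rw [snoc_comp_castSucc]
      rw [this, Fin.snoc_castSucc]
      exact hh i

end Law

end FairBandit

namespace FairBandit

variable {d : ℕ}

/-! ### Number of exploration rounds -/

/-- Number of observations after which reliable data end the exploration, up to round `s`, when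
the gap is `Δ`. -/
noncomputable def explorationBound (p : Params) (d s : ℕ) (Δ : ℝ) : ℝ :=
  4 * p.r ^ 2 * Real.log (2 * d * s / p.conf s) / p.lam +
    128 * p.r ^ 4 * p.R ^ 2 * Real.log (2 * s / p.conf s) / (p.lam ^ 2 * Δ ^ 2)

theorem explorationBound_mono {p : Params} (hd : 0 < d) (hδ : 0 < p.δ) (hc : 0 ≤ p.c)
    (hlam : 0 < p.lam) {s s' : ℕ} (hs : 0 < s) (hss' : s ≤ s') (Δ : ℝ) :
    explorationBound p d s Δ ≤ explorationBound p d s' Δ := by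
  have hcs := conf_anti hc hs hss'
  have hu := conf_pos hδ (hs.trans_le hss')
  have hs0 : (0 : ℝ) < s := by exact_mod_cast hs
  have hd0 : (0 : ℝ) < d := by exact_mod_cast hd
  have hss : (s : ℝ) ≤ s' := by exact_mod_cast hss'
  have hu' := conf_pos hδ hs
  unfold explorationBound
  gcongr

theorem explorationBound_nonneg {p : Params} (hd : 0 < d) (hδ : 0 < p.δ) (hc : 0 ≤ p.c)
    (hlam : 0 < p.lam) {s : ℕ} (hs : 0 < s) (Δ : ℝ) : 0 ≤ explorationBound p d s Δ := by
  have h1 := log_mul_div_conf_pos hδ hc hs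
  have h2 := log_le_log_dim hd hδ hs
  have h3 := h1.trans_le h2
  unfold explorationBound
  positivity

/-- Since `κ √n = √n - a` with `a = r √(2E/λ)`, the condition `Δ ≤ 4w` reads `√n ≤ a + b`, whence `n
≤ 2a² + 2b²`. Up to the threshold already `n ≤ a²`. -/
theorem le_explorationBound_of_le_width {p : Params} (hd : 0 < d) (hδ : 0 < p.δ) (hc : 0 ≤ p.c)
    (hr : 0 ≤ p.r) (hlam : 0 < p.lam) {n s : ℕ} (hs : 0 < s) {Δ : ℝ} (hΔ : 0 < Δ)
    (hn : threshold p d s < n → 0 < n ∧ Δ ≤ 4 * p.width d n s) :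
    (n : ℝ) ≤ explorationBound p d s Δ := by
  have hL := log_mul_div_conf_pos hδ hc hs
  have hE := hL.trans_le (log_le_log_dim hd hδ hs)
  rw [explorationBound]
  set L := Real.log (2 * s / p.conf s) with hLdef
  set E := Real.log (2 * d * s / p.conf s) with hEdef
  have hb0 : 0 ≤ 128 * p.r ^ 4 * p.R ^ 2 * L / (p.lam ^ 2 * Δ ^ 2) := by positivity
  have ha0 : 0 ≤ 2 * p.r ^ 2 * E / p.lam := by positivity
  have hsplit : 4 * p.r ^ 2 * E / p.lam = 2 * (2 * p.r ^ 2 * E / p.lam) := by ring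
  rcases le_or_gt (n : ℝ) (threshold p d s) with hle | hlt
  · rw [threshold, ← hEdef] at hle
    linarith
  obtain ⟨hn0, hw⟩ := hn hlt
  have hκ := kappa_pos hr hlam hlt hn0
  have hn' : (0 : ℝ) < n := by exact_mod_cast hn0
  have hq : 0 < √(n : ℝ) := Real.sqrt_pos.2 hn'
  rw [Params.width, ← hLdef] at hw
  have hκq : kappa d p.r p.lam (p.conf s) n s * √(n : ℝ) = √(n : ℝ) - p.r * √(2 * E / p.lam) := by
    rw [kappa, ← hEdef, mul_comm (n : ℝ) p.lam, ← div_div, Real.sqrt_div (by positivity)]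
    field_simp
  set κ := kappa d p.r p.lam (p.conf s) n s
  set a := p.r * √(2 * E / p.lam) with ha
  set b := 8 * p.r ^ 2 * p.R * √L / (p.lam * Δ) with hb
  have hle : √(n : ℝ) ≤ a + b := by
    rw [mul_right_comm κ, hκq] at hw
    have hpos : 0 < √(n : ℝ) - a := by
      rw [← hκq]
      positivity
    rw [← mul_div_assoc, le_div_iff₀ (by positivity)] at hw
    have : √(n : ℝ) - a ≤ b := by
      rw [hb, le_div_iff₀ (by positivity)]
      linarith
    linarith
  have ha2 : a ^ 2 = 2 * p.r ^ 2 * E / p.lam := by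
    rw [ha, mul_pow, Real.sq_sqrt (by positivity)]
    ring
  have hb2 : 2 * b ^ 2 = 128 * p.r ^ 4 * p.R ^ 2 * L / (p.lam ^ 2 * Δ ^ 2) := by
    rw [hb, div_pow, mul_pow, mul_pow, mul_pow, Real.sq_sqrt hL.le]
    ring
  rw [hsplit, ← ha2, ← hb2, ← Real.sq_sqrt hn'.le]
  nlinarith [sq_nonneg (a - b), pow_le_pow_left₀ hq.le hle 2]

section Law

variable {p : Params} {T : ℕ} {C : ℕ → Set (Vec d)} {β : Vec d} {ν : ℕ → Kernel (Vec d) ℝ} {r : ℝ}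
  {R : ℝ≥0}

theorem IsInstance.length_dataBefore_le (hI : IsInstance T C β ν r R) (hd : 0 < d) (hT : 0 < T)
    (hpr : p.r = r) (hpR : p.R = R) (hpl : p.lam = lambdaMin T C) (hδ : 0 < p.δ) (hc : 0 ≤ p.c)
    (hΔ : 0 < gapMin T C β) {h : Fin T → Vec d × ℝ} {t : Fin T} (hm : ¬ Misled p C β h t)
    (he : Explores p (C t) (t + 1) (dataBefore p C h t)) :
    ((dataBefore p C h t).length : ℝ) ≤ explorationBound p d T (gapMin T C β) := by
  obtain ⟨hr, hR, hlam⟩ := hI.params_nonneg hd hT hpr hpR hpl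
  refine le_trans ?_ (explorationBound_mono hd hδ hc hlam (Nat.succ_pos t) t.2 _)
  refine le_explorationBound_of_le_width hd hδ hc hr.le hlam (Nat.succ_pos t) hΔ fun hn => ?_
  refine ⟨?_, (gapMin_le t.2).trans ?_⟩
  · have h1 := hI.two_mul_log_lt hd hT hpr hpl hδ hc (Nat.succ_pos t) hn
    have h2 := log_mul_div_conf_pos hδ hc (Nat.succ_pos t)
    have : (0 : ℝ) < (dataBefore p C h t).length := by linarith
    exact_mod_cast this
  · exact gap_le_width_of_explores (hI.isCompact t.2) (hI.nontrivial hd t.2) he hn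
      fun x hx => hI.abs_inner_sub_le_width hd hT hpr hpR hpl hδ hc hm hn hx

/-! ### Regret along a history -/

theorem IsInstance.bestReward_sub_le_two (hI : IsInstance T C β ν r R) {t : ℕ} (ht : t < T)
    {x : Vec d} (hx : x ∈ C t) : bestReward (C t) β - inner ℝ β x ≤ 2 := by
  have hC := hI.isCompact ht
  have h1 := abs_le.1 (hI.abs_inner_le_one ht hx)
  have h2 := abs_le.1 (hI.abs_inner_le_one ht (topExtreme_mem hC (hI.nonempty ht) β))
  rw [bestReward_eq hC (hI.nonempty ht)]
  linarith [h1.1, h2.2]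

open Classical in
-- A round costs at most `2`. Rounds that are not misled cost nothing when exploiting, and those
-- that explore are few by `sum_explores_le`.
theorem IsInstance.ae_realizedRegret_le (hI : IsInstance T C β ν r R) (hd : 0 < d) (hT : 0 < T)
    (hpr : p.r = r) (hpR : p.R = R) (hpl : p.lam = lambdaMin T C) (hδ : 0 < p.δ) (hc : 0 ≤ p.c)
    (hΔ : 0 < gapMin T C β) :
    ∀ᵐ h ∂(historyLaw p C ν T), realizedRegret T C β h ≤
      2 * (explorationBound p d T (gapMin T C β) + 1) +
        2 * ∑ t : Fin T, if Misled p C β h t then (1 : ℝ) else 0 := by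
  obtain ⟨hr, hR, hlam⟩ := hI.params_nonneg hd hT hpr hpR hpl
  filter_upwards [hI.ae_historyLaw_mem hd hr.le hR hlam le_rfl,
    hI.ae_historyLaw_exploit hd hr.le hR hlam le_rfl] with h hmem hexp
  have hcount := sum_explores_le (p := p) (C := C)
    (explorationBound_nonneg hd hδ hc hlam hT (gapMin T C β)) h
  refine le_trans ?_ (add_le_add_left (mul_le_mul_of_nonneg_left hcount two_pos.le) _)
  rw [realizedRegret, Finset.mul_sum, Finset.mul_sum, ← Finset.sum_add_distrib]
  refine Finset.sum_le_sum fun t _ => ?_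
  have h2 := hI.bestReward_sub_le_two t.2 (hmem t).1
  by_cases hm : Misled p C β h t
  · rw [if_pos hm]
    split_ifs <;> linarith
  · rw [if_neg hm]
    by_cases he : Explores p (C t) (t + 1) (dataBefore p C h t)
    · rw [if_pos ⟨he, hI.length_dataBefore_le hd hT hpr hpR hpl hδ hc hΔ hm he⟩]
      linarith
    · rw [if_neg fun hh => he hh.1, hexp t he, bestReward_eq (hI.isCompact t.2) (hI.nonempty t.2)]
      have htop := topExtreme_mem (hI.isCompact t.2) (hI.nonempty t.2) β
      by_cases heq : topExtreme (C t) β = topExtreme (C t) (leastSquares (dataBefore p C h t))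
      · rw [heq]
        simp
      · have := hI.inner_lt_of_not_misled hd hT hpr hpR hpl hδ hc hm he htop heq
        linarith

theorem IsInstance.historyLaw_lt_realizedRegret_le (hI : IsInstance T C β ν r R) (hd : 0 < d)
    (hT : 0 < T) (hR : 0 < R) (hpr : p.r = r) (hpR : p.R = R) (hpl : p.lam = lambdaMin T C)
    (hδ : 0 < p.δ) (hc : 0 ≤ p.c) (hΔ : 0 < gapMin T C β) {B : ℝ}
    (hB : 2 * (explorationBound p d T (gapMin T C β) + 1) ≤ B) :
    historyLaw p C ν T {h | B < realizedRegret T C β h} ≤ ENNReal.ofReal p.δ := by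
  obtain ⟨hr, hR', hlam⟩ := hI.params_nonneg hd hT hpr hpR hpl
  refine (measure_mono_ae ?_).trans (hI.historyLaw_iUnion_le hd hT hR hpr hpR hpl hδ hc)
  filter_upwards [hI.ae_realizedRegret_le hd hT hpr hpR hpl hδ hc hΔ] with h hh hlt
  by_contra hcon
  have hlt' : B < realizedRegret T C β h := hlt
  have hm := not_misled_of_notMem hd hδ hc hr.le hlam hcon
  simp only [hm, if_false, Finset.sum_const_zero] at hh
  linarith

/-! ### Pseudo-regret -/

theorem IsInstance.integrable_inner (hI : IsInstance T C β ν r R) (hd : 0 < d)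
    (hr : 0 ≤ p.r) (hR : 0 ≤ p.R) (hlam : 0 < p.lam) {t : ℕ} (ht : t ≤ T) (i : Fin t) :
    Integrable (fun h => inner ℝ β (h i).1) (historyLaw p C ν t) := by
  have := hI.isProbabilityMeasure_historyLaw hd hr hR hlam ht (ν := ν)
  refine Integrable.of_bound (C := 1) ?_ ?_
  · exact (measurable_const.inner (measurable_fst.comp (measurable_pi_apply i))).aestronglyMeasurable
  · filter_upwards [hI.ae_historyLaw_mem hd hr hR hlam ht] with h hh
    exact hI.abs_inner_le_one (i.2.trans_le ht) (hh i).1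

theorem IsInstance.integrable_reward (hI : IsInstance T C β ν r R) (hd : 0 < d)
    (hr : 0 ≤ p.r) (hR : 0 ≤ p.R) (hlam : 0 < p.lam) {t : ℕ} (ht : t ≤ T) (i : Fin t) :
    Integrable (fun h => (h i).2) (historyLaw p C ν t) := by
  have := hI.isProbabilityMeasure_historyLaw hd hr hR hlam ht (ν := ν)
  refine Integrable.of_bound (C := 1) ?_ ?_
  · exact (measurable_snd.comp (measurable_pi_apply i)).aestronglyMeasurable
  · filter_upwards [hI.ae_historyLaw_mem hd hr hR hlam ht] with h hh
    exact abs_le.2 (hh i).2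

theorem IsInstance.integral_noise_eq_zero (hI : IsInstance T C β ν r R) (hd : 0 < d)
    (hr : 0 ≤ p.r) (hR : 0 ≤ p.R) (hlam : 0 < p.lam) {t : ℕ} (ht : t ≤ T) :
    ∫ h, ∑ i : Fin t, ((h i).2 - inner ℝ β (h i).1) ∂(historyLaw p C ν t) = 0 := by
  induction t with
  | zero => simp
  | succ t ih =>
    have hint : Integrable (fun h : Fin (t + 1) → Vec d × ℝ =>
        ∑ i : Fin (t + 1), ((h i).2 - inner ℝ β (h i).1)) (historyLaw p C ν (t + 1)) :=
      integrable_finsetSum _ fun i _ =>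
        (hI.integrable_reward hd hr hR hlam ht i).sub (hI.integrable_inner hd hr hR hlam ht i)
    rw [hI.integral_historyLaw_succ hd hr hR hlam ht hint, ← ih (by omega)]
    refine integral_congr_ae (Filter.Eventually.of_forall fun h => ?_)
    have := hI.isProbabilityMeasure_actionDist p ht h
    have := hI.markov t ht
    have hx : ∀ᵐ x ∂(actionDist p C t h), ∫ y, ∑ i : Fin (t + 1),
        ((Fin.snoc (α := fun _ => Vec d × ℝ) h (x, y) i).2 -
          inner ℝ β (Fin.snoc (α := fun _ => Vec d × ℝ) h (x, y) i).1) ∂(ν t x) =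
        ∑ i : Fin t, ((h i).2 - inner ℝ β (h i).1) := by
      filter_upwards [hI.ae_actionDist_mem p ht h] with x hx
      simp only [Fin.sum_univ_castSucc, Fin.snoc_castSucc, Fin.snoc_last]
      have hint : Integrable (fun y : ℝ => y) (ν t x) := by
        refine Integrable.of_bound (C := 1) measurable_id.aestronglyMeasurable ?_
        filter_upwards [hI.reward_mem t ht x hx] with y hy
        exact abs_le.2 hy
      have hsub : Integrable (fun y : ℝ => y - inner ℝ β x) (ν t x) :=
        hint.sub (integrable_const _)
      rw [integral_add (integrable_const _) hsub, integral_sub hint (integrable_const _), hI.reward_mean t ht x hx]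
      simp
    simp only
    rw [integral_congr_ae hx]
    simp

theorem IsInstance.integrable_realizedRegret (hI : IsInstance T C β ν r R) (hd : 0 < d)
    (hr : 0 ≤ p.r) (hR : 0 ≤ p.R) (hlam : 0 < p.lam) :
    Integrable (realizedRegret T C β) (historyLaw p C ν T) := by
  have := hI.isProbabilityMeasure_historyLaw hd hr hR hlam le_rfl (ν := ν)
  exact integrable_finsetSum _ fun i _ =>
    (integrable_const _).sub (hI.integrable_inner hd hr hR hlam le_rfl i)

theorem IsInstance.pseudoRegret_eq (hI : IsInstance T C β ν r R) (hd : 0 < d)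
    (hr : 0 ≤ p.r) (hR : 0 ≤ p.R) (hlam : 0 < p.lam) :
    pseudoRegret p T C β ν = ∫ h, realizedRegret T C β h ∂(historyLaw p C ν T) := by
  have := hI.isProbabilityMeasure_historyLaw hd hr hR hlam le_rfl (ν := ν)
  have hy : Integrable (fun h : Fin T → Vec d × ℝ => ∑ t : Fin T, (h t).2) (historyLaw p C ν T) :=
    integrable_finsetSum _ fun i _ => hI.integrable_reward hd hr hR hlam le_rfl i
  have hx : Integrable (fun h : Fin T → Vec d × ℝ => ∑ t : Fin T, (inner ℝ β (h t).1 : ℝ))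
      (historyLaw p C ν T) :=
    integrable_finsetSum _ fun i _ => hI.integrable_inner hd hr hR hlam le_rfl i
  have h0 := hI.integral_noise_eq_zero hd hr hR hlam le_rfl
  simp only [Finset.sum_sub_distrib] at h0
  rw [integral_sub hy hx, sub_eq_zero] at h0
  simp only [pseudoRegret, realizedRegret, Finset.sum_sub_distrib]
  rw [integral_sub (integrable_const _) hx, h0]
  simp

theorem IsInstance.pseudoRegret_le (hI : IsInstance T C β ν r R) (hd : 0 < d)
    (hT : 0 < T) (hR : 0 < R) (hpr : p.r = r) (hpR : p.R = R) (hpl : p.lam = lambdaMin T C)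
    (hδ : 0 < p.δ) (hc : 0 ≤ p.c) (hΔ : 0 < gapMin T C β) :
    pseudoRegret p T C β ν ≤ 2 * (explorationBound p d T (gapMin T C β) + 1) + 2 := by
  obtain ⟨hr, hR', hlam⟩ := hI.params_nonneg hd hT hpr hpR hpl
  have := hI.isProbabilityMeasure_historyLaw hd hr.le hR' hlam le_rfl (ν := ν)
  set μ := historyLaw p C ν T
  -- Measurable hulls have the same measure, so measurability of the unreliable sets need not be
  -- shown.
  set ind : ℕ → ℕ → (Fin T → Vec d × ℝ) → ℝ := fun t n =>
    (toMeasurable μ (unreliableSet p T C β n (t + 1))).indicator 1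
  have hind : ∀ t n h, 0 ≤ ind t n h := fun t n h =>
    Set.indicator_nonneg (fun _ _ => zero_le_one) h
  have hint : ∀ t n, Integrable (ind t n) μ := fun t n =>
    (integrable_const (1 : ℝ)).indicator (measurableSet_toMeasurable _ _)
  have hsum : Integrable (fun h => ∑ t ∈ Finset.range T, ∑ n ∈ Finset.range (t + 1), ind t n h) μ :=
    integrable_finsetSum _ fun t _ => integrable_finsetSum _ fun n _ => hint t n
  rw [hI.pseudoRegret_eq hd hr.le hR' hlam]
  calc ∫ h, realizedRegret T C β h ∂μ
      ≤ ∫ h, (2 * (explorationBound p d T (gapMin T C β) + 1) +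
          2 * ∑ t ∈ Finset.range T, ∑ n ∈ Finset.range (t + 1), ind t n h) ∂μ := by
        refine integral_mono_ae (hI.integrable_realizedRegret hd hr.le hR' hlam)
          ((integrable_const _).add (hsum.const_mul 2)) ?_
        filter_upwards [hI.ae_realizedRegret_le hd hT hpr hpR hpl hδ hc hΔ] with h hh
        refine hh.trans ?_
        gcongr
        rw [← Fin.sum_univ_eq_sum_range fun t => ∑ n ∈ Finset.range (t + 1), ind t n h]
        refine Finset.sum_le_sum fun t _ => ?_
        split_ifs with hm
        · have hlen : (dataBefore p C h t).length ≤ t := length_design_le _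
          refine le_trans (le_of_eq ?_) (Finset.single_le_sum (fun n _ => hind t n h)
            (Finset.mem_range.2 (Nat.lt_succ_of_le hlen)))
          exact (Set.indicator_of_mem (subset_toMeasurable _ _ hm.mem_unreliableSet) 1).symm
        · exact Finset.sum_nonneg fun n _ => hind t n h
    _ = 2 * (explorationBound p d T (gapMin T C β) + 1) +
          2 * ∑ t ∈ Finset.range T, ∑ n ∈ Finset.range (t + 1),
            μ.real (unreliableSet p T C β n (t + 1)) := by
        rw [integral_add (integrable_const _) (hsum.const_mul 2),
          integral_const_mul (2 : ℝ) fun h => ∑ t ∈ Finset.range T, ∑ n ∈ Finset.range (t + 1),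
            ind t n h, integral_finsetSum _ fun t _ => integrable_finsetSum _ fun n _ => hint t n]
        simp only [integral_finsetSum _ fun n _ => hint _ n]
        congr 2
        · simp
        · refine Finset.sum_congr rfl fun t _ => Finset.sum_congr rfl fun n _ => ?_
          rw [integral_indicator_one (measurableSet_toMeasurable _ _), measureReal_def,
            measure_toMeasurable, measureReal_def]
    _ ≤ _ := by
        have := hI.sum_historyLaw_unreliableSet_le hd hT hR hpr hpR hpl hδ hc
        linarith

/-! ### Comparison with the regret bound -/

theorem IsInstance.gapMin_le_two (hI : IsInstance T C β ν r R) (hd : 0 < d) (hT : 0 < T) :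
    gapMin T C β ≤ 2 := by
  have hC := hI.isCompact hT
  obtain ⟨z, hz, hne⟩ := exists_extremePoint_ne hC (hI.nontrivial hd hT) (topExtreme (C 0) β)
  refine (gapMin_le hT).trans ((gap_le_inner hC hz hne).trans ?_)
  rw [← bestReward_eq hC (hI.nonempty hT)]
  exact hI.bestReward_sub_le_two hT (extremePoints_subset hz)

/-- `κ > 0` means `2r² log (2dT/δ) < Tλ`; the logarithm is at least `1/2`, and `dλ ≤ r²` by the
trace bound. -/
theorem IsInstance.dim_le_of_kappa_pos (hI : IsInstance T C β ν r R) (hd : 0 < d) (hT : 0 < T)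
    {δ : ℝ} (hδ : 0 < δ) (hδ1 : δ ≤ 1) (hκ : 0 < kappa d r (lambdaMin T C) δ T T) : d ≤ T := by
  have hr := hI.radius_pos hd hT
  have hlam := hI.lambdaMin_pos hd hT
  have hcard := hI.card_mul_lambdaMin_le hT
  have hT' : (1 : ℝ) ≤ T := by exact_mod_cast hT
  have hd' : (1 : ℝ) ≤ d := by exact_mod_cast hd
  have hlog : 1 / 2 ≤ Real.log (2 * d * T / δ) := by
    have h1 : Real.log 2 ≤ Real.log (2 * d * T / δ) := by
      refine Real.log_le_log two_pos ?_
      rw [le_div_iff₀ hδ]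
      nlinarith [mul_le_mul hd' hT' zero_le_one (by linarith)]
    linarith [Real.log_two_gt_d9]
  rw [kappa, sub_pos] at hκ
  have h1 : r ^ 2 * (2 * Real.log (2 * d * T / δ) / (T * lambdaMin T C)) < 1 := by
    have h0 : 0 ≤ 2 * Real.log (2 * d * T / δ) / (T * lambdaMin T C) := by positivity
    have := pow_lt_pow_left₀ hκ (by positivity) two_ne_zero
    rwa [mul_pow, Real.sq_sqrt h0, one_pow] at this
  rw [← mul_div_assoc, div_lt_one (by positivity)] at h1
  have h2 : (d : ℝ) * lambdaMin T C ≤ T * lambdaMin T C := by nlinarith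
  exact_mod_cast le_of_mul_le_mul_right h2 hlam

theorem neg_log_conf_le (hδ : 0 < p.δ) (hδ1 : p.δ ≤ 1) (hc : 0 ≤ p.c) {s : ℕ} (hs : 0 < s) :
    -Real.log (p.conf s) ≤ (1 + p.c) * Real.log s - Real.log p.δ := by
  have hs' : (0 : ℝ) < s := by exact_mod_cast hs
  have h0 : 0 ≤ Real.log s := Real.log_natCast_nonneg s
  have h1 : Real.log p.δ ≤ 0 := Real.log_nonpos hδ.le hδ1
  rw [Params.conf]
  rcases min_choice p.δ (1 / (s : ℝ) ^ (1 + p.c)) with h | h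
  · rw [h]
    have : 0 ≤ (1 + p.c) * Real.log s := by positivity
    linarith
  · rw [h, one_div, Real.log_inv, Real.log_rpow hs']
    linarith

/-- All logarithms are multiples of `l = log (2T/δ)`, using `log d ≤ log T` and `neg_log_conf_le`.
The additive `4` is at most `8 r²l/λ`, which turns `3 + c` into `4 + c`. By `λ ≤ r²` and `Δ ≤ 2` the
term `r²l/λ` is at most `4/(r²R²)` times the main one; here and in the factor `1/r²` of the width
term the lower bounds on `r` and `R` enter. -/
theorem IsInstance.explorationBound_le (hI : IsInstance T C β ν r R) (hd : 0 < d) (hT : 0 < T)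
    (hR : 0 < R) (hpr : p.r = r) (hpR : p.R = R) (hpl : p.lam = lambdaMin T C) (hδ : 0 < p.δ)
    (hδ1 : p.δ ≤ 1) (hc : 0 ≤ p.c) (hΔ : 0 < gapMin T C β)
    (hκ : 0 < kappa d r (lambdaMin T C) p.δ T T) {r₀ R₀ : ℝ} (hr₀ : 0 < r₀) (hR₀ : 0 < R₀)
    (hr : r₀ ≤ r) (hRR : R₀ ≤ R) :
    2 * (explorationBound p d T (gapMin T C β) + 1) + 2 ≤
      (32 * (4 + p.c) / (r₀ ^ 2 * R₀ ^ 2) + 256 * (2 + p.c) / r₀ ^ 2) *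
        regretBound d T r R p.δ (lambdaMin T C) (gapMin T C β) := by
  have hlam := hI.lambdaMin_pos hd hT
  have hlamr := hI.lambdaMin_le hd hT
  have hr' := hI.radius_pos hd hT
  have hR' : (0 : ℝ) < R := hR
  have hΔ2 := hI.gapMin_le_two hd hT
  have hT' : (0 : ℝ) < T := by exact_mod_cast hT
  have hd' : (0 : ℝ) < d := by exact_mod_cast hd
  have hdT := hI.dim_le_of_kappa_pos hd hT hδ hδ1 hκ
  have hconf := neg_log_conf_le hδ hδ1 hc hT
  have hlogT : 0 ≤ Real.log T := Real.log_natCast_nonneg T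
  have hlogδ : Real.log p.δ ≤ 0 := Real.log_nonpos hδ.le hδ1
  have hlogd : Real.log d ≤ Real.log T := Real.log_le_log hd' (by exact_mod_cast hdT)
  have hlog2 := Real.log_two_gt_d9
  rw [explorationBound, regretBound, log_dim_mul_div_conf hd hδ hT, log_mul_div_conf hδ hT, hpr,
    hpR, hpl]
  have hl : Real.log (2 * T / p.δ) = Real.log 2 + Real.log T - Real.log p.δ := by
    rw [Real.log_div (by positivity) hδ.ne', Real.log_mul two_ne_zero hT'.ne']
  set l := Real.log (2 * T / p.δ)
  set lam := lambdaMin T C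
  set Δ := gapMin T C β
  set κ := kappa d r lam p.δ T T with hκdef
  have hκ1 : κ ≤ 1 := by
    rw [hκdef, kappa, sub_le_self_iff]
    positivity
  have hL : Real.log 2 + Real.log T - Real.log (p.conf T) ≤ (2 + p.c) * l := by
    rw [hl]
    nlinarith
  have hl0 : 1 / 2 ≤ l := by linarith
  have hE : Real.log 2 + Real.log T - Real.log (p.conf T) + Real.log d ≤ (3 + p.c) * l := by
    linarith
  set B := r ^ 6 * (R : ℝ) ^ 2 * l / (lam ^ 2 * Δ ^ 2) with hBdef
  have hB : B ≤ r ^ 6 * (R : ℝ) ^ 2 * l / (κ ^ 2 * lam ^ 2 * Δ ^ 2) := by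
    rw [hBdef]
    have : κ ^ 2 * lam ^ 2 * Δ ^ 2 ≤ lam ^ 2 * Δ ^ 2 := by
      rw [mul_assoc]
      exact mul_le_of_le_one_left (by positivity) (pow_le_one₀ hκ.le hκ1)
    gcongr
  have hB0 : 0 ≤ B := by positivity
  have hlr : r ^ 2 * l / lam ≤ 4 / (r₀ ^ 2 * R₀ ^ 2) * B := by
    have e1 : r ^ 2 * l / lam = lam * Δ ^ 2 / (r ^ 4 * (R : ℝ) ^ 2) * B := by
      rw [hBdef]
      field_simp
    have e2 : lam * Δ ^ 2 / (r ^ 4 * (R : ℝ) ^ 2) ≤ r ^ 2 * 2 ^ 2 / (r ^ 4 * (R : ℝ) ^ 2) := by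
      gcongr
    have e3 : r ^ 2 * 2 ^ 2 / (r ^ 4 * (R : ℝ) ^ 2) = 4 / (r ^ 2 * (R : ℝ) ^ 2) := by
      field_simp
      norm_num
    have e4 : 4 / (r ^ 2 * (R : ℝ) ^ 2) ≤ 4 / (r₀ ^ 2 * R₀ ^ 2) := by gcongr
    rw [e1]
    exact mul_le_mul_of_nonneg_right (by linarith) hB0
  have hone : 1 ≤ 2 * (r ^ 2 * l / lam) := by
    have : l ≤ r ^ 2 * l / lam := by
      rw [le_div_iff₀ hlam]
      nlinarith
    linarith
  have hwide : r ^ 4 * (R : ℝ) ^ 2 * l / (lam ^ 2 * Δ ^ 2) ≤ 1 / r₀ ^ 2 * B := by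
    have e1 : r ^ 4 * (R : ℝ) ^ 2 * l / (lam ^ 2 * Δ ^ 2) = 1 / r ^ 2 * B := by
      rw [hBdef]
      field_simp
    rw [e1]
    gcongr
  have h4 : 4 * r ^ 2 * (Real.log 2 + Real.log T - Real.log (p.conf T) + Real.log d) / lam ≤
      4 * (3 + p.c) * (r ^ 2 * l / lam) := by
    calc _ ≤ 4 * r ^ 2 * ((3 + p.c) * l) / lam := by gcongr
      _ = _ := by ring
  have h128 : 128 * r ^ 4 * (R : ℝ) ^ 2 * (Real.log 2 + Real.log T - Real.log (p.conf T)) /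
      (lam ^ 2 * Δ ^ 2) ≤ 128 * (2 + p.c) * (r ^ 4 * (R : ℝ) ^ 2 * l / (lam ^ 2 * Δ ^ 2)) := by
    calc _ ≤ 128 * r ^ 4 * (R : ℝ) ^ 2 * ((2 + p.c) * l) / (lam ^ 2 * Δ ^ 2) := by gcongr
      _ = _ := by ring
  have hlr' : 8 * (4 + p.c) * (r ^ 2 * l / lam) ≤
      8 * (4 + p.c) * (4 / (r₀ ^ 2 * R₀ ^ 2) * B) := by gcongr
  have hwide' : 256 * (2 + p.c) * (r ^ 4 * (R : ℝ) ^ 2 * l / (lam ^ 2 * Δ ^ 2)) ≤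
      256 * (2 + p.c) * (1 / r₀ ^ 2 * B) := by gcongr
  calc _ ≤ 8 * (4 + p.c) * (r ^ 2 * l / lam) +
        256 * (2 + p.c) * (r ^ 4 * (R : ℝ) ^ 2 * l / (lam ^ 2 * Δ ^ 2)) := by linarith
    _ ≤ (32 * (4 + p.c) / (r₀ ^ 2 * R₀ ^ 2) + 256 * (2 + p.c) / r₀ ^ 2) * B := by
        refine (add_le_add hlr' hwide').trans (le_of_eq ?_)
        ring
    _ ≤ _ := by gcongr

end Law

end FairBandit

/-! ### The theorem -/

open FairBandit in
theorem mainTheorem2 (c : ℝ) (hc : 0 < c) (r₀ R₀ : ℝ) (hr₀ : 0 < r₀) (hR₀ : 0 < R₀) :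
    ∃ K : ℝ, 0 < K ∧
      ∀ (d T : ℕ) (C : ℕ → Set (Vec d)) (β : Vec d) (ν : ℕ → Kernel (Vec d) ℝ)
        (r : ℝ) (R : ℝ≥0) (δ lam Δ : ℝ) (p : Params),
        0 < d → 0 < T → 0 < R → 0 < δ → δ ≤ 1 →
        IsInstance T C β ν r R →
        lam = lambdaMin T C → Δ = gapMin T C β → p = ⟨δ, c, r, R, lam⟩ →
        0 < lam ∧
        IsProbabilityMeasure (historyLaw p C ν T) ∧
        historyLaw p C ν T {h | ¬ FairHistory p T C β h} ≤ ENNReal.ofReal δ ∧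
        (r₀ ≤ r → R₀ ≤ R → 0 < Δ → 0 < kappa d r lam δ T T →
          pseudoRegret p T C β ν ≤ K * regretBound d T r R δ lam Δ ∧
          historyLaw p C ν T {h | K * regretBound d T r R δ lam Δ < realizedRegret T C β h}
            ≤ ENNReal.ofReal δ) := by
  refine ⟨32 * (4 + c) / (r₀ ^ 2 * R₀ ^ 2) + 256 * (2 + c) / r₀ ^ 2, by positivity, ?_⟩
  intro d T C β ν r R δ lam Δ p hd hT hR hδ hδ1 hI hlam hΔ hp
  have hpr : p.r = r := by rw [hp]
  have hpR : p.R = R := by rw [hp]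
  have hpl : p.lam = lambdaMin T C := by rw [hp, hlam]
  have hpδ : p.δ = δ := by rw [hp]
  have hpc : p.c = c := by rw [hp]
  have hδ' : 0 < p.δ := by rwa [hpδ]
  have hc' : 0 ≤ p.c := by rw [hpc]; exact hc.le
  obtain ⟨hr0, hR0, hlam0⟩ := hI.params_nonneg hd hT hpr hpR hpl
  refine ⟨hlam ▸ hI.lambdaMin_pos hd hT,
    hI.isProbabilityMeasure_historyLaw hd hr0.le hR0 hlam0 le_rfl,
    hpδ ▸ hI.historyLaw_not_fairHistory_le hd hT hR hpr hpR hpl hδ' hc', ?_⟩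
  intro hr hRR hΔ0 hκ
  rw [hΔ] at hΔ0
  have hbound := hI.explorationBound_le hd hT hR hpr hpR hpl hδ' (hpδ ▸ hδ1) hc' hΔ0
    (by rwa [hpδ, ← hlam]) hr₀ hR₀ hr hRR
  rw [hpc, hpδ, ← hlam, ← hΔ] at hbound
  refine ⟨(hI.pseudoRegret_le hd hT hR hpr hpR hpl hδ' hc' hΔ0).trans (hΔ ▸ hbound), ?_⟩
  rw [← hpδ] at hbound ⊢
  refine hI.historyLaw_lt_realizedRegret_le hd hT hR hpr hpR hpl hδ' hc' hΔ0 ?_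
  rw [← hΔ]
  linarith
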